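/- **Setting.** Let $K$ be a commutative ring. Let $\Gamma$ be a quiver with vertex set $I$ and arrow set $A$ (possibly infinite), origin and target maps $o,t:A\to I$, without loops and with finitely many arrows between any two vertices. Write $|i\to j|$ for the number of arrows from $i$ to $j$, and $i\cdot j=|i\to j|+|j\to i|$. Put $d(i,j)=i\cdot j$ if $i\ne j$ and $d(i,i)=-2$; put $Q_{ij}(u,v)=(-1)^{|i\to j|}(u-v)^{i\cdot j}$ if $i\neq j$ and $Q_{ii}=0$. Let $\theta$ be an involution of $I$ and of $A$ with $\theta(o(a))=t(\theta(a))$ for all $a\in A$. Let $\lambda\in\mathbb N^I$ and $\gamma\in K^I$; put $d(i)=\lambda_i+\lambda_{\theta(i)}$ if $\gamma_i=0$, and $d(i)=-2$ otherwise. Assume that for all $i\in I$: (a) $\theta(i)\ne i$ implies $\gamma_i=0$; (b) $\gamma_i=0$ implies that $\theta(i)\neq i$ or $d(i)=0$. Let $n\ge 0$. The group $B_n$ of signed permutations of $\{\pm1,\dots,\pm n\}$ acts on $I^n$: $r_a$ ($1\le a\le n-1$) exchanges $i_a$ and $i_{a+1}$, and $r_0$ replaces $i_1$ by $\theta(i_1)$.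 Let $\beta\subseteq I^n$ be a $B_n$-orbit. **The algebra.** $V_\beta(\Gamma,\lambda,\gamma)$ is the unital associative $K$-algebra generated by $y_1,\dots,y_n$, $\psi_0,\dots,\psi_{n-1}$ and $e(\boldsymbol i)$ ($\boldsymbol i\in\beta$), with the following relations, for all $\boldsymbol i,\boldsymbol j\in\beta$ and all indices for which they make sense (each fraction denotes the polynomial that it is equal to): * $\sum_{\boldsymbol i\in\beta}e(\boldsymbol i)=1$, $\ e(\boldsymbol i)e(\boldsymbol j)=\delta_{\boldsymbol i\boldsymbol j}e(\boldsymbol i)$, $\ y_ay_b=y_by_a$, $\ y_ae(\boldsymbol i)=e(\boldsymbol i)y_a$, $\ \psi_b e(\boldsymbol i)=e(r_b\cdot\boldsymbol i)\psi_b$ for $0\le b\le n-1$; * for $a\ge1$: $(\psi_ay_b-y_{r_a(b)}\psi_a)e(\boldsymbol i)$ equals $-e(\boldsymbol i)$ if $b=a$ and $i_a=i_{a+1}$, equals $e(\boldsymbol i)$ if $b=a+1$ and $i_a=i_{a+1}$, and is $0$ otherwise; * $\psi_a\psi_b=\psi_b\psi_a$ if $a,b\ge 0$ and $|a-b|>1$;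 for $a\ge1$: $\psi_a^2e(\boldsymbol i)=Q_{i_ai_{a+1}}(y_a,y_{a+1})e(\boldsymbol i)$; * for $b\ge1$: $(\psi_{b+1}\psi_b\psi_{b+1}-\psi_b\psi_{b+1}\psi_b)e(\boldsymbol i)$ equals $\frac{Q_{i_bi_{b+1}}(y_b,y_{b+1})-Q_{i_bi_{b+1}}(y_{b+2},y_{b+1})}{y_b-y_{b+2}}e(\boldsymbol i)$ if $i_b=i_{b+2}$, and is $0$ otherwise; * $(\psi_0y_1+y_1\psi_0)e(\boldsymbol i)=2\gamma_{i_1}e(\boldsymbol i)$, and $\psi_0y_a=y_a\psi_0$ for $a\ge2$; * $\psi_0^2e(\boldsymbol i)$ equals $(-1)^{\lambda_{\theta(i_1)}}y_1^{d(i_1)}e(\boldsymbol i)$ if $\gamma_{i_1}=0$, and is $0$ otherwise; * $\big((\psi_0\psi_1)^2-(\psi_1\psi_0)^2\big)e(\boldsymbol i)$ equals $(-1)^{\lambda_{\theta(i_1)}}\frac{(-y_1)^{d(i_1)}-y_2^{d(i_1)}}{y_1+y_2}\psi_1e(\boldsymbol i)$ if $\gamma_{i_1}=0$ and $\theta(i_1)=i_2$,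 and equals $\gamma_{i_2}\frac{Q_{i_2i_1}(y_1,-y_2)-Q_{i_2i_1}(y_1,y_2)}{y_1y_2}(y_1\psi_0-\gamma_{i_1})e(\boldsymbol i)$ otherwise. It is $\mathbb Z$-graded by $\deg e(\boldsymbol i)=0$, $\deg y_a=2$, $\deg\psi_0e(\boldsymbol i)=d(i_1)$ and $\deg\psi_be(\boldsymbol i)=d(i_b,i_{b+1})$ for $b\geq 1$. **The decomposition.** Let $d\ge1$ and let $\Gamma=\bigsqcup_{j=1}^d\Gamma^{(j)}$ be a disjoint union of $\theta$-stable full subquivers, with no arrows between different $\Gamma^{(j)}$. Let $I=\bigsqcup_jI^{(j)}$ be the corresponding partition of the vertices, and let $\lambda^{(j)},\gamma^{(j)}$ be the restrictions of $\lambda,\gamma$ to $I^{(j)}$. For $\boldsymbol i\in\beta$ let $\boldsymbol i^{(j)}$ be the tuple obtained from $\boldsymbol i$ by removing the entries not in $I^{(j)}$. Its length $n_j$ does not depend on $\boldsymbol i\in\beta$. Put $\beta^{(j)}=\{\boldsymbol i^{(j)}:\boldsymbol i\in\beta\}\subseteq (I^{(j)})^{n_j}$, which is a $B_{n_j}$-orbit.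 **Theorem.** There is an isomorphism of $\mathbb{Z}$-graded $K$-algebras $$V_\beta(\Gamma,\lambda,\gamma)\;\simeq\;\mathrm{Mat}_{\binom{n}{n_1,\dots,n_d}}\Big(\bigotimes_{j=1}^dV_{\beta^{(j)}}(\Gamma^{(j)},\lambda^{(j)},\gamma^{(j)})\Big),$$ where the tensor product over $K$ has the total grading, and a matrix is homogeneous of degree $k$ if all its entries are homogeneous of degree $k$. -/

import Mathlib

open scoped TensorProduct

namespace TypeB

universe u v w

/-! ### Quivers with involution -/

/-- A loop-free quiver with vertex set `I` and arrow set `A`, with finitely many arrows between any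
two vertices, together with an involution `θ` (on vertices and on arrows) that reverses arrows. -/
structure InvQuiver (I : Type u) (A : Type v) where
  /-- origin of an arrow -/
  o : A → I
  /-- target of an arrow -/
  t : A → I
  loopFree : ∀ a, o a ≠ t a
  finite_arrows : ∀ i j, {a | o a = i ∧ t a = j}.Finite
  /-- the involution on vertices -/
  θ : I → I
  /-- the involution on arrows -/
  θA : A → A
  θ_invol : Function.Involutive θ
  θA_invol : Function.Involutive θA
  θ_o : ∀ a, θ (o a) = t (θA a)

namespace InvQuiver

variable {I : Type u} {A : Type v} (Γ : InvQuiver I A)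

theorem θ_t (a : A) : Γ.θ (Γ.t a) = Γ.o (Γ.θA a) := by
  have h := Γ.θ_o (Γ.θA a)
  rw [Γ.θA_invol a] at h
  rw [← h, Γ.θ_invol]

/-- The number `|i → j|` of arrows from `i` to `j`. -/
noncomputable def arrows (i j : I) : ℕ := {a | Γ.o a = i ∧ Γ.t a = j}.ncard

/-- `i · j = |i → j| + |i ← j|`. -/
noncomputable def dot (i j : I) : ℕ := Γ.arrows i j + Γ.arrows j i

open Classical in
/-- The integer `d(i, j)`: it is `i · j` if `i ≠ j`, and `-2` otherwise. -/
noncomputable def d₂ (i j : I) : ℤ := if i = j then -2 else (Γ.dot i j : ℤ)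

open Classical in
/-- The integer `d(i)`: it is `λ_i + λ_{θ(i)}` if `γ_i = 0`, and `-2` otherwise. -/
noncomputable def d₁ {K : Type w} [CommRing K] (lam : I → ℕ) (γ : I → K) (i : I) : ℤ :=
  if γ i = 0 then ((lam i + lam (Γ.θ i) : ℕ) : ℤ) else -2

/-- The full subquiver on a `θ`-stable set of vertices, with the restricted involution. -/
def full (S : Set I) (hS : ∀ i ∈ S, Γ.θ i ∈ S) :
    InvQuiver S {a : A // Γ.o a ∈ S ∧ Γ.t a ∈ S} where
  o a := ⟨Γ.o a.1, a.2.1⟩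
  t a := ⟨Γ.t a.1, a.2.2⟩
  loopFree a h := Γ.loopFree a.1 (congrArg Subtype.val h)
  finite_arrows i j := by
    refine Set.Finite.of_finite_image (f := Subtype.val)
      ((Γ.finite_arrows i j).subset ?_) Subtype.val_injective.injOn
    rintro _ ⟨a, ⟨h1, h2⟩, rfl⟩
    exact ⟨congrArg Subtype.val h1, congrArg Subtype.val h2⟩
  θ i := ⟨Γ.θ i.1, hS i.1 i.2⟩
  θA a := ⟨Γ.θA a.1, by
    rw [← Γ.θ_t a.1, ← Γ.θ_o a.1]; exact ⟨hS _ a.2.2, hS _ a.2.1⟩⟩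
  θ_invol i := Subtype.ext (Γ.θ_invol i.1)
  θA_invol a := Subtype.ext (Γ.θA_invol a.1)
  θ_o a := Subtype.ext (Γ.θ_o a.1)

end InvQuiver

/-! ### The polynomials `Q_{ij}` and the fractions in the relations

They are evaluated at elements of an arbitrary `K`-algebra; in the algebras below they are only
evaluated at commuting elements. -/

section Polynomials

variable {I : Type u} {A : Type v} (Γ : InvQuiver I A)

open Classical in
/-- `Q_{ij}(x, y)`: it is `(-1)^{|i → j|} (x - y)^{i · j}` if `i ≠ j`, and `0` otherwise. -/
noncomputable def Q {R : Type w} [Ring R] (i j : I) (x y : R) : R :=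
  if i = j then 0 else (-1) ^ Γ.arrows i j * (x - y) ^ Γ.dot i j

open Classical in
/-- The polynomial `(Q_{ij}(x, y) - Q_{ij}(z, y)) / (x - z)`. -/
noncomputable def divQ {R : Type w} [Ring R] (i j : I) (x y z : R) : R :=
  if i = j then 0 else
    (-1) ^ Γ.arrows i j *
      ∑ k ∈ Finset.range (Γ.dot i j), (x - y) ^ k * (z - y) ^ (Γ.dot i j - 1 - k)

open Classical in
/-- The polynomial `(Q_{ij}(x, -y) - Q_{ij}(x, y)) / y`. -/
noncomputable def oddQ {R : Type w} [Ring R] (i j : I) (x y : R) : R :=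
  if i = j then 0 else
    (-1) ^ Γ.arrows i j *
      (2 * ∑ k ∈ Finset.range (Γ.dot i j), (x + y) ^ k * (x - y) ^ (Γ.dot i j - 1 - k))

open Classical in
/-- The polynomial `(Q_{ij}(x, -y) - Q_{ij}(x, y)) / (x y)`, for `i`, `j` fixed by `θ`
(then `i · j` is even if `i ≠ j`). -/
noncomputable def oddQ₂ {R : Type w} [Ring R] (i j : I) (x y : R) : R :=
  if i = j then 0 else
    (-1) ^ Γ.arrows i j *
      (4 * ∑ k ∈ Finset.range (Γ.dot i j / 2),
        ((x + y) ^ 2) ^ k * ((x - y) ^ 2) ^ (Γ.dot i j / 2 - 1 - k))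

/-- The polynomial `((-x)^m - y^m) / (x + y)`. -/
def divPow {R : Type w} [Ring R] (m : ℕ) (x y : R) : R :=
  -∑ k ∈ Finset.range m, (-x) ^ k * y ^ (m - 1 - k)

theorem divQ_spec {R : Type w} [CommRing R] (i j : I) (x y z : R) :
    (x - z) * divQ Γ i j x y z = Q Γ i j x y - Q Γ i j z y := by
  unfold divQ Q
  split_ifs
  · simp
  · have h := Commute.geom_sum₂_mul (Commute.all (x - y) (z - y)) (Γ.dot i j)
    linear_combination ((-1) ^ Γ.arrows i j) * h

theorem oddQ_spec {R : Type w} [CommRing R] (i j : I) (x y : R) :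
    y * oddQ Γ i j x y = Q Γ i j x (-y) - Q Γ i j x y := by
  unfold oddQ Q
  split_ifs
  · simp
  · have h := Commute.geom_sum₂_mul (Commute.all (x + y) (x - y)) (Γ.dot i j)
    rw [sub_neg_eq_add]
    linear_combination ((-1) ^ Γ.arrows i j) * h

theorem arrows_θ (i j : I) : Γ.arrows i j = Γ.arrows (Γ.θ j) (Γ.θ i) := by
  unfold InvQuiver.arrows
  rw [← Set.ncard_image_of_injective _ Γ.θA_invol.injective]
  congr 1
  ext a
  constructor
  · rintro ⟨b, ⟨rfl, rfl⟩, rfl⟩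
    exact ⟨(Γ.θ_t b).symm, (Γ.θ_o b).symm⟩
  · rintro ⟨h1, h2⟩
    refine ⟨Γ.θA a, ⟨?_, ?_⟩, Γ.θA_invol a⟩
    · rw [← Γ.θ_t, h2, Γ.θ_invol]
    · rw [← Γ.θ_o, h1, Γ.θ_invol]

theorem even_dot (i j : I) (hi : Γ.θ i = i) (hj : Γ.θ j = j) : Even (Γ.dot i j) := by
  have h := arrows_θ Γ i j
  rw [hi, hj] at h
  exact ⟨Γ.arrows i j, by rw [InvQuiver.dot, ← h]⟩

theorem oddQ₂_spec {R : Type w} [CommRing R] (i j : I) (x y : R)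
    (hi : Γ.θ i = i) (hj : Γ.θ j = j) :
    x * y * oddQ₂ Γ i j x y = Q Γ i j x (-y) - Q Γ i j x y := by
  unfold oddQ₂ Q
  split_ifs
  · simp
  · have h := Commute.geom_sum₂_mul (Commute.all ((x + y) ^ 2) ((x - y) ^ 2)) (Γ.dot i j / 2)
    rw [← pow_mul, ← pow_mul, Nat.two_mul_div_two_of_even (even_dot Γ i j hi hj)] at h
    rw [sub_neg_eq_add]
    linear_combination ((-1) ^ Γ.arrows i j) * h

theorem divPow_spec {R : Type w} [CommRing R] (m : ℕ) (x y : R) :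
    (x + y) * divPow m x y = (-x) ^ m - y ^ m := by
  unfold divPow
  have h := Commute.geom_sum₂_mul (Commute.all (-x) y) m
  linear_combination h

end Polynomials

/-! ### The group of signed permutations and its orbits -/

/-- The involution `(a, s) ↦ (a, -s)` of `{±1, …, ±n}`; the pair `(a, s)` stands for `s · a`. -/
def flip {n : ℕ} (x : Fin n × ℤˣ) : Fin n × ℤˣ := (x.1, -x.2)

/-- The group `B_n` of signed permutations: the permutations `π` of `{±1, …, ±n}` such that
`π(-x) = -π(x)`. -/
def SignedPerm (n : ℕ) : Subgroup (Equiv.Perm (Fin n × ℤˣ)) where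
  carrier := {π | ∀ x, π (flip x) = flip (π x)}
  one_mem' _ := rfl
  mul_mem' {π ρ} hπ hρ x := by
    rw [Equiv.Perm.mul_apply, hρ, hπ, Equiv.Perm.mul_apply]
  inv_mem' {π} hπ x := by
    have h : π (flip (π⁻¹ x)) = flip x := by rw [hπ]; simp
    rw [← h]; simp

namespace InvQuiver

variable {I : Type u} {A : Type v} (Γ : InvQuiver I A) {n : ℕ}

/-- The entries of a tuple `(i_1, …, i_n)` extended to signed positions by `i_{-a} = θ(i_a)`. -/
def entry (i : Fin n → I) (x : Fin n × ℤˣ) : I := if x.2 = 1 then i x.1 else Γ.θ (i x.1)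

theorem entry_flip (i : Fin n → I) (x : Fin n × ℤˣ) :
    Γ.entry i (flip x) = Γ.θ (Γ.entry i x) := by
  obtain ⟨a, s⟩ := x
  rcases Int.units_eq_one_or s with rfl | rfl
  · have h : (-1 : ℤˣ) ≠ 1 := by decide
    simp [entry, flip, h]
  · have h : (-1 : ℤˣ) ≠ 1 := by decide
    simp [entry, flip, h, Γ.θ_invol (i a)]

theorem entry_act (i : Fin n → I) (π : SignedPerm n) (x : Fin n × ℤˣ) :
    Γ.entry (fun a => Γ.entry i ((π⁻¹ : SignedPerm n).1 (a, 1))) x =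
      Γ.entry i ((π⁻¹ : SignedPerm n).1 x) := by
  obtain ⟨a, s⟩ := x
  rcases Int.units_eq_one_or s with rfl | rfl
  · simp [entry]
  · have h : (-1 : ℤˣ) ≠ 1 := by decide
    have h2 : ((a, -1) : Fin n × ℤˣ) = flip (a, 1) := rfl
    rw [h2, (π⁻¹ : SignedPerm n).2, entry_flip, entry_flip]
    simp [entry]

/-- The action of `B_n` on `I^n`: `π` sends `(i_1, …, i_n)` to the tuple with entry
`i_{π⁻¹(a)}` in position `a`, where `i_{-a} = θ(i_a)`. -/
@[reducible] def signedAction : MulAction (SignedPerm n) (Fin n → I) where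
  smul π i := fun a => Γ.entry i ((π⁻¹ : SignedPerm n).1 (a, 1))
  one_smul i := by
    funext a
    change Γ.entry i (((1 : SignedPerm n)⁻¹ : SignedPerm n).1 (a, 1)) = i a
    simp [entry]
  mul_smul π ρ i := by
    funext a
    change Γ.entry i (((π * ρ)⁻¹ : SignedPerm n).1 (a, 1)) =
      Γ.entry (fun a => Γ.entry i ((ρ⁻¹ : SignedPerm n).1 (a, 1))) ((π⁻¹ : SignedPerm n).1 (a, 1))
    rw [entry_act, mul_inv_rev]
    rfl

/-- The `B_n`-orbit of a tuple. -/
def orbit (i : Fin n → I) : Set (Fin n → I) :=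
  letI := Γ.signedAction (n := n)
  MulAction.orbit (SignedPerm n) i

end InvQuiver

/-! ### The interpolating quiver Hecke algebra of type B -/

/-- The generators: `y a` is `y_{a+1}` (tuples and the `y`'s are indexed from `0` here), `psi b`
is `ψ_b` for `0 ≤ b ≤ n - 1`, and `e i` is the idempotent `e(i)`, `i ∈ β`. So for `b ≥ 1` the
generator `psi b` exchanges the positions `b - 1` and `b`. -/
inductive Gen {I : Type u} {n : ℕ} (β : Set (Fin n → I)) : Type u
  | y (a : Fin n) : Gen β
  | psi (b : Fin n) : Gen β
  | e (i : β) : Gen β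

section Algebra

variable {I : Type u} {A : Type v} {K : Type w} [CommRing K] {n : ℕ}

local notation "𝐲" a:max => FreeAlgebra.ι K (Gen.y a)
local notation "𝛙" b:max => FreeAlgebra.ι K (Gen.psi b)
local notation "𝐞" i:max => FreeAlgebra.ι K (Gen.e i)

open Classical in
/-- The defining relations. -/
inductive Rel (Γ : InvQuiver I A) (lam : I → ℕ) (γ : I → K) (β : Set (Fin n → I)) :
    FreeAlgebra K (Gen β) → FreeAlgebra K (Gen β) → Prop
  | sum_e : Rel Γ lam γ β (∑ᶠ i : β, 𝐞 i) 1
  | e_mul_e (i j : β) : Rel Γ lam γ β (𝐞 i * 𝐞 j) (if i = j then 𝐞 i else 0)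
  | y_comm (a b : Fin n) : Rel Γ lam γ β (𝐲 a * 𝐲 b) (𝐲 b * 𝐲 a)
  | y_e (a : Fin n) (i : β) : Rel Γ lam γ β (𝐲 a * 𝐞 i) (𝐞 i * 𝐲 a)
  | psi_e (k : ℕ) (hk : k + 1 < n) (i i' : β)
      (hi : i'.1 = i.1 ∘ Equiv.swap ⟨k, by omega⟩ ⟨k + 1, hk⟩) :
      Rel Γ lam γ β (𝛙 ⟨k + 1, hk⟩ * 𝐞 i) (𝐞 i' * 𝛙 ⟨k + 1, hk⟩)
  | psi_y (k : ℕ) (hk : k + 1 < n) (b : Fin n) (i : β) :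
      Rel Γ lam γ β
        ((𝛙 ⟨k + 1, hk⟩ * 𝐲 b - 𝐲 (Equiv.swap ⟨k, by omega⟩ ⟨k + 1, hk⟩ b) * 𝛙 ⟨k + 1, hk⟩) * 𝐞 i)
        (if b.1 = k ∧ i.1 ⟨k, by omega⟩ = i.1 ⟨k + 1, hk⟩ then -𝐞 i
          else if b.1 = k + 1 ∧ i.1 ⟨k, by omega⟩ = i.1 ⟨k + 1, hk⟩ then 𝐞 i
          else 0)
  | psi_comm (k l : ℕ) (hk : k + 1 < n) (hl : l + 1 < n) (hkl : k + 1 < l ∨ l + 1 < k) :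
      Rel Γ lam γ β (𝛙 ⟨k + 1, hk⟩ * 𝛙 ⟨l + 1, hl⟩) (𝛙 ⟨l + 1, hl⟩ * 𝛙 ⟨k + 1, hk⟩)
  | psi_sq (k : ℕ) (hk : k + 1 < n) (i : β) :
      Rel Γ lam γ β (𝛙 ⟨k + 1, hk⟩ ^ 2 * 𝐞 i)
        (Q Γ (i.1 ⟨k, by omega⟩) (i.1 ⟨k + 1, hk⟩) (𝐲 ⟨k, by omega⟩) (𝐲 ⟨k + 1, hk⟩) * 𝐞 i)
  | psi_braid (k : ℕ) (hk : k + 2 < n) (i : β) :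
      Rel Γ lam γ β
        ((𝛙 ⟨k + 2, hk⟩ * 𝛙 ⟨k + 1, by omega⟩ * 𝛙 ⟨k + 2, hk⟩
          - 𝛙 ⟨k + 1, by omega⟩ * 𝛙 ⟨k + 2, hk⟩ * 𝛙 ⟨k + 1, by omega⟩) * 𝐞 i)
        (if i.1 ⟨k, by omega⟩ = i.1 ⟨k + 2, hk⟩ then
          divQ Γ (i.1 ⟨k, by omega⟩) (i.1 ⟨k + 1, by omega⟩)
            (𝐲 ⟨k, by omega⟩) (𝐲 ⟨k + 1, by omega⟩) (𝐲 ⟨k + 2, hk⟩) * 𝐞 i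
          else 0)
  | psi0_e (h : 0 < n) (i i' : β)
      (hi : i'.1 = Function.update i.1 ⟨0, h⟩ (Γ.θ (i.1 ⟨0, h⟩))) :
      Rel Γ lam γ β (𝛙 ⟨0, h⟩ * 𝐞 i) (𝐞 i' * 𝛙 ⟨0, h⟩)
  | psi0_psi (h : 0 < n) (b : Fin n) (hb : 2 ≤ b.1) :
      Rel Γ lam γ β (𝛙 ⟨0, h⟩ * 𝛙 b) (𝛙 b * 𝛙 ⟨0, h⟩)
  | psi0_y1 (h : 0 < n) (i : β) :
      Rel Γ lam γ β ((𝛙 ⟨0, h⟩ * 𝐲 ⟨0, h⟩ + 𝐲 ⟨0, h⟩ * 𝛙 ⟨0, h⟩) * 𝐞 i)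
        ((2 * γ (i.1 ⟨0, h⟩)) • 𝐞 i)
  | psi0_y (h : 0 < n) (a : Fin n) (ha : 1 ≤ a.1) :
      Rel Γ lam γ β (𝛙 ⟨0, h⟩ * 𝐲 a) (𝐲 a * 𝛙 ⟨0, h⟩)
  | psi0_sq (h : 0 < n) (i : β) :
      Rel Γ lam γ β (𝛙 ⟨0, h⟩ ^ 2 * 𝐞 i)
        (if γ (i.1 ⟨0, h⟩) = 0 then
          (-1) ^ lam (Γ.θ (i.1 ⟨0, h⟩)) *
            𝐲 ⟨0, h⟩ ^ (lam (i.1 ⟨0, h⟩) + lam (Γ.θ (i.1 ⟨0, h⟩))) * 𝐞 i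
          else 0)
  | braid4_zero_opp (h : 1 < n) (i : β) (h1 : γ (i.1 ⟨0, by omega⟩) = 0)
      (h2 : Γ.θ (i.1 ⟨0, by omega⟩) = i.1 ⟨1, h⟩) :
      Rel Γ lam γ β
        (((𝛙 ⟨0, by omega⟩ * 𝛙 ⟨1, h⟩) ^ 2 - (𝛙 ⟨1, h⟩ * 𝛙 ⟨0, by omega⟩) ^ 2) * 𝐞 i)
        ((-1) ^ lam (Γ.θ (i.1 ⟨0, by omega⟩)) *
          divPow (lam (i.1 ⟨0, by omega⟩) + lam (Γ.θ (i.1 ⟨0, by omega⟩)))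
            (𝐲 ⟨0, by omega⟩) (𝐲 ⟨1, h⟩) * 𝛙 ⟨1, h⟩ * 𝐞 i)
  | braid4_zero (h : 1 < n) (i : β) (h1 : γ (i.1 ⟨0, by omega⟩) = 0)
      (h2 : Γ.θ (i.1 ⟨0, by omega⟩) ≠ i.1 ⟨1, h⟩) :
      Rel Γ lam γ β
        (((𝛙 ⟨0, by omega⟩ * 𝛙 ⟨1, h⟩) ^ 2 - (𝛙 ⟨1, h⟩ * 𝛙 ⟨0, by omega⟩) ^ 2) * 𝐞 i)
        (γ (i.1 ⟨1, h⟩) •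
          (oddQ Γ (i.1 ⟨1, h⟩) (i.1 ⟨0, by omega⟩) (𝐲 ⟨0, by omega⟩) (𝐲 ⟨1, h⟩) *
            𝛙 ⟨0, by omega⟩ * 𝐞 i))
  | braid4_ne_zero (h : 1 < n) (i : β) (h1 : γ (i.1 ⟨0, by omega⟩) ≠ 0) :
      Rel Γ lam γ β
        (((𝛙 ⟨0, by omega⟩ * 𝛙 ⟨1, h⟩) ^ 2 - (𝛙 ⟨1, h⟩ * 𝛙 ⟨0, by omega⟩) ^ 2) * 𝐞 i)
        (γ (i.1 ⟨1, h⟩) •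
          (oddQ₂ Γ (i.1 ⟨1, h⟩) (i.1 ⟨0, by omega⟩) (𝐲 ⟨0, by omega⟩) (𝐲 ⟨1, h⟩) *
            (𝐲 ⟨0, by omega⟩ * 𝛙 ⟨0, by omega⟩ -
              algebraMap K _ (γ (i.1 ⟨0, by omega⟩))) * 𝐞 i))

/-- The algebra `V_β(Γ, λ, γ)`, for a finite set `β ⊆ I^n` stable under `B_n`. -/
def V (Γ : InvQuiver I A) (lam : I → ℕ) (γ : I → K) (β : Set (Fin n → I)) : Type (max u w) :=
  RingQuot (Rel Γ lam γ β)

variable (Γ : InvQuiver I A) (lam : I → ℕ) (γ : I → K) (β : Set (Fin n → I))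

noncomputable instance V.instRing : Ring (V Γ lam γ β) := inferInstanceAs (Ring (RingQuot (Rel Γ lam γ β)))

noncomputable instance V.instAlgebra : Algebra K (V Γ lam γ β) :=
  inferInstanceAs (Algebra K (RingQuot (Rel Γ lam γ β)))

/-- The class in `V_β(Γ, λ, γ)` of a generator. -/
noncomputable def V.gen (g : Gen β) : V Γ lam γ β :=
  RingQuot.mkAlgHom K (Rel Γ lam γ β) (FreeAlgebra.ι K g)

/-- `IsWord k x`: the element `x` is a product of elements `e(i)`, `y_a`, `ψ_0 e(i)`, `ψ_b e(i)`
whose degrees `0`, `2`, `d(i_1)`, `d(i_b, i_{b+1})` add up to `k`. -/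
inductive IsWord : ℤ → V Γ lam γ β → Prop
  | one : IsWord 0 1
  | mul_e {k : ℤ} {x : V Γ lam γ β} (hx : IsWord k x) (i : β) :
      IsWord k (x * V.gen Γ lam γ β (.e i))
  | mul_y {k : ℤ} {x : V Γ lam γ β} (hx : IsWord k x) (a : Fin n) :
      IsWord (k + 2) (x * V.gen Γ lam γ β (.y a))
  | mul_psi0 {k : ℤ} {x : V Γ lam γ β} (hx : IsWord k x) (h : 0 < n) (i : β) :
      IsWord (k + Γ.d₁ lam γ (i.1 ⟨0, h⟩))
        (x * (V.gen Γ lam γ β (.psi ⟨0, h⟩) * V.gen Γ lam γ β (.e i)))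
  | mul_psi {k : ℤ} {x : V Γ lam γ β} (hx : IsWord k x) (b : ℕ) (hb : b + 1 < n) (i : β) :
      IsWord (k + Γ.d₂ (i.1 ⟨b, by omega⟩) (i.1 ⟨b + 1, hb⟩))
        (x * (V.gen Γ lam γ β (.psi ⟨b + 1, hb⟩) * V.gen Γ lam γ β (.e i)))

/-- The homogeneous component of degree `k` of `V_β(Γ, λ, γ)`. -/
noncomputable def V.grading (k : ℤ) : Submodule K (V Γ lam γ β) :=
  Submodule.span K {x | IsWord Γ lam γ β k x}

end Algebra

/-! ### Gradings on tensor products and on matrix algebras -/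

/-- The total grading on a finite tensor product of graded modules. -/
noncomputable def tensorGrading {K : Type w} [CommRing K] {d : ℕ} {B : Fin d → Type u}
    [∀ j, Ring (B j)] [∀ j, Algebra K (B j)] (𝒢 : ∀ j, ℤ → Submodule K (B j)) (k : ℤ) :
    Submodule K (⨂[K] j, B j) :=
  Submodule.span K {x | ∃ (deg : Fin d → ℤ) (b : ∀ j, B j),
    ∑ j, deg j = k ∧ (∀ j, b j ∈ 𝒢 j (deg j)) ∧ x = PiTensorProduct.tprod K b}

/-- The entrywise grading on a matrix algebra. -/
def matrixGrading {K : Type w} [CommRing K] {B : Type u} [Ring B] [Algebra K B] (N : ℕ)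
    (𝒢 : ℤ → Submodule K B) (k : ℤ) : Submodule K (Matrix (Fin N) (Fin N) B) where
  carrier := {M | ∀ s t, M s t ∈ 𝒢 k}
  zero_mem' _ _ := (𝒢 k).zero_mem
  add_mem' hM hN s t := (𝒢 k).add_mem (hM s t) (hN s t)
  smul_mem' c _ hM s t := (𝒢 k).smul_mem c (hM s t)

/-! ### Disjoint unions of subquivers

The decomposition `I = I^(1) ⊔ … ⊔ I^(d)` is given by the map `p` with `p(i) = j` for
`i ∈ I^(j)`. -/

section Decomposition

variable {I : Type u} {A : Type v} {d n : ℕ} (p : I → Fin d)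

/-- The vertex set `I^(j)`. -/
def part (j : Fin d) : Set I := {i | p i = j}

theorem part_stable {Γ : InvQuiver I A} {p : I → Fin d} (hp : ∀ i, p (Γ.θ i) = p i) (j : Fin d) :
    ∀ i ∈ part p j, Γ.θ i ∈ part p j := fun i hi => (hp i).trans hi

/-- The number `n_j(i)` of entries of the tuple `i` that lie in `I^(j)`. -/
def partSize (i : Fin n → I) (j : Fin d) : ℕ := Fintype.card {a : Fin n // p (i a) = j}

/-- `n_j` is constant on the `B_n`-orbits. -/
theorem partSize_eq_of_mem_orbit {Γ : InvQuiver I A} {p : I → Fin d}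
    (hp : ∀ i, p (Γ.θ i) = p i) {i i₀ : Fin n → I} (hi : i ∈ Γ.orbit i₀) (j : Fin d) :
    partSize p i j = partSize p i₀ j := by
  obtain ⟨π, rfl⟩ := hi
  have hent : ∀ x, p (Γ.entry i₀ x) = p (i₀ x.1) := by
    intro x
    unfold InvQuiver.entry
    split_ifs
    · rfl
    · exact hp _
  have hinj : Function.Injective (fun a : Fin n => ((π⁻¹ : SignedPerm n).1 (a, 1)).1) := by
    intro a b hab
    have hab' : ((π⁻¹ : SignedPerm n).1 (a, 1)).1 = ((π⁻¹ : SignedPerm n).1 (b, 1)).1 := hab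
    have key : (π⁻¹ : SignedPerm n).1 (a, 1) = (π⁻¹ : SignedPerm n).1 (b, 1) ∨
        (π⁻¹ : SignedPerm n).1 (a, 1) = (π⁻¹ : SignedPerm n).1 (flip (b, 1)) := by
      rw [(π⁻¹ : SignedPerm n).2]
      rcases (show ∀ s t : ℤˣ, s = t ∨ s = -t by decide) ((π⁻¹ : SignedPerm n).1 (a, 1)).2
        ((π⁻¹ : SignedPerm n).1 (b, 1)).2 with h | h
      · exact Or.inl (Prod.ext hab' h)
      · exact Or.inr (Prod.ext hab' h)
    rcases key with h | h
    · exact congrArg Prod.fst ((π⁻¹ : SignedPerm n).1.injective h)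
    · exact congrArg Prod.fst ((π⁻¹ : SignedPerm n).1.injective h)
  have hbij := Finite.injective_iff_bijective.mp hinj
  refine Fintype.card_congr ((Equiv.ofBijective _ hbij).subtypeEquiv fun a => ?_)
  change p (Γ.entry i₀ ((π⁻¹ : SignedPerm n).1 (a, 1))) = j ↔
    p (i₀ ((π⁻¹ : SignedPerm n).1 (a, 1)).1) = j
  rw [hent]

/-- The set of the tuples `i^(j)`, `i ∈ β`, where `i^(j)` is obtained from `i` by removing the
entries that are not in `I^(j)`, for a set `β` of tuples that all have `m` entries in `I^(j)`. The
map `f` is the increasing enumeration of the positions of `i` that are kept. -/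
def subtuples (β : Set (Fin n → I)) (j : Fin d) (m : ℕ) : Set (Fin m → part p j) :=
  {x | ∃ i ∈ β, ∃ f : Fin m ↪o Fin n,
    Set.range f = {a | p (i a) = j} ∧ ∀ k, (x k : I) = i (f k)}

variable {K : Type w} [CommRing K]

/-- The algebra `V_{β^(j)}(Γ^(j), λ^(j), γ^(j))`, for `β` the `B_n`-orbit of `i₀`. -/
abbrev VPart (Γ : InvQuiver I A) (lam : I → ℕ) (γ : I → K) (hp : ∀ i, p (Γ.θ i) = p i)
    (i₀ : Fin n → I) (j : Fin d) : Type (max u w) :=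
  V (Γ.full (part p j) (part_stable hp j)) (fun i => lam i) (fun i => γ i)
    (subtuples p (Γ.orbit i₀) j (partSize p i₀ j))

/-- The grading of `V_{β^(j)}(Γ^(j), λ^(j), γ^(j))`, for `β` the `B_n`-orbit of `i₀`. -/
noncomputable abbrev VPart.grading (Γ : InvQuiver I A) (lam : I → ℕ) (γ : I → K) (hp : ∀ i, p (Γ.θ i) = p i)
    (i₀ : Fin n → I) (j : Fin d) : ℤ → Submodule K (VPart p Γ lam γ hp i₀ j) :=
  V.grading (Γ.full (part p j) (part_stable hp j)) (fun i => lam i) (fun i => γ i)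
    (subtuples p (Γ.orbit i₀) j (partSize p i₀ j))

end Decomposition

end TypeB

open scoped TensorProduct

namespace TypeB

universe u v w

/-! ### The polynomials of the relations under homomorphisms -/

section MapPolynomials

variable {I A K R S : Type*} [CommRing K] [Ring R] [Ring S] [Algebra K R] [Algebra K S]
  (Γ : InvQuiver I A) (f : R →ₐ[K] S)

/-! Record for a tuple `i ∈ β` the word of the parts that contain its entries. Every word that
occurs contains the letter `j` exactly `n_j` times, and there are `n! / ∏ n_j!` such words. Let
`e(w)` be the sum of the `e(i)` over the tuples with word `w`; these are orthogonal idempotents with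
sum `1`.

There are no arrows between different parts, so `Q_{ij} = 1` for `i`, `j` in different parts. Hence,
if the letters of `w` in positions `k` and `k+1` differ, `ψ_k` is its own inverse between `e(w)` and
`e(r_k w)`. The braid relation has no correction term if the outer letters differ. Products of such
`ψ_k` along a way of sorting a word therefore depend only on the word (`SortPath.unique`, a
confluence argument), and they yield matrix units `M w u` with diagonal `e(w)`
(`Shuffle.exists_matUnits`). So the algebra is a matrix algebra over a corner, and the corner has to
be identified with the tensor product. The generator `ψ_0` does not change the word, because the
parts are stable under `θ`.

The identification uses two explicit homomorphisms. The first, `toMat`, sends `y` and `ψ` to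
matrices. On the column of a word `w`, the generator `y_a` acts as `y_r` in the tensor factor of the
letter at `a`, where `r` is its rank among the equal letters. If `ψ_k` meets two equal letters it
acts as a `ψ` of their factor, and otherwise it only exchanges the letters of the word. The
relations either take place in one factor, or are statements about words, or express that different
factors commute (`rep_mat`).

The second, `ofMat`, consists of the matrix units and of one homomorphism `fromPart` for each part
`j`. In a word that begins with all its letters `j`, the first `n_j` positions satisfy literally the
relations of the part `j`, including those of `ψ_0` (`rep_sorted`). Conjugating by the matrix units
and summing over all words extends this from one corner to the whole algebra, and the result
commutes with the matrix units. Its value on every component is again a `y` or a `ψ` at the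
appropriate position (`MatUnits.intertwine`). The images of two parts commute. The delicate case is
`ψ_0` against `ψ_0`: on a word beginning with `j`, `l` the second one becomes `ψ_1ψ_0ψ_1`, and the
claim is the four-term braid relation without correction (`comm_psi0_psi0`).

The composite `toMat ∘ ofMat` is the identity by evaluation on generators, and `ofMat` is
surjective, so both are isomorphisms. Degrees match because `ψ_k` has degree `i·j = 0` between
different parts, so that all matrix units have degree `0`. That `V_β` is graded at all follows from
a coaction `x ↦ x t^k` into Laurent polynomials, which exists because the relations are homogeneous
(`coact_rep`). The grading of the matrix algebra is then transported along the isomorphism. -/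

theorem map_Q (i j : I) (x y : R) : f (Q Γ i j x y) = Q Γ i j (f x) (f y) := by
  unfold Q; split_ifs <;> simp

theorem map_divQ (i j : I) (x y z : R) :
    f (divQ Γ i j x y z) = divQ Γ i j (f x) (f y) (f z) := by
  unfold divQ; split_ifs <;> simp

theorem map_oddQ (i j : I) (x y : R) : f (oddQ Γ i j x y) = oddQ Γ i j (f x) (f y) := by
  unfold oddQ; split_ifs <;> simp [map_ofNat]

theorem map_oddQ₂ (i j : I) (x y : R) : f (oddQ₂ Γ i j x y) = oddQ₂ Γ i j (f x) (f y) := by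
  unfold oddQ₂; split_ifs <;> simp [map_ofNat]

theorem map_divPow (m : ℕ) (x y : R) : f (divPow m x y) = divPow m (f x) (f y) := by
  unfold divPow; simp

end MapPolynomials

/-- The defining relations of `V_β(Γ, λ, γ)` for the elements `Y a`, `P b`, `E x` of a `K`-algebra,
applied to an element `z` on which `E i` acts by the identity. -/
structure RepAt {I A K B : Type*} [CommRing K] [Ring B] [Algebra K B] {n : ℕ}
    (Γ : InvQuiver I A) (lam : I → ℕ) (γ : I → K) {β : Set (Fin n → I)}
    (Y P : ℕ → B) (E : β → B) (i : β) (z : B) : Prop where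
  e_same : E i * z = z
  e_ne (x : β) (hx : x ≠ i) : E x * z = 0
  y_y (a b : ℕ) (ha : a < n) (hb : b < n) : Y a * (Y b * z) = Y b * (Y a * z)
  e_y_same (a : ℕ) (ha : a < n) : E i * (Y a * z) = Y a * z
  e_y_ne (a : ℕ) (ha : a < n) (x : β) (hx : x ≠ i) : E x * (Y a * z) = 0
  e_psi_same (k : ℕ) (hk : k + 1 < n) (x : β)
    (hx : x.1 = i.1 ∘ Equiv.swap ⟨k, by omega⟩ ⟨k + 1, hk⟩) :
    E x * (P (k + 1) * z) = P (k + 1) * z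
  e_psi_ne (k : ℕ) (hk : k + 1 < n) (x : β)
    (hx : x.1 ≠ i.1 ∘ Equiv.swap ⟨k, by omega⟩ ⟨k + 1, hk⟩) :
    E x * (P (k + 1) * z) = 0
  psi_y_left (k : ℕ) (hk : k + 1 < n) : P (k + 1) * (Y k * z) = Y (k + 1) * (P (k + 1) * z) +
    (open Classical in if i.1 ⟨k, by omega⟩ = i.1 ⟨k + 1, hk⟩ then -z else 0)
  psi_y_right (k : ℕ) (hk : k + 1 < n) : P (k + 1) * (Y (k + 1) * z) = Y k * (P (k + 1) * z) +
    (open Classical in if i.1 ⟨k, by omega⟩ = i.1 ⟨k + 1, hk⟩ then z else 0)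
  psi_y_far (k a : ℕ) (hk : k + 1 < n) (ha : a < n) (h1 : a ≠ k) (h2 : a ≠ k + 1) :
    P (k + 1) * (Y a * z) = Y a * (P (k + 1) * z)
  psi_psi (k l : ℕ) (hl : l + 1 < n) (hkl : k + 1 < l) :
    P (k + 1) * (P (l + 1) * z) = P (l + 1) * (P (k + 1) * z)
  psi_sq (k : ℕ) (hk : k + 1 < n) : P (k + 1) * (P (k + 1) * z) =
    Q Γ (i.1 ⟨k, by omega⟩) (i.1 ⟨k + 1, hk⟩) (Y k) (Y (k + 1)) * z
  braid_eq (k : ℕ) (hk : k + 2 < n) (h : i.1 ⟨k, by omega⟩ = i.1 ⟨k + 2, hk⟩) :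
    P (k + 2) * (P (k + 1) * (P (k + 2) * z)) = P (k + 1) * (P (k + 2) * (P (k + 1) * z)) +
      divQ Γ (i.1 ⟨k, by omega⟩) (i.1 ⟨k + 1, by omega⟩) (Y k) (Y (k + 1)) (Y (k + 2)) * z
  braid_ne (k : ℕ) (hk : k + 2 < n) (h : i.1 ⟨k, by omega⟩ ≠ i.1 ⟨k + 2, hk⟩) :
    P (k + 2) * (P (k + 1) * (P (k + 2) * z)) = P (k + 1) * (P (k + 2) * (P (k + 1) * z))
  e_psi0_same (h : 0 < n) (x : β)
    (hx : x.1 = Function.update i.1 ⟨0, h⟩ (Γ.θ (i.1 ⟨0, h⟩))) : E x * (P 0 * z) = P 0 * z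
  e_psi0_ne (h : 0 < n) (x : β)
    (hx : x.1 ≠ Function.update i.1 ⟨0, h⟩ (Γ.θ (i.1 ⟨0, h⟩))) : E x * (P 0 * z) = 0
  psi0_psi (k : ℕ) (hk : k + 2 < n) : P 0 * (P (k + 2) * z) = P (k + 2) * (P 0 * z)
  psi0_y0 (h : 0 < n) : P 0 * (Y 0 * z) = (2 * γ (i.1 ⟨0, h⟩)) • z - Y 0 * (P 0 * z)
  psi0_y (a : ℕ) (ha : a + 1 < n) : P 0 * (Y (a + 1) * z) = Y (a + 1) * (P 0 * z)
  psi0_sq_eq (h : 0 < n) (h0 : γ (i.1 ⟨0, h⟩) = 0) : P 0 * (P 0 * z) =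
    (-1) ^ lam (Γ.θ (i.1 ⟨0, h⟩)) *
      Y 0 ^ (lam (i.1 ⟨0, h⟩) + lam (Γ.θ (i.1 ⟨0, h⟩))) * z
  psi0_sq_ne (h : 0 < n) (h0 : γ (i.1 ⟨0, h⟩) ≠ 0) : P 0 * (P 0 * z) = 0
  braid4_opp (h : 1 < n) (h1 : γ (i.1 ⟨0, by omega⟩) = 0)
      (h2 : Γ.θ (i.1 ⟨0, by omega⟩) = i.1 ⟨1, h⟩) :
    P 0 * (P 1 * (P 0 * (P 1 * z))) = P 1 * (P 0 * (P 1 * (P 0 * z))) +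
      (-1) ^ lam (Γ.θ (i.1 ⟨0, by omega⟩)) *
        divPow (lam (i.1 ⟨0, by omega⟩) + lam (Γ.θ (i.1 ⟨0, by omega⟩))) (Y 0) (Y 1) * (P 1 * z)
  braid4_zero (h : 1 < n) (h1 : γ (i.1 ⟨0, by omega⟩) = 0)
      (h2 : Γ.θ (i.1 ⟨0, by omega⟩) ≠ i.1 ⟨1, h⟩) :
    P 0 * (P 1 * (P 0 * (P 1 * z))) = P 1 * (P 0 * (P 1 * (P 0 * z))) +
      γ (i.1 ⟨1, h⟩) • (oddQ Γ (i.1 ⟨1, h⟩) (i.1 ⟨0, by omega⟩) (Y 0) (Y 1) * (P 0 * z))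
  braid4_ne (h : 1 < n) (h1 : γ (i.1 ⟨0, by omega⟩) ≠ 0) :
    P 0 * (P 1 * (P 0 * (P 1 * z))) = P 1 * (P 0 * (P 1 * (P 0 * z))) +
      γ (i.1 ⟨1, h⟩) • (oddQ₂ Γ (i.1 ⟨1, h⟩) (i.1 ⟨0, by omega⟩) (Y 0) (Y 1) *
        (Y 0 * (P 0 * z) - γ (i.1 ⟨0, by omega⟩) • z))

/-! ### Homomorphisms out of the algebra, and the relations inside it -/

section Lift

variable {I : Type u} {A : Type v} {K : Type w} {B : Type*} [CommRing K] [Ring B] [Algebra K B]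
  {n : ℕ} {Γ : InvQuiver I A} {lam : I → ℕ} {γ : I → K} {β : Set (Fin n → I)}
  {Y P : ℕ → B} {E : β → B}

/-- The assignment of the images `Y a`, `P b`, `E x` to the generators. -/
def genImage (Y P : ℕ → B) (E : β → B) : Gen β → B
  | .y a => Y a
  | .psi b => P b
  | .e x => E x

/-- Most relations end in an idempotent `e(x)`, which maps `z` to `z` or to `0`; so the relation has
content at `z` only for `x = i`, and there it is one of the fields of `RepAt`. This reduces every
verification below to one test vector at a time. -/
theorem RepAt.rel [Finite β] {i : β} {z : B} (h : RepAt Γ lam γ Y P E i z)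
    {a b : FreeAlgebra K (Gen β)} (hab : Rel Γ lam γ β a b) :
    FreeAlgebra.lift K (genImage Y P E) a * z = FreeAlgebra.lift K (genImage Y P E) b * z := by
  classical
  have hE : ∀ x : β, E x * z = if x = i then z else 0 := by
    intro x
    split_ifs with hx
    · rw [hx, h.e_same]
    · exact h.e_ne x hx
  have hE' : ∀ (c : B) (x : β), c * E x * z = if x = i then c * z else 0 := by
    intro c x
    rw [mul_assoc, hE]; split_ifs <;> simp
  induction hab with
  | sum_e =>
    have := Fintype.ofFinite β
    rw [finsum_eq_sum_of_fintype]
    simp [genImage, Finset.sum_mul, hE]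
  | e_mul_e x y =>
    by_cases hxy : x = y
    · subst hxy
      simp only [if_true, map_mul, FreeAlgebra.lift_ι_apply, genImage, hE', hE]
      split_ifs <;> rfl
    · simp only [hxy, if_false, map_mul, FreeAlgebra.lift_ι_apply, genImage, hE',
        map_zero, zero_mul, hE]
      split_ifs with hx hy
      · exact absurd (hy.trans hx.symm) hxy
      · rfl
      · rfl
  | y_comm a b => simpa [genImage, mul_assoc] using h.y_y a b a.2 b.2
  | y_e a x =>
    simp only [map_mul, FreeAlgebra.lift_ι_apply, genImage, hE']
    split_ifs with hx
    · subst hx; rw [mul_assoc, h.e_y_same a a.2]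
    · rw [mul_assoc, h.e_y_ne a a.2 x hx]
  | psi_e k hk x x' hx =>
    simp only [map_mul, FreeAlgebra.lift_ι_apply, genImage, hE']
    split_ifs with hxi
    · subst hxi; rw [mul_assoc, h.e_psi_same k hk x' hx]
    · rw [mul_assoc, h.e_psi_ne k hk x']
      intro h'
      apply hxi
      rw [hx] at h'
      exact Subtype.ext ((Equiv.swap _ _).surjective.injective_comp_right h')
  | psi_y k hk b x =>
    simp only [map_mul, map_sub, FreeAlgebra.lift_ι_apply, genImage, hE']
    split_ifs with hxi hb hb' hb hb'
    · subst hxi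
      obtain ⟨hb, hx⟩ := hb
      obtain ⟨b, hbn⟩ := b
      dsimp only at hb
      subst hb
      have := h.psi_y_left b hk
      simp only [hx, if_true] at this
      simp [genImage, sub_mul, mul_assoc, this, hE]
    · subst hxi
      obtain ⟨hb, hx⟩ := hb'
      obtain ⟨b, hbn⟩ := b
      dsimp only at hb
      subst hb
      have := h.psi_y_right k hk
      simp only [hx, if_true] at this
      simp [genImage, sub_mul, mul_assoc, this, hE]
    · subst hxi
      rw [sub_mul, mul_assoc, mul_assoc, map_zero, zero_mul, sub_eq_zero]
      by_cases h1 : b = ⟨k, by omega⟩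
      · subst h1
        have := h.psi_y_left k hk
        rw [if_neg (by simpa using hb), add_zero] at this
        simpa using this
      by_cases h2 : b = ⟨k + 1, hk⟩
      · subst h2
        have := h.psi_y_right k hk
        rw [if_neg (by simpa using hb'), add_zero] at this
        simpa using this
      · rw [Equiv.swap_apply_of_ne_of_ne h1 h2]
        exact h.psi_y_far k b hk b.2 (fun h => h1 (Fin.ext h)) (fun h => h2 (Fin.ext h))
    · simp [genImage, hE, hxi]
    · simp [genImage, hE, hxi]
    · simp
  | psi_comm k l hk hl hkl =>
    rcases hkl with hkl | hkl
    · simpa [genImage, mul_assoc] using h.psi_psi k l hl hkl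
    · simpa [genImage, mul_assoc] using (h.psi_psi l k hk hkl).symm
  | psi_sq k hk x =>
    simp only [map_mul, map_pow, FreeAlgebra.lift_ι_apply, genImage, hE', map_Q]
    split_ifs with hx
    · subst hx; rw [pow_two, mul_assoc, h.psi_sq k hk]
    · rfl
  | psi_braid k hk x =>
    simp only [map_mul, map_sub, FreeAlgebra.lift_ι_apply, genImage, hE']
    by_cases hx : x = i
    · subst hx
      by_cases hk' : x.1 ⟨k, by omega⟩ = x.1 ⟨k + 2, hk⟩
      · have := h.braid_eq k hk hk'
        simp only [hk', if_true, map_mul, map_divQ, FreeAlgebra.lift_ι_apply, genImage, hE']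
        rw [← hk']
        simp only [sub_mul, mul_assoc, this]
        simp
      · have := h.braid_ne k hk hk'
        simp only [hk', if_true, if_false, sub_mul, mul_assoc, this]
        simp
    · rw [if_neg hx]
      split_ifs <;> simp [genImage, hE', hx]
  | psi0_e h0 x x' hx =>
    simp only [map_mul, FreeAlgebra.lift_ι_apply, genImage, hE']
    split_ifs with hxi
    · subst hxi; rw [mul_assoc, h.e_psi0_same h0 x' hx]
    · rw [mul_assoc, h.e_psi0_ne h0 x']
      intro h'
      apply hxi
      rw [hx] at h'
      refine Subtype.ext (funext fun a => ?_)
      have ha := congrFun h' a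
      by_cases ha0 : a = ⟨0, h0⟩
      · subst ha0
        simp only [Function.update_self] at ha
        exact Γ.θ_invol.injective ha
      · simpa [Function.update_of_ne ha0] using ha
  | psi0_psi h0 b hb =>
    obtain ⟨b, hb'⟩ := b
    obtain ⟨k, rfl⟩ : ∃ k, b = k + 2 := ⟨b - 2, by simp at hb; omega⟩
    simpa [genImage, mul_assoc] using h.psi0_psi k hb'
  | psi0_y1 h0 x =>
    simp only [map_mul, map_add, map_smul, FreeAlgebra.lift_ι_apply, genImage, hE', smul_mul_assoc,
      hE]
    split_ifs with hx
    · subst hx; simp [add_mul, mul_assoc, h.psi0_y0 h0]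
    · simp
  | psi0_y h0 a ha =>
    obtain ⟨a, ha'⟩ := a
    obtain ⟨k, rfl⟩ : ∃ k, a = k + 1 := ⟨a - 1, by simp at ha; omega⟩
    simpa [genImage, mul_assoc] using h.psi0_y k ha'
  | psi0_sq h0 x =>
    simp only [map_mul, map_pow, FreeAlgebra.lift_ι_apply, genImage, hE']
    by_cases hx : x = i
    · subst hx
      by_cases hg : γ (x.1 ⟨0, h0⟩) = 0
      · simp [hg, genImage, hE', pow_two, mul_assoc, h.psi0_sq_eq h0 hg]
      · simp [hg, pow_two, mul_assoc, h.psi0_sq_ne h0 hg]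
    · split_ifs <;> simp [genImage, hE', hx]
  | braid4_zero_opp h0 x h1 h2 =>
    simp only [map_mul, map_sub, map_pow, map_divPow, FreeAlgebra.lift_ι_apply, genImage, hE']
    split_ifs with hx
    · subst hx
      simp only [pow_two, sub_mul, mul_assoc, h.braid4_opp h0 h1 h2]
      simp
    · rfl
  | braid4_zero h0 x h1 h2 =>
    simp only [map_mul, map_sub, map_pow, map_smul, smul_mul_assoc, map_oddQ,
      FreeAlgebra.lift_ι_apply, genImage, hE']
    split_ifs with hx
    · subst hx
      simp only [pow_two, sub_mul, mul_assoc, h.braid4_zero h0 h1 h2]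
      simp
    · simp
  | braid4_ne_zero h0 x h1 =>
    simp only [map_mul, map_sub, map_pow, map_smul, smul_mul_assoc, map_oddQ₂,
      FreeAlgebra.lift_ι_apply, genImage, hE', AlgHom.commutes]
    split_ifs with hx
    · subst hx
      simp only [pow_two, sub_mul, mul_assoc, h.braid4_ne h0 h1]
      simp [Algebra.smul_def]
    · simp

/-- A family of test vectors satisfying the relations and separating the elements of `B` gives a
homomorphism from `V_β(Γ, λ, γ)` to `B`. -/
noncomputable def V.lift [Finite β] {ι : Type*} (t : ι → β) (z : ι → B)
    (hz : ∀ s, RepAt Γ lam γ Y P E (t s) (z s))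
    (hsep : ∀ b b' : B, (∀ s, b * z s = b' * z s) → b = b') : V Γ lam γ β →ₐ[K] B :=
  RingQuot.liftAlgHom K ⟨FreeAlgebra.lift K (genImage Y P E), fun {_ _} hab =>
    hsep _ _ fun s => (hz s).rel hab⟩

namespace V

/-- The element `y_{a+1}`; it is `0` by convention if `a` is out of range. -/
noncomputable def y (a : ℕ) : V Γ lam γ β :=
  if h : a < n then V.gen Γ lam γ β (.y ⟨a, h⟩) else 0

/-- The element `ψ_b`; it is `0` by convention if `b` is out of range. -/
noncomputable def psi (b : ℕ) : V Γ lam γ β :=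
  if h : b < n then V.gen Γ lam γ β (.psi ⟨b, h⟩) else 0

/-- The idempotent `e(i)`. -/
noncomputable def e (i : β) : V Γ lam γ β := V.gen Γ lam γ β (.e i)

theorem gen_y (a : Fin n) : V.gen Γ lam γ β (.y a) = V.y a := by simp [V.y]

theorem gen_e (i : β) : V.gen Γ lam γ β (.e i) = V.e i := rfl

theorem gen_psi (a : Fin n) : V.gen Γ lam γ β (.psi a) = V.psi a := by simp [V.psi]

theorem y_of_lt {a : ℕ} (h : a < n) : (V.y a : V Γ lam γ β) = V.gen Γ lam γ β (.y ⟨a, h⟩) :=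
  dif_pos h

theorem psi_of_lt {a : ℕ} (h : a < n) : (V.psi a : V Γ lam γ β) = V.gen Γ lam γ β (.psi ⟨a, h⟩) :=
  dif_pos h

theorem lift_gen [Finite β] {ι : Type*} (t : ι → β) (z : ι → B)
    (hz : ∀ s, RepAt Γ lam γ Y P E (t s) (z s))
    (hsep : ∀ b b' : B, (∀ s, b * z s = b' * z s) → b = b') (g : Gen β) :
    V.lift t z hz hsep (V.gen Γ lam γ β g) = genImage Y P E g := by
  unfold V.lift V.gen
  erw [RingQuot.liftAlgHom_mkAlgHom_apply]
  simp

/-- The homomorphism from the free algebra. -/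
noncomputable def mk : FreeAlgebra K (Gen β) →ₐ[K] V Γ lam γ β :=
  RingQuot.mkAlgHom K (Rel Γ lam γ β)

theorem mk_surjective : Function.Surjective (mk : FreeAlgebra K (Gen β) →ₐ[K] V Γ lam γ β) :=
  RingQuot.mkAlgHom_surjective K _

theorem mk_rel {a b : FreeAlgebra K (Gen β)} (h : Rel Γ lam γ β a b) :
    (mk a : V Γ lam γ β) = mk b := RingQuot.mkAlgHom_rel K h

theorem mk_ι (g : Gen β) : (mk (FreeAlgebra.ι K g) : V Γ lam γ β) = V.gen Γ lam γ β g := rfl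

/-- The generators generate. -/
theorem mem_of_gen_mem (S : Subalgebra K (V Γ lam γ β)) (hS : ∀ g, V.gen Γ lam γ β g ∈ S)
    (x : V Γ lam γ β) : x ∈ S := by
  obtain ⟨a, rfl⟩ := mk_surjective x
  induction a using FreeAlgebra.induction with
  | grade0 r => rw [AlgHom.commutes]; exact S.algebraMap_mem r
  | grade1 g => exact hS g
  | mul a b ha hb => rw [map_mul]; exact S.mul_mem ha hb
  | add a b ha hb => rw [map_add]; exact S.add_mem ha hb

theorem sum_e [Fintype β] : ∑ i : β, (V.e i : V Γ lam γ β) = 1 := by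
  have := mk_rel (Rel.sum_e (Γ := Γ) (lam := lam) (γ := γ) (β := β))
  rw [finsum_eq_sum_of_fintype, map_sum, map_one] at this
  exact this

theorem e_mul_self (i : β) : (V.e i * V.e i : V Γ lam γ β) = V.e i := by
  have := mk_rel (Rel.e_mul_e (Γ := Γ) (lam := lam) (γ := γ) (β := β) i i)
  rw [if_pos rfl] at this
  rwa [map_mul] at this

theorem e_mul_ne {i j : β} (h : i ≠ j) : (V.e i * V.e j : V Γ lam γ β) = 0 := by
  have := mk_rel (Rel.e_mul_e (Γ := Γ) (lam := lam) (γ := γ) (β := β) i j)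
  rwa [if_neg h, map_mul, map_zero] at this

/-- Two elements are equal if they are equal after multiplication by all the idempotents. -/
theorem ext_e [Finite β] {x y : V Γ lam γ β} (h : ∀ i : β, x * V.e i = y * V.e i) : x = y := by
  have := Fintype.ofFinite β
  rw [← mul_one x, ← mul_one y, ← sum_e, Finset.mul_sum, Finset.mul_sum]
  exact Finset.sum_congr rfl fun i _ => h i

theorem y_mul_y (a b : ℕ) : (V.y a * V.y b : V Γ lam γ β) = V.y b * V.y a := by
  by_cases ha : a < n
  · by_cases hb : b < n
    · have := mk_rel (Rel.y_comm (Γ := Γ) (lam := lam) (γ := γ) (β := β) ⟨a, ha⟩ ⟨b, hb⟩)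
      rw [map_mul, map_mul] at this
      simpa only [mk_ι, gen_y] using this
    · simp [V.y, hb]
  · simp [V.y, ha]

theorem y_mul_e (a : ℕ) (i : β) : (V.y a * V.e i : V Γ lam γ β) = V.e i * V.y a := by
  by_cases ha : a < n
  · have := mk_rel (Rel.y_e (Γ := Γ) (lam := lam) (γ := γ) (β := β) ⟨a, ha⟩ i)
    rw [map_mul, map_mul] at this
    simpa only [mk_ι, gen_e, gen_y] using this
  · simp [V.y, ha]

theorem psi_mul_e {k : ℕ} (hk : k + 1 < n) {i i' : β}
    (hi : i'.1 = i.1 ∘ Equiv.swap ⟨k, by omega⟩ ⟨k + 1, hk⟩) :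
    (V.psi (k + 1) * V.e i : V Γ lam γ β) = V.e i' * V.psi (k + 1) := by
  have := mk_rel (Rel.psi_e (Γ := Γ) (lam := lam) (γ := γ) (β := β) k hk i i' hi)
  rw [map_mul, map_mul] at this
  simpa only [mk_ι, gen_e, gen_psi] using this

theorem psi0_mul_e (h : 0 < n) {i i' : β}
    (hi : i'.1 = Function.update i.1 ⟨0, h⟩ (Γ.θ (i.1 ⟨0, h⟩))) :
    (V.psi 0 * V.e i : V Γ lam γ β) = V.e i' * V.psi 0 := by
  have := mk_rel (Rel.psi0_e (Γ := Γ) (lam := lam) (γ := γ) (β := β) h i i' hi)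
  rw [map_mul, map_mul] at this
  simpa only [mk_ι, gen_e, gen_psi] using this

theorem psi_mul_psi {k l : ℕ} (hkl : k + 1 < l) :
    (V.psi (k + 1) * V.psi (l + 1) : V Γ lam γ β) = V.psi (l + 1) * V.psi (k + 1) := by
  by_cases hl : l + 1 < n
  · have := mk_rel (Rel.psi_comm (Γ := Γ) (lam := lam) (γ := γ) (β := β) k l (by omega) hl
      (Or.inl hkl))
    rw [map_mul, map_mul] at this
    simpa only [mk_ι, gen_e, gen_psi] using this
  · simp [V.psi, hl]

theorem psi0_mul_psi (k : ℕ) :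
    (V.psi 0 * V.psi (k + 2) : V Γ lam γ β) = V.psi (k + 2) * V.psi 0 := by
  by_cases hl : k + 2 < n
  · have := mk_rel (Rel.psi0_psi (Γ := Γ) (lam := lam) (γ := γ) (β := β) (by omega) ⟨k + 2, hl⟩
      (by simp))
    rw [map_mul, map_mul] at this
    simpa only [mk_ι, gen_e, gen_psi] using this
  · simp [V.psi, hl]

theorem psi0_mul_y (a : ℕ) :
    (V.psi 0 * V.y (a + 1) : V Γ lam γ β) = V.y (a + 1) * V.psi 0 := by
  by_cases hl : a + 1 < n
  · have := mk_rel (Rel.psi0_y (Γ := Γ) (lam := lam) (γ := γ) (β := β) (by omega) ⟨a + 1, hl⟩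
      (by simp))
    rw [map_mul, map_mul] at this
    simpa only [mk_ι, gen_e, gen_psi, gen_y] using this
  · simp [V.y, hl]

theorem psi_y_e {k : ℕ} (hk : k + 1 < n) (b : Fin n) (i : β) :
    (V.psi (k + 1) * (V.y b * V.e i) : V Γ lam γ β) =
      V.y (Equiv.swap (⟨k, by omega⟩ : Fin n) ⟨k + 1, hk⟩ b).1 * (V.psi (k + 1) * V.e i) +
      (open Classical in if b.1 = k ∧ i.1 ⟨k, by omega⟩ = i.1 ⟨k + 1, hk⟩ then -V.e i
          else if b.1 = k + 1 ∧ i.1 ⟨k, by omega⟩ = i.1 ⟨k + 1, hk⟩ then V.e i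
          else 0) := by
  classical
  have := mk_rel (Rel.psi_y (Γ := Γ) (lam := lam) (γ := γ) (β := β) k hk b i)
  rw [map_mul, map_sub, map_mul, map_mul, sub_mul, sub_eq_iff_eq_add'] at this
  simp only [mk_ι, gen_e, gen_psi, gen_y, mul_assoc] at this
  rw [this]
  split_ifs <;> simp [mk_ι, gen_e]

/-- The relations hold in the algebra itself. -/
theorem rep (hβ : ∀ i ∈ β, ∀ k (hk : k + 1 < n), i ∘ Equiv.swap ⟨k, by omega⟩ ⟨k + 1, hk⟩ ∈ β)
    (hβ0 : ∀ i ∈ β, ∀ h : 0 < n, Function.update i ⟨0, h⟩ (Γ.θ (i ⟨0, h⟩)) ∈ β) (i : β) :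
    RepAt Γ lam γ (V.y : ℕ → V Γ lam γ β) V.psi V.e i (V.e i) where
  e_same := e_mul_self i
  e_ne x hx := e_mul_ne hx
  y_y a b _ _ := by rw [← mul_assoc, y_mul_y, mul_assoc]
  e_y_same a _ := by rw [y_mul_e, ← mul_assoc, e_mul_self]
  e_y_ne a _ x hx := by rw [y_mul_e, ← mul_assoc, e_mul_ne hx, zero_mul]
  e_psi_same k hk x hx := by rw [psi_mul_e hk hx, ← mul_assoc, e_mul_self]
  e_psi_ne k hk x hx := by
    have h : x ≠ ⟨_, hβ i.1 i.2 k hk⟩ := fun h => hx (congrArg Subtype.val h)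
    rw [psi_mul_e hk (i' := ⟨_, hβ i.1 i.2 k hk⟩) rfl, ← mul_assoc, e_mul_ne h, zero_mul]
  psi_y_left k hk := by
    have := psi_y_e (Γ := Γ) (lam := lam) (γ := γ) hk ⟨k, by omega⟩ i
    rw [this, Equiv.swap_apply_left]
    congr 1
    split_ifs <;> simp_all
  psi_y_right k hk := by
    have := psi_y_e (Γ := Γ) (lam := lam) (γ := γ) hk ⟨k + 1, by omega⟩ i
    rw [this, Equiv.swap_apply_right]
    congr 1
    split_ifs <;> simp_all
  psi_y_far k a hk ha h1 h2 := by
    have := psi_y_e (Γ := Γ) (lam := lam) (γ := γ) hk ⟨a, by omega⟩ i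
    rw [this, Equiv.swap_apply_of_ne_of_ne (by simpa using h1) (by simpa using h2)]
    simp [h1, h2]
  psi_psi k l _ hkl := by rw [← mul_assoc, psi_mul_psi hkl, mul_assoc]
  psi_sq k hk := by
    have := mk_rel (Rel.psi_sq (Γ := Γ) (lam := lam) (γ := γ) (β := β) k hk i)
    rw [map_mul, map_mul, map_pow, map_Q] at this
    simpa only [mk_ι, gen_e, gen_psi, gen_y, pow_two, mul_assoc] using this
  braid_eq k hk h := by
    have := mk_rel (Rel.psi_braid (Γ := Γ) (lam := lam) (γ := γ) (β := β) k hk i)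
    rw [if_pos h, map_mul, map_mul, map_sub, map_divQ, sub_mul, sub_eq_iff_eq_add'] at this
    simpa only [map_mul, mk_ι, gen_e, gen_psi, gen_y, mul_assoc] using this
  braid_ne k hk h := by
    have := mk_rel (Rel.psi_braid (Γ := Γ) (lam := lam) (γ := γ) (β := β) k hk i)
    rw [if_neg h, map_mul, map_sub, map_zero, sub_mul, sub_eq_zero] at this
    simpa only [map_mul, mk_ι, gen_e, gen_psi, gen_y, mul_assoc] using this
  e_psi0_same h x hx := by rw [psi0_mul_e h hx, ← mul_assoc, e_mul_self]
  e_psi0_ne h x hx := by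
    have h' : x ≠ ⟨_, hβ0 i.1 i.2 h⟩ := fun h => hx (congrArg Subtype.val h)
    rw [psi0_mul_e h (i' := ⟨_, hβ0 i.1 i.2 h⟩) rfl, ← mul_assoc, e_mul_ne h', zero_mul]
  psi0_psi k _ := by rw [← mul_assoc, psi0_mul_psi, mul_assoc]
  psi0_y0 h := by
    have := mk_rel (Rel.psi0_y1 (Γ := Γ) (lam := lam) (γ := γ) (β := β) h i)
    rw [map_mul, map_add, map_mul, map_mul, map_smul, add_mul] at this
    rw [eq_sub_iff_add_eq]
    simpa only [mk_ι, gen_e, gen_psi, gen_y, mul_assoc] using this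
  psi0_y a _ := by rw [← mul_assoc, psi0_mul_y, mul_assoc]
  psi0_sq_eq h h0 := by
    have := mk_rel (Rel.psi0_sq (Γ := Γ) (lam := lam) (γ := γ) (β := β) h i)
    rw [if_pos h0] at this
    simpa only [map_mul, map_pow, map_neg, map_one, mk_ι, gen_e, gen_psi, gen_y, pow_two (V.psi _),
      mul_assoc] using this
  psi0_sq_ne h h0 := by
    have := mk_rel (Rel.psi0_sq (Γ := Γ) (lam := lam) (γ := γ) (β := β) h i)
    rw [if_neg h0] at this
    simpa only [map_mul, map_pow, map_neg, map_one, map_zero, mk_ι, gen_e, gen_psi, gen_y,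
      pow_two (V.psi _), mul_assoc] using this
  braid4_opp h h1 h2 := by
    have := mk_rel (Rel.braid4_zero_opp (Γ := Γ) (lam := lam) (γ := γ) (β := β) h i h1 h2)
    rw [map_mul, map_sub, sub_mul, sub_eq_iff_eq_add'] at this
    simpa only [map_mul, map_pow, map_neg, map_one, map_divPow, mk_ι, gen_e, gen_psi, gen_y,
      pow_two (V.psi _ * _), mul_assoc] using this
  braid4_zero h h1 h2 := by
    have := mk_rel (Rel.braid4_zero (Γ := Γ) (lam := lam) (γ := γ) (β := β) h i h1 h2)
    rw [map_mul, map_sub, sub_mul, sub_eq_iff_eq_add'] at this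
    simpa only [map_mul, map_pow, map_neg, map_one, map_smul, map_oddQ, mk_ι, gen_e, gen_psi, gen_y,
      pow_two (V.psi _ * _), mul_assoc] using this
  braid4_ne h h1 := by
    have := mk_rel (Rel.braid4_ne_zero (Γ := Γ) (lam := lam) (γ := γ) (β := β) h i h1)
    rw [map_mul, map_sub, sub_mul, sub_eq_iff_eq_add'] at this
    simpa only [map_mul, map_sub, map_pow, map_neg, map_one, map_smul, map_oddQ₂, mk_ι, gen_e,
      gen_psi,       gen_y, pow_two (V.psi _ * _), mul_assoc, sub_mul, AlgHom.commutes,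
      Algebra.smul_def (γ (i.1 ⟨0, _⟩))] using this

end V

end Lift

open AddMonoidAlgebra (single)

/-! ### Degrees of the polynomials in the relations -/

section Homogeneous

variable {I A R : Type*} [Ring R] (Γ : InvQuiver I A)

theorem neg_one_pow_mul_single (m : ℕ) (k : ℤ) (x : R) :
    (-1) ^ m * single k x = single k ((-1) ^ m * x) := by
  rcases neg_one_pow_eq_or R m with h | h <;>
    rcases Nat.even_or_odd m with h' | h' <;>
    simp [h'.neg_one_pow]

theorem Q_single {i j : I} (h : i ≠ j) (x y : R) :
    Q Γ i j (single (2 : ℤ) x) (single 2 y) = single (2 * (Γ.dot i j : ℤ)) (Q Γ i j x y) := by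
  simp only [Q, if_neg h, ← AddMonoidAlgebra.single_sub, AddMonoidAlgebra.single_pow,
    neg_one_pow_mul_single]
  congr 1
  simp [mul_comm]

/-- Every summand has degree `(m - 1) a`, computed in `ℤ`; for `m = 0` the sum is empty and the
negative degree is harmless. -/
theorem sum_single_mul_single (m : ℕ) (a : ℤ) (x y : R) :
    ∑ k ∈ Finset.range m, single a x ^ k * single a y ^ (m - 1 - k) =
      single (m * a - a) (∑ k ∈ Finset.range m, x ^ k * y ^ (m - 1 - k)) := by
  refine Eq.trans ?_ (map_sum (AddMonoidAlgebra.singleAddHom (m * a - a)) _ _).symm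
  refine Finset.sum_congr rfl fun k hk => ?_
  rw [Finset.mem_range] at hk
  rw [AddMonoidAlgebra.single_pow, AddMonoidAlgebra.single_pow, AddMonoidAlgebra.single_mul_single,
    AddMonoidAlgebra.singleAddHom_apply]
  congr 1
  have : ((m - 1 - k : ℕ) : ℤ) = m - 1 - k := by omega
  simp only [nsmul_eq_mul, this]
  ring

theorem divQ_single {i j : I} (x y z : R) :
    divQ Γ i j (single (2 : ℤ) x) (single 2 y) (single 2 z) =
      single (2 * (Γ.dot i j : ℤ) - 2) (divQ Γ i j x y z) := by
  unfold divQ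
  split_ifs with h
  · simp
  · simp only [← AddMonoidAlgebra.single_sub]
    rw [sum_single_mul_single, neg_one_pow_mul_single, mul_comm (2 : ℤ)]

theorem oddQ_single {i j : I} (x y : R) :
    oddQ Γ i j (single (2 : ℤ) x) (single 2 y) =
      single (2 * (Γ.dot i j : ℤ) - 2) (oddQ Γ i j x y) := by
  unfold oddQ
  split_ifs with h
  · simp
  · simp only [← AddMonoidAlgebra.single_sub, ← AddMonoidAlgebra.single_add]
    rw [sum_single_mul_single, mul_comm (2 : ℤ), two_mul, two_mul, ← AddMonoidAlgebra.single_add,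
      neg_one_pow_mul_single]

/-- Between `θ`-fixed vertices `i·j` is even, so halving it is exact; the summands are products of
`i·j/2 - 1` squares, each of degree `4`. -/
theorem oddQ₂_single {i j : I} (hi : Γ.θ i = i) (hj : Γ.θ j = j) (x y : R) :
    oddQ₂ Γ i j (single (2 : ℤ) x) (single 2 y) =
      single (2 * (Γ.dot i j : ℤ) - 4) (oddQ₂ Γ i j x y) := by
  obtain ⟨m, hm⟩ := even_dot Γ i j hi hj
  unfold oddQ₂
  split_ifs with h
  · simp
  · simp only [← AddMonoidAlgebra.single_sub, ← AddMonoidAlgebra.single_add,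
      AddMonoidAlgebra.single_pow _ _ 2]
    have h4 : ∀ {S : Type _} [Ring S] (s : S), 4 * s = s + s + (s + s) := fun s => by noncomm_ring
    rw [sum_single_mul_single, h4, h4, ← AddMonoidAlgebra.single_add,
      ← AddMonoidAlgebra.single_add, neg_one_pow_mul_single]
    congr 1
    have : Γ.dot i j / 2 = m := by omega
    rw [this, hm]
    push_cast
    simp
    ring

theorem divPow_single (m : ℕ) (x y : R) :
    divPow m (single (2 : ℤ) x) (single 2 y) = single (2 * (m : ℤ) - 2) (divPow m x y) := by
  unfold divPow
  rw [← AddMonoidAlgebra.single_neg, sum_single_mul_single,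
    ← AddMonoidAlgebra.single_neg, mul_comm (2 : ℤ)]

end Homogeneous

/-! ### The algebra is graded: coaction of the grading group -/

section Grading

variable {I : Type u} {A : Type v} {K : Type w} [CommRing K]
  {n : ℕ} {Γ : InvQuiver I A} {lam : I → ℕ} {γ : I → K} {β : Set (Fin n → I)}

/-- The degree of `ψ_b e(i)`. -/
noncomputable def psiDeg (Γ : InvQuiver I A) (lam : I → ℕ) (γ : I → K) (i : Fin n → I) : ℕ → ℤ
  | 0 => if h : 0 < n then Γ.d₁ lam γ (i ⟨0, h⟩) else 0
  | k + 1 => if h : k + 1 < n then Γ.d₂ (i ⟨k, by omega⟩) (i ⟨k + 1, h⟩) else 0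

/-- The coaction on `ψ_b`. -/
noncomputable def coactPsi (Γ : InvQuiver I A) (lam : I → ℕ) (γ : I → K) (β : Set (Fin n → I))
    [Fintype β] (b : ℕ) : AddMonoidAlgebra (V Γ lam γ β) ℤ :=
  ∑ i : β, single (psiDeg Γ lam γ i.1 b) (V.psi b * V.e i)

/-- As `x` lies in `e(i) V`, the idempotents in `coactPsi` select the single summand of `i`; this
assigns to `ψ_b` the degree that it has on `x`. -/
theorem coactPsi_mul_single [Fintype β] (b : ℕ) (i : β) {x : V Γ lam γ β} (hx : V.e i * x = x)
    (k : ℤ) : coactPsi Γ lam γ β b * single k x =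
      single (psiDeg Γ lam γ i.1 b + k) (V.psi b * x) := by
  rw [coactPsi, Finset.sum_mul, Finset.sum_eq_single i]
  · rw [AddMonoidAlgebra.single_mul_single, mul_assoc, hx]
  · intro j _ hj
    rw [AddMonoidAlgebra.single_mul_single, ← hx, mul_assoc, ← mul_assoc (V.e j),
      V.e_mul_ne hj, zero_mul, mul_zero, AddMonoidAlgebra.single_zero]
  · simp

variable (β) in
/-- The set `β` is stable under the generators of `B_n`. -/
structure Stable (Γ : InvQuiver I A) : Prop where
  finite : Finite β
  swap_mem : ∀ i ∈ β, ∀ k (hk : k + 1 < n), i ∘ Equiv.swap ⟨k, by omega⟩ ⟨k + 1, hk⟩ ∈ β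
  theta_mem : ∀ i ∈ β, ∀ h : 0 < n, Function.update i ⟨0, h⟩ (Γ.θ (i ⟨0, h⟩)) ∈ β

/-- The action of `r_{k+1}` on `β`. -/
def Stable.sw (hβ : Stable β Γ) (i : β) (k : ℕ) (hk : k + 1 < n) : β :=
  ⟨i.1 ∘ Equiv.swap ⟨k, by omega⟩ ⟨k + 1, hk⟩, hβ.swap_mem i.1 i.2 k hk⟩

/-- The action of `r_0` on `β`. -/
def Stable.th (hβ : Stable β Γ) (i : β) (h : 0 < n) : β :=
  ⟨Function.update i.1 ⟨0, h⟩ (Γ.θ (i.1 ⟨0, h⟩)), hβ.theta_mem i.1 i.2 h⟩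

theorem Stable.rep (hβ : Stable β Γ) (i : β) :
    RepAt Γ lam γ (V.y : ℕ → V Γ lam γ β) V.psi V.e i (V.e i) :=
  V.rep hβ.swap_mem hβ.theta_mem i

theorem Stable.e_psi (hβ : Stable β Γ) {i : β} {k : ℕ} (hk : k + 1 < n) {x : V Γ lam γ β}
    (hx : V.e i * x = x) : V.e (hβ.sw i k hk) * (V.psi (k + 1) * x) = V.psi (k + 1) * x := by
  rw [← mul_assoc, ← V.psi_mul_e hk (i := i) rfl, mul_assoc, hx]

theorem Stable.e_psi0 (hβ : Stable β Γ) {i : β} (h : 0 < n) {x : V Γ lam γ β}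
    (hx : V.e i * x = x) : V.e (hβ.th i h) * (V.psi 0 * x) = V.psi 0 * x := by
  rw [← mul_assoc, ← V.psi0_mul_e h (i := i) rfl, mul_assoc, hx]

theorem V.e_y {i : β} (a : ℕ) {x : V Γ lam γ β} (hx : V.e i * x = x) :
    V.e i * (V.y a * x) = V.y a * x := by
  rw [← mul_assoc, ← V.y_mul_e, mul_assoc, hx]

theorem d₂_symm (i j : I) : Γ.d₂ i j = Γ.d₂ j i := by
  unfold InvQuiver.d₂ InvQuiver.dot
  split_ifs with h h' h'
  · rfl
  · exact absurd h.symm h'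
  · exact absurd h'.symm h
  · push_cast; ring

/-- The involution reverses arrows, and `i·j` counts both directions. -/
theorem d₂_θ (i j : I) : Γ.d₂ (Γ.θ i) (Γ.θ j) = Γ.d₂ i j := by
  unfold InvQuiver.d₂ InvQuiver.dot
  rw [arrows_θ Γ i j, arrows_θ Γ j i, add_comm, Γ.θ_invol.injective.eq_iff]

theorem d₂_θ' (i j : I) : Γ.d₂ (Γ.θ i) j = Γ.d₂ i (Γ.θ j) := by
  rw [← d₂_θ (Γ := Γ) i, Γ.θ_invol]

theorem d₂_ne {i j : I} (h : i ≠ j) : Γ.d₂ i j = Γ.dot i j := if_neg h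

theorem d₂_self (i : I) : Γ.d₂ i i = -2 := if_pos rfl

theorem gamma_θ (hγ : ∀ i, Γ.θ i ≠ i → γ i = 0) (i : I) : γ (Γ.θ i) = γ i := by
  by_cases h : Γ.θ i = i
  · rw [h]
  · rw [hγ i h, hγ]
    rw [Γ.θ_invol]
    exact fun h' => h h'.symm

theorem d₁_θ (hγ : ∀ i, Γ.θ i ≠ i → γ i = 0) (i : I) :
    Γ.d₁ lam γ (Γ.θ i) = Γ.d₁ lam γ i := by
  unfold InvQuiver.d₁
  rw [gamma_θ hγ, Γ.θ_invol, add_comm]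

theorem psiDeg_succ (i : Fin n → I) {k : ℕ} (hk : k + 1 < n) :
    psiDeg Γ lam γ i (k + 1) = Γ.d₂ (i ⟨k, by omega⟩) (i ⟨k + 1, hk⟩) := dif_pos hk

theorem psiDeg_zero (i : Fin n → I) (h : 0 < n) :
    psiDeg Γ lam γ i 0 = Γ.d₁ lam γ (i ⟨0, h⟩) := dif_pos h

theorem sw_apply (hβ : Stable β Γ) (i : β) (k : ℕ) (hk : k + 1 < n) (a : ℕ) (ha : a < n) :
    (hβ.sw i k hk).1 ⟨a, ha⟩ = if a = k then i.1 ⟨k + 1, hk⟩ else if a = k + 1 then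
      i.1 ⟨k, by omega⟩ else i.1 ⟨a, ha⟩ := by
  simp only [Stable.sw, Function.comp_apply, Equiv.swap_apply_def, Fin.mk.injEq]
  split_ifs <;> rfl

theorem th_apply (hβ : Stable β Γ) (i : β) (h : 0 < n) (a : ℕ) (ha : a < n) :
    (hβ.th i h).1 ⟨a, ha⟩ = if a = 0 then Γ.θ (i.1 ⟨0, h⟩) else i.1 ⟨a, ha⟩ := by
  simp [Stable.th, Function.update_apply, Fin.ext_iff]

/-- This is the homogeneity of the relations: when each generator is replaced by the monomial of its
degree, the two sides of every relation get equal exponents. The weights enter through the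
invariance of `d` under `θ`, which rests on `hγ`. -/
theorem coact_rep [Fintype β] (hβ : Stable β Γ) (hγ : ∀ i, Γ.θ i ≠ i → γ i = 0) (i : β) :
    RepAt Γ lam γ (fun a => single (2 : ℤ) (V.y a : V Γ lam γ β)) (coactPsi Γ lam γ β)
      (fun j => single 0 (V.e j)) i (single 0 (V.e i)) := by
  have R := hβ.rep (lam := lam) (γ := γ) i
  have he := R.e_same
  have hP : ∀ b (j : β) {x : V Γ lam γ β} (hx : V.e j * x = x)
    (k : ℤ), coactPsi Γ lam γ β b * single k x =
      single (psiDeg Γ lam γ j.1 b + k) (V.psi b * x) := fun b j _ hx k =>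
        coactPsi_mul_single b j hx k
  have hm := fun (a b : ℤ) (x y : V Γ lam γ β) => AddMonoidAlgebra.single_mul_single a b x y
  -- Both alternating products of length four meet the degrees `d(i_1)`, `d(i_2)`, `d(i_1, i_2)` and
  -- `d(θ(i_1), i_2)` once each, up to the symmetries of `d`, so they are brought to a common total
  -- degree.
  have chainL (h : 1 < n) : coactPsi Γ lam γ β 0 * (coactPsi Γ lam γ β 1 * (coactPsi Γ lam γ β 0 *
      (coactPsi Γ lam γ β 1 * single 0 (V.e i)))) =
      single (Γ.d₁ lam γ (i.1 ⟨0, by omega⟩) + Γ.d₁ lam γ (i.1 ⟨1, h⟩) +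
        Γ.d₂ (i.1 ⟨0, by omega⟩) (i.1 ⟨1, h⟩) + Γ.d₂ (Γ.θ (i.1 ⟨0, by omega⟩)) (i.1 ⟨1, h⟩))
        (V.psi 0 * (V.psi 1 * (V.psi 0 * (V.psi 1 * V.e i)))) := by
    have h0 : 0 < n := by omega
    have he1 := hβ.e_psi (k := 0) h he
    have he2 := hβ.e_psi0 h0 he1
    have he3 := hβ.e_psi (k := 0) h he2
    rw [hP _ _ he, hP _ _ he1, hP _ _ he2, hP _ _ he3]
    congr 1
    rw [psiDeg_succ _ h, psiDeg_zero _ h0, psiDeg_succ _ h, psiDeg_zero _ h0]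
    simp only [sw_apply, th_apply]
    simp
    rw [d₂_symm (Γ.θ _), d₂_θ', d₂_symm]
    ring
  have chainR (h : 1 < n) : coactPsi Γ lam γ β 1 * (coactPsi Γ lam γ β 0 * (coactPsi Γ lam γ β 1 *
      (coactPsi Γ lam γ β 0 * single 0 (V.e i)))) =
      single (Γ.d₁ lam γ (i.1 ⟨0, by omega⟩) + Γ.d₁ lam γ (i.1 ⟨1, h⟩) +
        Γ.d₂ (i.1 ⟨0, by omega⟩) (i.1 ⟨1, h⟩) + Γ.d₂ (Γ.θ (i.1 ⟨0, by omega⟩)) (i.1 ⟨1, h⟩))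
        (V.psi 1 * (V.psi 0 * (V.psi 1 * (V.psi 0 * V.e i)))) := by
    have h0 : 0 < n := by omega
    have he1 := hβ.e_psi0 h0 he
    have he2 := hβ.e_psi (k := 0) h he1
    have he3 := hβ.e_psi0 h0 he2
    rw [hP _ _ he, hP _ _ he1, hP _ _ he2, hP _ _ he3]
    congr 1
    rw [psiDeg_succ _ h, psiDeg_zero _ h0, psiDeg_succ _ h, psiDeg_zero _ h0]
    simp only [sw_apply, th_apply]
    simp
    rw [d₂_θ, d₂_symm (i.1 ⟨1, _⟩)]
    ring
  constructor
  · rw [hm, R.e_same, add_zero]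
  · intro x hx; rw [hm, R.e_ne x hx, AddMonoidAlgebra.single_zero]
  · intro a b ha hb; simp only [hm, R.y_y a b ha hb]
  · intro a ha; simp only [hm, R.e_y_same a ha, zero_add]
  · intro a ha x hx; simp only [hm, R.e_y_ne a ha x hx, AddMonoidAlgebra.single_zero]
  · intro k hk x hx
    rw [hP _ _ he, hm, R.e_psi_same k hk x hx, zero_add]
  · intro k hk x hx
    rw [hP _ _ he, hm, R.e_psi_ne k hk x hx, AddMonoidAlgebra.single_zero]
  · intro k hk
    rw [hm, hP _ _ he, hP _ _ (V.e_y k he), hm, R.psi_y_left k hk, AddMonoidAlgebra.single_add,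
      psiDeg_succ _ hk]
    -- For equal entries the correction `-e(i)` has degree `0`, and `2 + d(i, i) = 0`.
    split_ifs with h
    · rw [h, d₂_self, ← AddMonoidAlgebra.single_neg]; rfl
    · rw [AddMonoidAlgebra.single_zero]; congr 2; ring
  · intro k hk
    rw [hm, hP _ _ he, hP _ _ (V.e_y _ he), hm, R.psi_y_right k hk, AddMonoidAlgebra.single_add,
      psiDeg_succ _ hk]
    split_ifs with h
    · rw [h, d₂_self]; rfl
    · rw [AddMonoidAlgebra.single_zero]; congr 2; ring
  · intro k a hk ha h1 h2
    rw [hm, hP _ _ he, hP _ _ (V.e_y _ he), hm, R.psi_y_far k a hk ha h1 h2]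
    congr 1; ring
  · intro k l hl hkl
    have hk : k + 1 < n := by omega
    rw [hP _ _ he, hP _ _ he, hP _ _ (hβ.e_psi hl he), hP _ _ (hβ.e_psi hk he),
      R.psi_psi k l hl hkl]
    congr 1
    simp only [psiDeg_succ _ hl, psiDeg_succ _ hk, sw_apply]
    have h1 : k ≠ l := by omega
    have h2 : k ≠ l + 1 := by omega
    have h3 : k + 1 ≠ l := by omega
    simp [h1, h2, h3, h1.symm, h2.symm, h3.symm]
    ring
  · intro k hk
    rw [hP _ _ he, hP _ _ (hβ.e_psi hk he), R.psi_sq k hk]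
    by_cases h : i.1 ⟨k, by omega⟩ = i.1 ⟨k + 1, hk⟩
    · simp [Q, h]
    · rw [Q_single Γ h, hm]
      congr 1
      simp only [psiDeg_succ _ hk, sw_apply]
      simp only [if_true, if_neg (Nat.succ_ne_self k), d₂_ne h, d₂_ne (Ne.symm h)]
      simp [InvQuiver.dot]; ring
  · intro k hk h
    have hk' : k + 1 < n := by omega
    rw [hP _ _ he, hP _ _ he, hP _ _ (hβ.e_psi hk he), hP _ _ (hβ.e_psi hk' he),
      hP _ _ (hβ.e_psi hk' (hβ.e_psi hk he)), hP _ _ (hβ.e_psi hk (hβ.e_psi hk' he)),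
      R.braid_eq k hk h, divQ_single, hm, AddMonoidAlgebra.single_add]
    have e1 : k ≠ k + 1 + 1 := by omega
    simp only [psiDeg_succ _ hk, psiDeg_succ _ hk', sw_apply]
    by_cases h' : i.1 ⟨k, by omega⟩ = i.1 ⟨k + 1, hk'⟩
    · simp only [divQ, if_pos h', zero_mul, AddMonoidAlgebra.single_zero, add_zero]
      congr 1
      simp [h, e1, e1.symm, d₂_symm (i.1 ⟨k + 1 + 1, hk⟩)]
    · congr 2
      · simp [h, e1, e1.symm, d₂_symm (i.1 ⟨k + 1 + 1, hk⟩)]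
      · rw [← d₂_ne h']
        simp [h, e1, e1.symm, d₂_symm (i.1 ⟨k + 1 + 1, hk⟩), d₂_self]
        ring
  · intro k hk h
    have hk' : k + 1 < n := by omega
    rw [hP _ _ he, hP _ _ he, hP _ _ (hβ.e_psi hk he), hP _ _ (hβ.e_psi hk' he),
      hP _ _ (hβ.e_psi hk' (hβ.e_psi hk he)), hP _ _ (hβ.e_psi hk (hβ.e_psi hk' he)),
      R.braid_ne k hk h]
    congr 1
    simp only [psiDeg_succ _ hk, psiDeg_succ _ hk', sw_apply]
    have e1 : k ≠ k + 1 + 1 := by omega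
    simp [e1, e1.symm]
    ring
  · intro h x hx
    rw [hP _ _ he, hm, R.e_psi0_same h x hx, zero_add]
  · intro h x hx
    rw [hP _ _ he, hm, R.e_psi0_ne h x hx, AddMonoidAlgebra.single_zero]
  · intro k hk
    have h : 0 < n := by omega
    rw [hP _ _ he, hP _ _ he, hP _ _ (hβ.e_psi hk he), hP _ _ (hβ.e_psi0 h he), R.psi0_psi k hk]
    congr 1
    simp only [psiDeg_succ _ hk, psiDeg_zero _ h, sw_apply, th_apply]
    simp
    ring
  · intro h
    rw [hP _ _ he, hm, hm, hP _ _ (V.e_y _ he), R.psi0_y0 h, AddMonoidAlgebra.single_sub,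
      psiDeg_zero _ h]
    by_cases h0 : γ (i.1 ⟨0, h⟩) = 0
    · simp [h0, add_comm]
    · have : Γ.d₁ lam γ (i.1 ⟨0, h⟩) = -2 := if_neg h0
      rw [this, AddMonoidAlgebra.smul_single]
      congr 2
  · intro a ha
    rw [hP _ _ he, hm, hm, hP _ _ (V.e_y _ he), R.psi0_y a ha]
    congr 1; ring
  · intro h h0
    rw [hP _ _ he, hP _ _ (hβ.e_psi0 h he), R.psi0_sq_eq h h0, AddMonoidAlgebra.single_pow,
      neg_one_pow_mul_single, hm]
    congr 1
    simp only [psiDeg_zero _ h, th_apply, if_true, d₁_θ hγ]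
    simp [InvQuiver.d₁, h0]
    ring
  · intro h h0
    rw [hP _ _ he, hP _ _ (hβ.e_psi0 h he), R.psi0_sq_ne h h0, AddMonoidAlgebra.single_zero]
  · intro h h1 h2
    rw [chainL h, chainR h, R.braid4_opp h h1 h2, hP _ _ he, divPow_single,
      neg_one_pow_mul_single, hm, AddMonoidAlgebra.single_add]
    congr 2
    -- Here `i_2 = θ(i_1)`, so `d(i_2) = d(i_1)` and `d(θ(i_1), i_2) = -2`; the total `2 d(i_1) - 2
    -- + d(i_1, i_2)` is the degree of `divPow` plus that of `ψ_1`.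
    have h3 : γ (i.1 ⟨1, h⟩) = 0 := by rw [← h2, gamma_θ hγ, h1]
    have h4 : Γ.d₁ lam γ (i.1 ⟨1, h⟩) = Γ.d₁ lam γ (i.1 ⟨0, by omega⟩) := by rw [← h2, d₁_θ hγ]
    have h5 : Γ.d₁ lam γ (i.1 ⟨0, by omega⟩) =
      ((lam (i.1 ⟨0, by omega⟩) + lam (Γ.θ (i.1 ⟨0, by omega⟩)) : ℕ) : ℤ) := if_pos h1
    rw [h4, ← h5, h2, d₂_self, psiDeg_succ _ h]
    ring
  · intro h h1 h2
    rw [chainL h, chainR h, R.braid4_zero h h1 h2, hP _ _ he, oddQ_single, hm,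
      AddMonoidAlgebra.single_add]
    congr 1
    -- If `γ_{i_2} = 0` the correction vanishes. Otherwise `i_2` is fixed by `θ` and has degree
    -- `-2`, and it differs from `i_1` since `γ_{i_1} = 0`; so both mixed degrees equal `i_1·i_2`,
    -- and the total is `d(i_1) + 2 (i_1·i_2) - 2`.
    by_cases h3 : γ (i.1 ⟨1, h⟩) = 0
    · simp [h3]
    · rw [← AddMonoidAlgebra.smul_single]
      congr 2
      have h4 : Γ.θ (i.1 ⟨1, h⟩) = i.1 ⟨1, h⟩ := by_contra fun h' => h3 (hγ _ h')
      have h5 : i.1 ⟨1, h⟩ ≠ i.1 ⟨0, by omega⟩ := fun h' => h3 (h' ▸ h1)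
      have h6 : Γ.d₁ lam γ (i.1 ⟨1, h⟩) = -2 := if_neg h3
      rw [d₂_θ', h4, d₂_symm, d₂_ne h5, psiDeg_zero _ (by omega), h6]
      ring
  · intro h h1
    rw [chainL h, chainR h, R.braid4_ne h h1, hP _ _ he, hm,
      AddMonoidAlgebra.single_add]
    congr 1
    have h7 : Γ.d₁ lam γ (i.1 ⟨0, by omega⟩) = -2 := if_neg h1
    by_cases h3 : γ (i.1 ⟨1, h⟩) = 0
    · simp [h3]
    by_cases h5 : i.1 ⟨1, h⟩ = i.1 ⟨0, by omega⟩
    · simp [h5, oddQ₂]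
    · have h4 : Γ.θ (i.1 ⟨1, h⟩) = i.1 ⟨1, h⟩ := by_contra fun h' => h3 (hγ _ h')
      have h8 : Γ.θ (i.1 ⟨0, by omega⟩) = i.1 ⟨0, by omega⟩ :=
        by_contra fun h' => h1 (hγ _ h')
      have h6 : Γ.d₁ lam γ (i.1 ⟨1, h⟩) = -2 := if_neg h3
      -- Since `d(i_1) = -2`, the product `y_1 ψ_0` has degree `0` like the scalar `γ_{i_1}`, so
      -- their difference is homogeneous.
      have h9 : (2 : ℤ) + (psiDeg Γ lam γ i.1 0 + 0) = 0 := by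
        rw [psiDeg_zero _ (by omega), h7]; rfl
      rw [h9, AddMonoidAlgebra.smul_single, ← AddMonoidAlgebra.single_sub,
        oddQ₂_single Γ h4 h8, hm, AddMonoidAlgebra.smul_single]
      congr 1
      rw [h8, d₂_symm, d₂_ne h5, h6, h7]
      ring

/-- The coaction of the grading group. -/
noncomputable def coact [Fintype β] (hβ : Stable β Γ) (hγ : ∀ i, Γ.θ i ≠ i → γ i = 0) :
    V Γ lam γ β →ₐ[K] AddMonoidAlgebra (V Γ lam γ β) ℤ :=
  V.lift id _ (coact_rep hβ hγ) fun b b' h => by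
    rw [← mul_one b, ← mul_one b', AddMonoidAlgebra.one_def, ← V.sum_e,
      ← AddMonoidAlgebra.singleAddHom_apply, map_sum, Finset.mul_sum, Finset.mul_sum]
    exact Finset.sum_congr rfl fun i _ => h i

theorem isWord_mul {k l : ℤ} {x x' : V Γ lam γ β} (hx : IsWord Γ lam γ β k x)
    (hx' : IsWord Γ lam γ β l x') : IsWord Γ lam γ β (k + l) (x * x') := by
  induction hx' with
  | one => simpa using hx
  | mul_e _ i h => rw [← mul_assoc]; exact h.mul_e i
  | mul_y _ a h => rw [← mul_assoc, ← add_assoc]; exact h.mul_y a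
  | mul_psi0 _ h0 i h => rw [← mul_assoc, ← add_assoc]; exact h.mul_psi0 h0 i
  | mul_psi _ b hb i h => rw [← mul_assoc, ← add_assoc]; exact h.mul_psi b hb i

instance : SetLike.GradedMonoid (V.grading Γ lam γ β) where
  one_mem := Submodule.subset_span .one
  mul_mem k l x x' hx hx' := by
    have : (V.grading Γ lam γ β k) * (V.grading Γ lam γ β l) ≤ V.grading Γ lam γ β (k + l) := by
      unfold V.grading
      rw [Submodule.span_mul_span, Submodule.span_le]
      rintro _ ⟨a, ha, b, hb, rfl⟩
      exact Submodule.subset_span (isWord_mul ha hb)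
    exact this (Submodule.mul_mem_mul hx hx')

theorem IsWord.mem_grading {k : ℤ} {x : V Γ lam γ β} (h : IsWord Γ lam γ β k x) :
    x ∈ V.grading Γ lam γ β k := Submodule.subset_span h

theorem V.e_mem_grading (i : β) : V.e i ∈ V.grading Γ lam γ β 0 := by
  have h := (IsWord.one.mul_e i).mem_grading (Γ := Γ) (lam := lam) (γ := γ)
  rwa [one_mul] at h

theorem V.y_mem_grading (a : ℕ) : V.y a ∈ V.grading Γ lam γ β 2 := by
  by_cases h : a < n
  · rw [V.y_of_lt h]
    have h' := (IsWord.one.mul_y ⟨a, h⟩).mem_grading (Γ := Γ) (lam := lam) (γ := γ) (β := β)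
    rwa [one_mul, zero_add] at h'
  · simp [V.y, h]

theorem V.psi_e_mem_grading (b : ℕ) (i : β) :
    V.psi b * V.e i ∈ V.grading Γ lam γ β (psiDeg Γ lam γ i.1 b) := by
  by_cases h : b < n
  · rw [V.psi_of_lt h]
    cases b with
    | zero =>
      rw [psiDeg_zero _ h]
      have h' := (IsWord.one.mul_psi0 h i).mem_grading (Γ := Γ) (lam := lam) (γ := γ) (β := β)
      rwa [one_mul, zero_add] at h'
    | succ b =>
      rw [psiDeg_succ _ h]
      have h' := (IsWord.one.mul_psi b h i).mem_grading (Γ := Γ) (lam := lam) (γ := γ) (β := β)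
      rwa [one_mul, zero_add] at h'
  · simp [V.psi, h]

/-- A homomorphism that maps the homogeneous generators into homogeneous components is graded. -/
theorem V.map_grading {B : Type*} [Ring B] [Algebra K B] (𝒢 : ℤ → Submodule K B)
    [SetLike.GradedMonoid 𝒢] (f : V Γ lam γ β →ₐ[K] B) (he : ∀ i, f (V.e i) ∈ 𝒢 0)
    (hy : ∀ a, a < n → f (V.y a) ∈ 𝒢 2)
    (hpsi : ∀ b i, b < n → f (V.psi b * V.e i) ∈ 𝒢 (psiDeg Γ lam γ i.1 b))
    {k : ℤ} {x : V Γ lam γ β} (hx : x ∈ V.grading Γ lam γ β k) : f x ∈ 𝒢 k := by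
  suffices V.grading Γ lam γ β k ≤ (𝒢 k).comap f.toLinearMap from this hx
  unfold V.grading
  rw [Submodule.span_le]
  clear hx x
  intro x hx
  change f x ∈ 𝒢 k
  induction hx with
  | one => rw [map_one]; exact SetLike.GradedOne.one_mem
  | mul_e hx i h =>
    rw [map_mul]
    have h' := SetLike.GradedMul.mul_mem h (he i)
    rwa [add_zero] at h'
  | mul_y hx a h => rw [map_mul, V.gen_y]; exact SetLike.GradedMul.mul_mem h (hy a a.2)
  | mul_psi0 hx h0 i h =>
    rw [map_mul, V.gen_psi, ← psiDeg_zero]; exact SetLike.GradedMul.mul_mem h (hpsi _ i h0)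
  | mul_psi hx b hb i h =>
    rw [map_mul, V.gen_psi, ← psiDeg_succ (lam := lam) (γ := γ)]
    exact SetLike.GradedMul.mul_mem h (hpsi _ i hb)

/-- `V_β(Γ, λ, γ)` is a graded algebra. -/
theorem V.gradedAlgebra (hβ : Stable β Γ) (hγ : ∀ i, Γ.θ i ≠ i → γ i = 0) :
    Nonempty (GradedAlgebra (V.grading Γ lam γ β)) := by
  have := hβ.finite
  have := Fintype.ofFinite β
  let f := coact (lam := lam) (γ := γ) hβ hγ
  -- The coaction multiplies elements of degree `k` by the monomial of exponent `k`.
  have hf : ∀ (k : ℤ) (x : V Γ lam γ β), x ∈ V.grading Γ lam γ β k → f x = single k x := by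
    intro k x hx
    unfold V.grading at hx
    induction hx using Submodule.span_induction with
    | mem x hx =>
      have hgen : ∀ g, f (V.gen Γ lam γ β g) = _ := V.lift_gen _ _ _ _
      have he : ∀ i, V.e i * V.e i = (V.e i : V Γ lam γ β) := V.e_mul_self
      induction hx with
      | one => rw [map_one]; rfl
      | mul_e hx i h =>
        rw [map_mul, h, hgen, genImage, AddMonoidAlgebra.single_mul_single, add_zero]; rfl
      | mul_y hx a h =>
        rw [map_mul, h, hgen, genImage, AddMonoidAlgebra.single_mul_single, V.gen_y]
      | mul_psi0 hx h0 i h =>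
        rw [map_mul, map_mul, h, hgen, hgen, genImage, genImage,
          coactPsi_mul_single _ _ (he i), AddMonoidAlgebra.single_mul_single, V.gen_psi,
          psiDeg_zero _ h0, add_zero]; rfl
      | mul_psi hx b hb i h =>
        rw [map_mul, map_mul, h, hgen, hgen, genImage, genImage,
          coactPsi_mul_single _ _ (he i), AddMonoidAlgebra.single_mul_single, V.gen_psi,
          psiDeg_succ _ hb, add_zero]; rfl
    | zero => simp
    | add x y _ _ hx hy => rw [map_add, hx, hy, AddMonoidAlgebra.single_add]
    | smul c x _ hx => rw [map_smul, hx, AddMonoidAlgebra.smul_single]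
  have hint : DirectSum.IsInternal (V.grading Γ lam γ β) := by
    constructor
    · rw [injective_iff_map_eq_zero]
      intro a ha
      -- The homogeneous components of an element are read off as the coefficients of its image
      -- under the coaction, so the sum of the components is direct.
      have key : ∀ (a : DirectSum ℤ fun k => V.grading Γ lam γ β k) (k : ℤ),
          (f (DirectSum.coeAddMonoidHom (V.grading Γ lam γ β) a)).coeff k =
            (a k : V Γ lam γ β) := by
        intro a k
        induction a using DirectSum.induction_on with
        | zero => simp
        | of j x =>
          rw [DirectSum.coeAddMonoidHom_of, hf j x x.2, AddMonoidAlgebra.coeff_single,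
            Finsupp.single_apply,
            DirectSum.of_apply]
          split_ifs with h
          · subst h; rfl
          · rfl
        | add x y hx hy => simp [hx, hy]
      refine DFinsupp.ext fun k => Subtype.ext ?_
      rw [← key, ha]
      simp
    · intro x
      let S := (DirectSum.coeAlgHom (V.grading Γ lam γ β)).range
      have hS : ∀ (k : ℤ) (x : V Γ lam γ β), x ∈ V.grading Γ lam γ β k → x ∈ S := fun k x hx =>
        ⟨DirectSum.of (fun k => V.grading Γ lam γ β k) k ⟨x, hx⟩, by
          change DirectSum.coeAlgHom _ _ = _
          rw [DirectSum.coeAlgHom_of]⟩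
      refine V.mem_of_gen_mem S ?_ x
      rintro (a | b | i)
      · rw [V.gen_y]; exact hS _ _ (V.y_mem_grading _)
      -- The generator `ψ_b` alone need not be homogeneous, but it is the sum of the homogeneous
      -- elements `ψ_b e(i)`.
      · rw [V.gen_psi, ← mul_one (V.psi _), ← V.sum_e, Finset.mul_sum]
        exact sum_mem fun i _ => hS _ _ (V.psi_e_mem_grading _ _)
      · exact hS _ _ (V.e_mem_grading i)
  let := hint.chooseDecomposition
  exact ⟨{ }⟩

end Grading

/-! ### Words with prescribed content -/

/-- The words of length `n` in which the letter `j` occurs `m j` times. -/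
abbrev Word (n : ℕ) {d : ℕ} (m : Fin d → ℕ) : Type :=
  {w : Fin n → Fin d // ∀ j, Fintype.card {a : Fin n // w a = j} = m j}

namespace Word

variable {n d : ℕ} {m : Fin d → ℕ}

/-- The rearrangement of a word by a permutation of the positions. -/
def perm (w : Word n m) (σ : Equiv.Perm (Fin n)) : Word n m :=
  ⟨w.1 ∘ σ, fun j => by
    rw [← w.2 j]
    exact Fintype.card_congr (σ.subtypeEquiv fun a => Iff.rfl)⟩

/-- The word with the letters in positions `k` and `k + 1` exchanged. -/
def sw (w : Word n m) (k : ℕ) (hk : k + 1 < n) : Word n m :=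
  w.perm (Equiv.swap ⟨k, by omega⟩ ⟨k + 1, hk⟩)

theorem sw_apply (w : Word n m) (k : ℕ) (hk : k + 1 < n) (a : ℕ) (ha : a < n) :
    (w.sw k hk).1 ⟨a, ha⟩ = if a = k then w.1 ⟨k + 1, hk⟩ else if a = k + 1 then
      w.1 ⟨k, by omega⟩ else w.1 ⟨a, ha⟩ := by
  simp only [sw, perm, Function.comp_apply, Equiv.swap_apply_def, Fin.mk.injEq]
  split_ifs <;> rfl

theorem ext_nat {w v : Word n m} (h : ∀ a (ha : a < n), w.1 ⟨a, ha⟩ = v.1 ⟨a, ha⟩) : w = v :=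
  Subtype.ext (funext fun a => h a.1 a.2)

@[simp] theorem sw_sw (w : Word n m) (k : ℕ) (hk : k + 1 < n) : (w.sw k hk).sw k hk = w := by
  refine ext_nat fun a ha => ?_
  simp only [sw_apply]
  split_ifs <;> first | omega | (subst_vars; rfl)

theorem sw_eq_self {w : Word n m} {k : ℕ} {hk : k + 1 < n}
    (h : w.1 ⟨k, by omega⟩ = w.1 ⟨k + 1, hk⟩) : w.sw k hk = w := by
  refine ext_nat fun a ha => ?_
  rw [sw_apply]
  split_ifs with h1 h2
  · subst h1; exact h.symm
  · subst h2; exact h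
  · rfl

theorem sw_comm (w : Word n m) {k l : ℕ} (hk : k + 1 < n) (hl : l + 1 < n) (hkl : k + 1 < l) :
    (w.sw k hk).sw l hl = (w.sw l hl).sw k hk := by
  refine ext_nat fun a ha => ?_
  simp only [sw_apply]
  split_ifs <;> omega

theorem sw_braid (w : Word n m) {k : ℕ} (hk : k + 2 < n) :
    ((w.sw k (by omega)).sw (k + 1) hk).sw k (by omega) =
      ((w.sw (k + 1) hk).sw k (by omega)).sw (k + 1) hk := by
  refine ext_nat fun a ha => ?_
  simp only [sw_apply]
  split_ifs <;> omega

/-- Each letter occurs equally often in both words; bijections between the sets of its positions are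
glued to a permutation. -/
theorem exists_perm (w v : Word n m) : ∃ σ : Equiv.Perm (Fin n), v = w.perm σ := by
  have h : ∀ j, Nonempty ({a // v.1 a = j} ≃ {a // w.1 a = j}) := fun j =>
    Fintype.card_eq.mp ((v.2 j).trans (w.2 j).symm)
  refine ⟨Equiv.ofFiberEquiv fun j => (h j).some, Subtype.ext (funext fun a => ?_)⟩
  exact (Equiv.ofFiberEquiv_map _ a).symm

/-- All words of the given content are rearrangements of each other, and a sequence has only one
sorted rearrangement. The permutation `π` allows the letters to be ordered differently, in
particular with a chosen letter first. -/
theorem eq_of_monotone {π : Equiv.Perm (Fin d)} {w v : Word n m} (hw : Monotone (π ∘ w.1))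
    (hv : Monotone (π ∘ v.1)) : w = v := by
  obtain ⟨σ, rfl⟩ := exists_perm w v
  have h := Tuple.unique_monotone (f := π ∘ w.1) (σ := 1) (τ := σ) hw hv
  exact Subtype.ext (funext fun a => π.injective (congrFun h a))

theorem exists_monotone (π : Equiv.Perm (Fin d)) (w : Word n m) :
    ∃ v : Word n m, Monotone (π ∘ v.1) :=
  ⟨w.perm (Tuple.sort (π ∘ w.1)), Tuple.monotone_sort (π ∘ w.1)⟩

theorem exists_descent {π : Equiv.Perm (Fin d)} {w : Word n m} (h : ¬ Monotone (π ∘ w.1)) :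
    ∃ k, ∃ hk : k + 1 < n, π (w.1 ⟨k + 1, hk⟩) < π (w.1 ⟨k, by omega⟩) := by
  cases n with
  | zero => exact absurd (fun a => a.elim0) h
  | succ n =>
    rw [Fin.monotone_iff_le_succ] at h
    push Not at h
    obtain ⟨i, hi⟩ := h
    exact ⟨i.1, by omega, hi⟩

/-- The lexicographic key used to sort words with respect to the order given by `π`. -/
def key (π : Equiv.Perm (Fin d)) (w : Word n m) : Lex (Fin n → Fin d) := toLex (π ∘ w.1)

theorem key_sw_lt {π : Equiv.Perm (Fin d)} {w : Word n m} {k : ℕ} {hk : k + 1 < n}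
    (h : π (w.1 ⟨k + 1, hk⟩) < π (w.1 ⟨k, by omega⟩)) : (w.sw k hk).key π < w.key π :=
  Pi.lex_desc (f := π ∘ w.1) (i := ⟨k, by omega⟩) (j := ⟨k + 1, hk⟩) (by simp) h

/-- Words are finite in number and the lexicographic order is linear. By `key_sw_lt` the key drops
at every exchange in a descent, so this is induction along a sorting procedure. -/
theorem sort_induction (π : Equiv.Perm (Fin d)) {P : Word n m → Prop}
    (h : ∀ w, (∀ v, v.key π < w.key π → P v) → P w) (w : Word n m) : P w := by
  have : WellFoundedLT (Lex (Fin n → Fin d)) := Finite.to_wellFoundedLT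
  exact (InvImage.wf (key π) (wellFounded_lt)).induction w fun w ih => h w ih

/-- Orbit counting: the permutations of the positions map onto the words by rearranging `w`, and
each fibre is a translate of a stabilizer, of order `∏ (m j)!`. Summing the fibres gives `n!`, which
is the identity that characterizes the multinomial coefficient. -/
theorem card_eq (w : Word n m) : Fintype.card (Word n m) = Nat.multinomial Finset.univ m := by
  classical
  have hm : ∑ j, m j = n := by
    simp_rw [← w.2]
    rw [← Fintype.card_sigma]
    exact (Fintype.card_congr (Equiv.sigmaFiberEquiv w.1)).trans (Fintype.card_fin n)
  have h1 := DomMulAct.stabilizer_card w.1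
  simp_rw [w.2] at h1
  have h2 : ∀ v : Word n m, Fintype.card {σ : Equiv.Perm (Fin n) // w.perm σ = v} =
      ∏ j, (m j).factorial := by
    intro v
    obtain ⟨τ, rfl⟩ := exists_perm w v
    rw [← h1]
    refine Fintype.card_congr ((Equiv.mulRight τ⁻¹).subtypeEquiv fun σ => ?_)
    constructor
    · intro h
      funext a
      have := congrFun (congrArg Subtype.val h) (τ⁻¹ a)
      simpa [perm] using this
    · intro h
      refine Subtype.ext (funext fun a => ?_)
      have := congrFun h (τ a)
      simpa [perm] using this
  have h3 := Fintype.card_congr (Equiv.sigmaFiberEquiv (fun σ : Equiv.Perm (Fin n) => w.perm σ))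
  rw [Fintype.card_sigma, Finset.sum_congr rfl fun v _ => h2 v, Finset.sum_const, smul_eq_mul,
    Finset.card_univ, Fintype.card_perm, Fintype.card_fin] at h3
  have h4 := Nat.multinomial_spec Finset.univ m
  rw [hm, ← h3, mul_comm] at h4
  exact (Nat.eq_of_mul_eq_mul_right (Finset.prod_pos fun j _ => Nat.factorial_pos _) h4).symm

end Word

/-! ### Matrix units from shuffles -/

section Shuffle

variable {n d : ℕ} {m : Fin d → ℕ} {R : Type*} [Ring R]

/-- Idempotents indexed by words and elements exchanging them, such that exchanging different
letters is an involution. -/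
structure Shuffle (e : Word n m → R) (s : ℕ → R) : Prop where
  e_self (w) : e w * e w = e w
  e_ne (w v) (h : w ≠ v) : e w * e v = 0
  s_e (k) (hk : k + 1 < n) (w : Word n m) : s k * e w = e (w.sw k hk) * s k
  s_sq (k) (hk : k + 1 < n) (w : Word n m) (h : w.1 ⟨k, by omega⟩ ≠ w.1 ⟨k + 1, hk⟩) :
    s k * (s k * e w) = e w
  s_comm (k l) (hl : l + 1 < n) (hkl : k + 1 < l) : s k * s l = s l * s k
  braid (k) (hk : k + 2 < n) (w : Word n m) (h : w.1 ⟨k, by omega⟩ ≠ w.1 ⟨k + 2, hk⟩) :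
    s (k + 1) * (s k * (s (k + 1) * e w)) = s k * (s (k + 1) * (s k * e w))

/-- The pairs of mutually inverse elements given by the ways to sort a word. -/
inductive SortPath (e : Word n m → R) (s : ℕ → R) (w₀ : Word n m) : Word n m → R → R → Prop
  | base : SortPath e s w₀ w₀ (e w₀) (e w₀)
  | step (k : ℕ) (hk : k + 1 < n) (w : Word n m) (x x' : R)
      (h : w.1 ⟨k + 1, hk⟩ < w.1 ⟨k, by omega⟩) (hx : SortPath e s w₀ (w.sw k hk) x x') :
      SortPath e s w₀ w (s k * x) (x' * s k)

variable {e : Word n m → R} {s : ℕ → R} {w₀ : Word n m}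

theorem Shuffle.e_s (S : Shuffle e s) (k) (hk : k + 1 < n) (w : Word n m) :
    e w * s k = s k * e (w.sw k hk) := by
  rw [S.s_e k hk, Word.sw_sw]

/-- The factors `s k` occur only at descents, where the two letters differ, so each is its own
inverse between the two idempotents. Together the six identities make `x` an isomorphism between the
corners of `w₀` and `w`, with inverse `x'`. -/
theorem SortPath.facts (S : Shuffle e s) {w : Word n m} {x x' : R} (h : SortPath e s w₀ w x x') :
    e w * x = x ∧ x * e w₀ = x ∧ e w₀ * x' = x' ∧ x' * e w = x' ∧ x * x' = e w ∧ x' * x = e w₀ := by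
  induction h with
  | base => simp [S.e_self]
  | step k hk w x x' h hx ih =>
    obtain ⟨h1, h2, h3, h4, h5, h6⟩ := ih
    have hsq : s k * (s k * e (w.sw k hk)) = e (w.sw k hk) := by
      refine S.s_sq k hk _ ?_
      simp only [Word.sw_apply]
      simpa using h.ne
    refine ⟨?_, ?_, ?_, ?_, ?_, ?_⟩
    · rw [← mul_assoc, S.e_s k hk, mul_assoc, h1]
    · rw [mul_assoc, h2]
    · rw [← mul_assoc, h3]
    · rw [mul_assoc, S.s_e k hk, ← mul_assoc, h4]
    · rw [mul_assoc, ← mul_assoc x, h5, ← S.s_e k hk, S.s_sq k hk _ h.ne']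
    · rw [mul_assoc, ← h1, ← mul_assoc (s k) (e _), ← mul_assoc (s k) (s k * _), hsq, h1, h6]

theorem SortPath.exists (hw₀ : Monotone w₀.1) (w : Word n m) : ∃ x x', SortPath e s w₀ w x x' := by
  induction w using Word.sort_induction 1 with
  | h w ih =>
    by_cases hw : Monotone w.1
    · obtain rfl := Word.eq_of_monotone (π := 1) hw₀ hw
      exact ⟨_, _, .base⟩
    · obtain ⟨k, hk, h⟩ := Word.exists_descent (π := 1) hw
      obtain ⟨x, x', hx⟩ := ih _ (Word.key_sw_lt h)
      exact ⟨_, _, .step k hk w x x' h hx⟩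

/-- Local confluence. If the first steps `k`, `l` are far apart they commute, and both routes
continue to the same word. If `l = k + 1`, three letters decrease strictly, both routes reach the
word with these three letters reversed, and the two products agree by the braid relation, which is
available because the outer letters differ. The induction hypothesis replaces the given
continuations by the common one. -/
theorem SortPath.diamond (S : Shuffle e s) (hw₀ : Monotone w₀.1) {w : Word n m}
    (ih : ∀ v : Word n m, v.key 1 < w.key 1 → ∀ x x' y y', SortPath e s w₀ v x x' →
      SortPath e s w₀ v y y' → x = y) {k l : ℕ} (hkl : k < l) (hk : k + 1 < n) (hl : l + 1 < n)
    (h : w.1 ⟨k + 1, hk⟩ < w.1 ⟨k, by omega⟩) (h' : w.1 ⟨l + 1, hl⟩ < w.1 ⟨l, by omega⟩)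
    {x x' y y' : R} (hx : SortPath e s w₀ (w.sw k hk) x x')
    (hy : SortPath e s w₀ (w.sw l hl) y y') : s k * x = s l * y := by
  have i1 := ih _ (Word.key_sw_lt (π := 1) h)
  have i2 := ih _ (Word.key_sw_lt (π := 1) h')
  rcases Nat.lt_or_ge (k + 1) l with hkl' | hkl'
  · obtain ⟨z, z', hz⟩ := SortPath.exists (e := e) (s := s) hw₀ ((w.sw k hk).sw l hl)
    have e1 := i1 _ _ _ _ hx (.step l hl _ z z' (by
      simp only [Word.sw_apply]
      rw [if_neg (by omega), if_neg (by omega), if_neg (by omega), if_neg (by omega)]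
      exact h') hz)
    rw [Word.sw_comm _ _ _ hkl'] at hz
    have e2 := i2 _ _ _ _ hy (.step k hk _ z z' (by
      simp only [Word.sw_apply]
      rw [if_neg (by omega), if_neg (by omega), if_neg (by omega), if_neg (by omega)]
      exact h) hz)
    rw [e1, e2, ← mul_assoc, S.s_comm k l hl hkl', mul_assoc]
  · obtain rfl : l = k + 1 := by omega
    obtain ⟨z, z', hz⟩ := SortPath.exists (e := e) (s := s) hw₀
      (((w.sw k hk).sw (k + 1) hl).sw k hk)
    have ha : ¬ k + 1 + 1 = k := by omega
    have hb : ¬ k = k + 1 + 1 := by omega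
    have hv := (hz.facts S).1
    have e1 := i1 _ _ _ _ hx (.step (k + 1) hl _ _ _ (by
      simpa [Word.sw_apply, ha, hb] using h'.trans h) (.step k hk _ z z' (by
      simpa [Word.sw_apply, ha, hb] using h') hz))
    rw [Word.sw_braid] at hz
    have e2 := i2 _ _ _ _ hy (.step k hk _ _ _ (by
      simpa [Word.sw_apply, ha, hb] using h'.trans h) (.step (k + 1) hl _ z z' (by
      simpa [Word.sw_apply, ha, hb] using h) hz))
    rw [e1, e2, ← hv]
    have := congrArg (· * z) (S.braid k hl (((w.sw k hk).sw (k + 1) hl).sw k hk) (by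
      simpa [Word.sw_apply, ha, hb] using (h'.trans h).ne))
    simp only [mul_assoc] at this ⊢
    exact this.symm

/-- Confluence by induction on the word: a sorted word has no descent and only the trivial path, and
two different first steps are compared by `SortPath.diamond`. -/
theorem SortPath.unique (S : Shuffle e s) (hw₀ : Monotone w₀.1) (w : Word n m) :
    ∀ x x' y y', SortPath e s w₀ w x x' → SortPath e s w₀ w y y' → x = y := by
  induction w using Word.sort_induction 1 with
  | h w ih =>
    intro x x' y y' hx hy
    cases hx with
    | base =>
      cases hy with
      | base => rfl
      | step k hk _ y y' h hy => exact absurd (hw₀ (by simp)) h.not_ge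
    | step k hk _ x x' h hx =>
      cases hy with
      | base => exact absurd (hw₀ (by simp)) h.not_ge
      | step l hl _ y y' h' hy =>
        rcases lt_trichotomy k l with hkl | rfl | hkl
        · exact SortPath.diamond S hw₀ ih hkl hk hl h h' hx hy
        · rw [ih _ (Word.key_sw_lt (π := 1) h) _ _ _ _ hx hy]
        · exact (SortPath.diamond S hw₀ ih hkl hl hk h' h hy hx).symm

/-- Matrix units that contain the given idempotents and the exchanges of different letters. -/
structure MatUnits (e : Word n m → R) (s : ℕ → R) (M : Word n m → Word n m → R) : Prop where
  diag (w) : M w w = e w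
  mul (w u v) : M w u * M u v = M w v
  mul_ne (w u u' v) (h : u ≠ u') : M w u * M u' v = 0
  s_mul (k) (hk : k + 1 < n) (w u : Word n m) (h : w.1 ⟨k, by omega⟩ ≠ w.1 ⟨k + 1, hk⟩) :
    s k * M w u = M (w.sw k hk) u

/-- The matrix units are `T w * T' u`, where `T w` and `T' w` come from some way to sort `w`. The
exchange rule needs independence of that way: if `k` is an ascent of `w`, then `s k * T w` is an
admissible choice of `T` for the exchanged word; if `k` is a descent, `T w` may be assumed to begin
with `s k`, which cancels. -/
theorem Shuffle.exists_matUnits (S : Shuffle e s) : ∃ M, MatUnits e s M := by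
  rcases isEmpty_or_nonempty (Word n m) with hW | ⟨⟨w₁⟩⟩
  · exact ⟨fun _ _ => 0, fun w => hW.elim w, fun w => hW.elim w, fun w => hW.elim w,
      fun _ _ w => hW.elim w⟩
  obtain ⟨w₀, hw₀⟩ := Word.exists_monotone 1 w₁
  choose T T' hT using SortPath.exists (e := e) (s := s) (w₀ := w₀) hw₀
  refine ⟨fun w u => T w * T' u, ?_, ?_, ?_, ?_⟩
  · intro w; exact ((hT w).facts S).2.2.2.2.1
  · intro w u v
    rw [mul_assoc, ← mul_assoc (T' u), ((hT u).facts S).2.2.2.2.2, ← mul_assoc,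
      ((hT w).facts S).2.1]
  · intro w u u' v h
    rw [mul_assoc, ← mul_assoc (T' u), ← ((hT u).facts S).2.2.2.1, ← ((hT u').facts S).1,
      ← mul_assoc (T' u * e u), mul_assoc (T' u), S.e_ne _ _ h]
    simp
  · intro k hk w u h
    rw [← mul_assoc]
    congr 1
    rcases lt_or_gt_of_ne h with h | h
    · refine SortPath.unique S hw₀ _ _ (T' w * s k) _ _ (.step k hk _ _ _ ?_ ?_) (hT _)
      · simpa [Word.sw_apply] using h
      · rw [Word.sw_sw]; exact hT w
    · have e1 := SortPath.unique S hw₀ _ _ _ _ _ (hT w) (.step k hk w _ _ h (hT _))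
      have hne : (w.sw k hk).1 ⟨k, by omega⟩ ≠ (w.sw k hk).1 ⟨k + 1, hk⟩ := by
        simpa [Word.sw_apply] using h.ne
      rw [e1, ← ((hT (w.sw k hk)).facts S).1, ← mul_assoc (s k) (e _), ← mul_assoc (s k) (s k * _),
        S.s_sq k hk _ hne, ((hT (w.sw k hk)).facts S).1]

namespace MatUnits

variable {M : Word n m → Word n m → R}

theorem e_mul (U : MatUnits e s M) (w u) : e w * M w u = M w u := by
  rw [← U.diag, U.mul]

theorem mul_e (U : MatUnits e s M) (w u) : M w u * e u = M w u := by
  rw [← U.diag, U.mul]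

theorem sw_eq (U : MatUnits e s M) (k) (hk : k + 1 < n) (w : Word n m)
    (h : w.1 ⟨k, by omega⟩ ≠ w.1 ⟨k + 1, hk⟩) : M (w.sw k hk) w = s k * e w := by
  rw [← U.diag, U.s_mul k hk w w h]

/-- Elements that are locally compatible with the matrix units are globally compatible. -/
theorem intertwine (U : MatUnits e s M) (π : Equiv.Perm (Fin d)) (f : Word n m → R)
    (C : Word n m → Prop) (hcomm : ∀ w, C w → f w * e w = e w * f w)
    (hstep : ∀ w, C w → ¬ Monotone (π ∘ w.1) →
      ∃ v, C v ∧ v.key π < w.key π ∧ M v w * f w = f v * M v w)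
    {w w' : Word n m} (hw : C w) (hw' : C w') : M w' w * f w = f w' * M w' w := by
  -- Composing local compatibilities leads from any word in `C` to a sorted one. The sorted word is
  -- unique, so `w` and `w'` reach the same `u`.
  have key : ∀ w, C w → ∃ u, C u ∧ Monotone (π ∘ u.1) ∧ M u w * f w = f u * M u w := by
    intro w
    induction w using Word.sort_induction π with
    | h w ih =>
      intro hw
      by_cases hm : Monotone (π ∘ w.1)
      · exact ⟨w, hw, hm, by rw [U.diag, hcomm w hw]⟩
      · obtain ⟨v, hv, hlt, hvw⟩ := hstep w hw hm
        obtain ⟨u, hu, hmu, huv⟩ := ih v hlt hv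
        refine ⟨u, hu, hmu, ?_⟩
        rw [← U.mul u v w, mul_assoc, hvw, ← mul_assoc, huv, mul_assoc]
  obtain ⟨u, hu, hmu, h1⟩ := key w hw
  obtain ⟨u', hu', hmu', h2⟩ := key w' hw'
  obtain rfl := Word.eq_of_monotone hmu hmu'
  rw [← U.mul w' u w, mul_assoc, h1, ← mul_assoc, ← mul_assoc]
  congr 1
  -- Multiplication by `M w' u` on both sides inverts the compatibility between `w'` and `u`.
  have h3 := congrArg (fun x => M w' u * x * M w' u) h2
  simp only [← mul_assoc, U.mul, U.diag] at h3
  rw [mul_assoc, mul_assoc, U.mul, U.diag, mul_assoc _ (f u), hcomm u hu, ← mul_assoc _ (e u),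
    U.mul_e, ← mul_assoc, ← hcomm w' hw', mul_assoc, U.e_mul] at h3
  exact h3.symm

end MatUnits

end Shuffle

/-! ### Ranks of the letters of a word -/

namespace Word

variable {n d : ℕ} {m : Fin d → ℕ}

/-- The letter in position `k` is `j`. -/
def Occ (w : Word n m) (j : Fin d) (k : ℕ) : Prop := ∃ h : k < n, w.1 ⟨k, h⟩ = j

instance (w : Word n m) (j : Fin d) : DecidablePred (Occ w j) := fun _ =>
  inferInstanceAs (Decidable (∃ _, _))

/-- The number of occurrences of the letter `j` before position `a`. -/
def cnt (w : Word n m) (j : Fin d) (a : ℕ) : ℕ := Nat.count (Occ w j) a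

theorem cnt_zero (w : Word n m) (j : Fin d) : w.cnt j 0 = 0 := Nat.count_zero _

theorem occ_iff (w : Word n m) (j : Fin d) {a : ℕ} (ha : a < n) :
    Occ w j a ↔ w.1 ⟨a, ha⟩ = j := ⟨fun ⟨_, h⟩ => h, fun h => ⟨ha, h⟩⟩

theorem cnt_succ (w : Word n m) (j : Fin d) {a : ℕ} (ha : a < n) :
    w.cnt j (a + 1) = w.cnt j a + if w.1 ⟨a, ha⟩ = j then 1 else 0 := by
  rw [cnt, Nat.count_succ]
  simp only [occ_iff w j ha]
  rfl

theorem cnt_succ_self (w : Word n m) {j : Fin d} {a : ℕ} {ha : a < n} (h : w.1 ⟨a, ha⟩ = j) :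
    w.cnt j (a + 1) = w.cnt j a + 1 := by rw [cnt_succ _ _ ha, if_pos h]

theorem cnt_succ_ne (w : Word n m) {j : Fin d} {a : ℕ} {ha : a < n} (h : w.1 ⟨a, ha⟩ ≠ j) :
    w.cnt j (a + 1) = w.cnt j a := by rw [cnt_succ _ _ ha, if_neg h, add_zero]

theorem cnt_mono (w : Word n m) (j : Fin d) : Monotone (w.cnt j) := Nat.count_monotone _

theorem cnt_total (w : Word n m) (j : Fin d) : w.cnt j n = m j := by
  rw [← w.2 j, cnt, Nat.count_eq_card_filter_range, Fintype.card_subtype]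
  symm
  refine Finset.card_bij (fun a _ => a.1) ?_ ?_ ?_
  · intro a ha
    simp only [Finset.mem_filter, Finset.mem_univ, true_and, Finset.mem_range] at ha ⊢
    exact ⟨a.2, a.2, ha⟩
  · intro a _ b _ h; exact Fin.ext h
  · intro b hb
    simp only [Finset.mem_filter, Finset.mem_range] at hb
    obtain ⟨hb, hb', h⟩ := hb
    exact ⟨⟨b, hb⟩, by simpa using h, rfl⟩

theorem cnt_lt (w : Word n m) {j : Fin d} {a : ℕ} {ha : a < n} (h : w.1 ⟨a, ha⟩ = j) :
    w.cnt j a < m j := by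
  have h1 := w.cnt_mono j (show a + 1 ≤ n from ha)
  rw [cnt_succ_self w h, cnt_total] at h1
  omega

theorem cnt_lt_cnt (w : Word n m) {j : Fin d} {a b : ℕ} {ha : a < n} (h : w.1 ⟨a, ha⟩ = j)
    (hab : a < b) : w.cnt j a < w.cnt j b := by
  have h1 := w.cnt_mono j (show a + 1 ≤ b from hab)
  rw [cnt_succ_self w h] at h1
  omega

theorem cnt_inj (w : Word n m) {j : Fin d} {a b : ℕ} {ha : a < n} {hb : b < n}
    (h : w.1 ⟨a, ha⟩ = j) (h' : w.1 ⟨b, hb⟩ = j) (hab : w.cnt j a = w.cnt j b) : a = b := by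
  rcases lt_trichotomy a b with h1 | h1 | h1
  · have := w.cnt_lt_cnt h h1; omega
  · exact h1
  · have := w.cnt_lt_cnt h' h1; omega

theorem exists_cnt_eq (w : Word n m) (j : Fin d) {r : ℕ} (hr : r < m j) :
    ∃ a, ∃ ha : a < n, w.1 ⟨a, ha⟩ = j ∧ w.cnt j a = r := by
  have h : ∀ b ≤ n, r < w.cnt j b → ∃ a, ∃ ha : a < n, w.1 ⟨a, ha⟩ = j ∧ w.cnt j a = r := by
    intro b
    induction b with
    | zero => intro _ h; rw [cnt_zero] at h; omega
    | succ b ih =>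
      intro hb h
      by_cases hj : w.1 ⟨b, hb⟩ = j
      · rw [cnt_succ_self w hj] at h
        rcases Nat.lt_succ_iff_lt_or_eq.mp h with h | h
        · exact ih (by omega) h
        · exact ⟨b, hb, hj, h.symm⟩
      · rw [cnt_succ_ne w hj] at h
        exact ih (by omega) h
  exact h n le_rfl (by rwa [w.cnt_total j])

/-- The position of the occurrence number `r` of the letter `j`. -/
noncomputable def pos (w : Word n m) (j : Fin d) (r : Fin (m j)) : Fin n :=
  ⟨(w.exists_cnt_eq j r.2).choose, (w.exists_cnt_eq j r.2).choose_spec.choose⟩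

theorem apply_pos (w : Word n m) (j : Fin d) (r : Fin (m j)) : w.1 (w.pos j r) = j :=
  (w.exists_cnt_eq j r.2).choose_spec.choose_spec.1

theorem cnt_pos (w : Word n m) (j : Fin d) (r : Fin (m j)) : w.cnt j (w.pos j r).1 = r :=
  (w.exists_cnt_eq j r.2).choose_spec.choose_spec.2

theorem pos_cnt (w : Word n m) {j : Fin d} {a : ℕ} {ha : a < n} (h : w.1 ⟨a, ha⟩ = j) :
    w.pos j ⟨w.cnt j a, w.cnt_lt h⟩ = ⟨a, ha⟩ :=
  Fin.ext (w.cnt_inj (w.apply_pos j _) h (w.cnt_pos j _))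

/-- The increasing enumeration of the positions of the letter `j`. -/
noncomputable def posEmb (w : Word n m) (j : Fin d) : Fin (m j) ↪o Fin n :=
  OrderEmbedding.ofStrictMono (w.pos j) fun r s h => by
    by_contra h'
    have := w.cnt_mono j (not_lt.mp h')
    rw [cnt_pos, cnt_pos] at this
    exact absurd h (not_lt.mpr this)

theorem range_posEmb (w : Word n m) (j : Fin d) : Set.range (w.posEmb j) = {a | w.1 a = j} := by
  ext a
  constructor
  · rintro ⟨r, rfl⟩; exact w.apply_pos j r
  · intro h
    exact ⟨⟨w.cnt j a, w.cnt_lt (ha := a.2) h⟩, w.pos_cnt h⟩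

/-- An exchange in positions `k`, `k + 1` affects only the initial segment that ends between the two
positions. -/
theorem cnt_sw (w : Word n m) {k : ℕ} {hk : k + 1 < n} {j : Fin d} {a : ℕ} (ha : a ≠ k + 1)
    (han : a ≤ n) : (w.sw k hk).cnt j a = w.cnt j a := by
  have h1 : ∀ b ≤ k, (w.sw k hk).cnt j b = w.cnt j b := by
    intro b
    induction b with
    | zero => intro _; rw [cnt_zero, cnt_zero]
    | succ b ih =>
      intro h
      have hb : b < n := by omega
      rw [cnt_succ _ _ hb, cnt_succ _ _ hb, ih (by omega), sw_apply,
        if_neg (show ¬ b = k by omega), if_neg (show ¬ b = k + 1 by omega)]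
  have h2 : ∀ b, k + 2 + b ≤ n → (w.sw k hk).cnt j (k + 2 + b) = w.cnt j (k + 2 + b) := by
    intro b
    induction b with
    | zero =>
      intro _
      rw [add_zero, cnt_succ _ _ hk, cnt_succ _ _ (by omega), cnt_succ _ _ hk,
        cnt_succ _ _ (by omega), h1 k le_rfl, sw_apply, sw_apply]
      simp only [if_true, if_neg (Nat.succ_ne_self k)]
      ring
    | succ b ih =>
      intro h
      have hb : k + 2 + b < n := by omega
      rw [← add_assoc, cnt_succ _ _ hb, cnt_succ _ _ hb, ih (by omega), sw_apply,
        if_neg (show ¬ k + 2 + b = k by omega), if_neg (show ¬ k + 2 + b = k + 1 by omega)]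
  rcases Nat.lt_or_ge k a with h | h
  · obtain ⟨b, rfl⟩ := Nat.exists_eq_add_of_le (show k + 2 ≤ a by omega)
    exact h2 b han
  · exact h1 a h

theorem cnt_sw_left (w : Word n m) {k : ℕ} {hk : k + 1 < n} {j : Fin d}
    (h : w.1 ⟨k + 1, hk⟩ ≠ j) : (w.sw k hk).cnt j (k + 1) = w.cnt j k := by
  rw [cnt_succ_ne (ha := by omega), cnt_sw _ (by omega) (by omega)]
  rw [sw_apply, if_pos rfl]; exact h

/-- The ranks do not change if different letters are exchanged. -/
theorem cnt_sw_swap (w : Word n m) {k : ℕ} {hk : k + 1 < n} {j : Fin d}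
    (h : w.1 ⟨k, by omega⟩ ≠ w.1 ⟨k + 1, hk⟩) {a : ℕ} {ha : a < n} (hj : w.1 ⟨a, ha⟩ = j) :
    (w.sw k hk).cnt j (Equiv.swap k (k + 1) a) = w.cnt j a := by
  by_cases h1 : a = k
  · subst h1
    rw [Equiv.swap_apply_left, cnt_sw_left]
    exact fun h' => h (hj.trans h'.symm)
  by_cases h2 : a = k + 1
  · subst h2
    rw [Equiv.swap_apply_right, cnt_sw _ (by omega) (by omega), cnt_succ_ne (ha := by omega)]
    exact fun h' => h (h'.trans hj.symm)
  · rw [Equiv.swap_apply_of_ne_of_ne h1 h2, cnt_sw _ h2 ha.le]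

theorem lt_of_swap {k a : ℕ} (hk : k + 1 < n) (ha : a < n) : Equiv.swap k (k + 1) a < n := by
  rw [Equiv.swap_apply_def]; split_ifs <;> omega

theorem sw_apply_swap (w : Word n m) {k : ℕ} (hk : k + 1 < n) {a : ℕ} (ha : a < n) :
    (w.sw k hk).1 ⟨Equiv.swap k (k + 1) a, lt_of_swap hk ha⟩ = w.1 ⟨a, ha⟩ := by
  rw [sw_apply]
  by_cases h1 : a = k
  · subst h1; simp
  by_cases h2 : a = k + 1
  · subst h2; simp
  · simp [Equiv.swap_apply_of_ne_of_ne h1 h2, h1, h2]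

/-- In a word sorted with the letter `j` first, the occurrences of `j` are the first positions. -/
theorem apply_of_sorted {π : Equiv.Perm (Fin d)} {w : Word n m} (hw : Monotone (π ∘ w.1))
    {j : Fin d} (hj : (π j).1 = 0) {a : ℕ} (ha : a < m j) :
    ∃ h : a < n, w.1 ⟨a, h⟩ = j := by
  have hn : m j ≤ n := by
    rw [← w.cnt_total j]; exact Nat.count_le _
  refine ⟨by omega, by_contra fun h => ?_⟩
  have h1 : ∀ b : Fin n, w.1 b = j → b.1 < a := by
    intro b hb
    by_contra hab
    have h2 := hw (show (⟨a, by omega⟩ : Fin n) ≤ b from not_lt.mp hab)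
    simp only [Function.comp_apply, hb] at h2
    exact h (π.injective (le_antisymm h2 (by rw [Fin.le_def, hj]; exact Nat.zero_le _)))
  have h3 := Fintype.card_le_of_injective
    (fun b : {b : Fin n // w.1 b = j} => (⟨b.1.1, h1 b.1 b.2⟩ : Fin a)) (fun b c h => by
      simp only [Fin.mk.injEq] at h
      exact Subtype.ext (Fin.ext h))
  rw [w.2 j, Fintype.card_fin] at h3
  omega

theorem cnt_of_sorted {π : Equiv.Perm (Fin d)} {w : Word n m} (hw : Monotone (π ∘ w.1))
    {j : Fin d} (hj : (π j).1 = 0) {a : ℕ} (ha : a ≤ m j) : w.cnt j a = a := by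
  induction a with
  | zero => exact cnt_zero _ _
  | succ a ih =>
    obtain ⟨h, h'⟩ := apply_of_sorted hw hj (show a < m j by omega)
    rw [cnt_succ_self w h', ih (by omega)]

/-- In a sorted word, the occurrences of a letter are consecutive. -/
theorem adjacent_of_sorted {π : Equiv.Perm (Fin d)} {w : Word n m} (hw : Monotone (π ∘ w.1))
    {j : Fin d} {r : ℕ} (hr : r + 1 < m j) : ∃ k, ∃ hk : k + 1 < n, w.1 ⟨k, by omega⟩ = j ∧
      w.1 ⟨k + 1, hk⟩ = j ∧ w.cnt j k = r := by
  obtain ⟨a, ha, h1, h2⟩ := w.exists_cnt_eq j (show r < m j by omega)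
  obtain ⟨b, hb, h3, h4⟩ := w.exists_cnt_eq j hr
  have hab : a < b := by
    by_contra h
    have := w.cnt_mono j (not_lt.mp h)
    omega
  have hk : a + 1 < n := by omega
  refine ⟨a, hk, h1, ?_, h2⟩
  have i1 := hw (show (⟨a, ha⟩ : Fin n) ≤ ⟨a + 1, hk⟩ by simp)
  have i2 := hw (show (⟨a + 1, hk⟩ : Fin n) ≤ ⟨b, hb⟩ by simpa using hab)
  simp only [Function.comp_apply, h1, h3] at i1 i2
  exact π.injective (le_antisymm i2 i1)

/-- A permutation of the letters that puts `j` first. -/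
def first (j : Fin d) : Equiv.Perm (Fin d) := Equiv.swap j ⟨0, j.pos⟩

theorem first_self (j : Fin d) : (first j j).1 = 0 := by simp [first]

end Word

/-! ### Decomposition of tuples into subtuples -/

section Decomp

variable {I : Type u} {A : Type v} {K : Type w} [CommRing K] {d n : ℕ}

/-- The set `β` of tuples is stable under `B_n`, all its elements have `m j` entries in `I^(j)`, and
it contains all the tuples that are made up from subtuples of elements of `β`. -/
structure Decomp (Γ : InvQuiver I A) (p : I → Fin d) (m : Fin d → ℕ) (β : Set (Fin n → I)) : Prop
    extends Stable β Γ where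
  arrows_part : ∀ a, p (Γ.o a) = p (Γ.t a)
  θ_part : ∀ i, p (Γ.θ i) = p i
  nonempty : β.Nonempty
  content : ∀ i ∈ β, ∀ j, Fintype.card {a // p (i a) = j} = m j
  glue : ∀ i : Fin n → I, (∀ j, Fintype.card {a // p (i a) = j} = m j) →
    (∀ j, (subtuples p {i} j (m j) ∩ subtuples p β j (m j)).Nonempty) → i ∈ β

variable {Γ : InvQuiver I A} {p : I → Fin d} {m : Fin d → ℕ} {β : Set (Fin n → I)}

namespace Decomp

variable (D : Decomp Γ p m β)

/-- The word of the parts that contain the entries of a tuple. -/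
def word (i : β) : Word n m := ⟨fun a => p (i.1 a), D.content i.1 i.2⟩

/-- The subtuple of the entries in `I^(j)`. -/
noncomputable def sub (i : β) (j : Fin d) : subtuples p β j (m j) :=
  ⟨fun r => ⟨i.1 ((D.word i).pos j r), (D.word i).apply_pos j r⟩, i.1, i.2, (D.word i).posEmb j,
    (D.word i).range_posEmb j, fun _ => rfl⟩

variable {D}

theorem sub_apply {i : β} {j : Fin d} {a : ℕ} {ha : a < n} (h : p (i.1 ⟨a, ha⟩) = j) {r : ℕ}
    {hr : r < m j} (e : (D.word i).cnt j a = r) : (D.sub i j).1 ⟨r, hr⟩ = ⟨i.1 ⟨a, ha⟩, h⟩ := by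
  subst e
  refine Subtype.ext ?_
  change i.1 ((D.word i).pos j _) = _
  rw [(D.word i).pos_cnt (j := j) (ha := ha) h]

theorem sub_ext {i : β} {j : Fin d} {x : Fin (m j) → part p j}
    (h : ∀ a (ha : a < n) (h : p (i.1 ⟨a, ha⟩) = j),
      (x ⟨(D.word i).cnt j a, (D.word i).cnt_lt (ha := ha) h⟩ : I) = i.1 ⟨a, ha⟩) :
    (D.sub i j).1 = x := by
  funext r
  obtain ⟨r, hr⟩ := r
  obtain ⟨a, ha, h1, h2⟩ := (D.word i).exists_cnt_eq j hr
  subst h2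
  rw [sub_apply (ha := ha) h1 rfl]
  exact Subtype.ext (h a ha h1).symm

/-- A tuple is a shuffle of its subtuples: the word tells from which subtuple an entry comes, and
the rank tells which entry it is. -/
theorem eq_of_sub {i i' : β} (hw : D.word i = D.word i') (h : ∀ j, D.sub i j = D.sub i' j) :
    i = i' := by
  refine Subtype.ext (funext fun a => ?_)
  have h1 := sub_apply (D := D) (i := i) (ha := a.2) (j := p (i.1 a)) rfl
    (hr := (D.word i).cnt_lt (ha := a.2) rfl) rfl
  have h2 := sub_apply (D := D) (i := i') (ha := a.2) (j := p (i.1 a))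
    (congrFun (congrArg Subtype.val hw) a).symm (hr := (D.word i).cnt_lt (ha := a.2) rfl)
    (by rw [hw])
  rw [h, h2] at h1
  exact (congrArg Subtype.val h1).symm

/-- The subtuples are interleaved as `w` prescribes, and `D.glue` puts the result in `β`. With
`eq_of_sub`, tuples of a fixed word correspond to families of subtuples; this product structure of
`β` is what fits the tensor product. -/
theorem exists_sub_eq (D : Decomp Γ p m β) (w : Word n m) (x : ∀ j, subtuples p β j (m j)) :
    ∃ i, D.word i = w ∧ ∀ j, D.sub i j = x j := by
  let i : Fin n → I := fun a => (x (w.1 a)).1 ⟨w.cnt (w.1 a) a, w.cnt_lt (ha := a.2) rfl⟩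
  have hi : ∀ a, p (i a) = w.1 a := fun a => ((x (w.1 a)).1 _).2
  have hi' : ∀ (j : Fin d) (a : ℕ) (ha : a < n) (h : w.1 ⟨a, ha⟩ = j),
      ((x j).1 ⟨w.cnt j a, w.cnt_lt h⟩ : I) = i ⟨a, ha⟩ := by
    rintro _ a ha rfl; rfl
  have hc : ∀ j, Fintype.card {a // p (i a) = j} = m j := by
    intro j; simp only [hi]; exact w.2 j
  have hmem : i ∈ β := by
    refine D.glue i hc fun j => ⟨(x j).1, ⟨i, rfl, w.posEmb j, ?_, ?_⟩, (x j).2⟩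
    · rw [w.range_posEmb]; simp only [hi]
    · intro r
      have := hi' j (w.pos j r).1 (w.pos j r).2 (w.apply_pos j r)
      simp only [w.cnt_pos] at this
      exact this
  have hw : D.word ⟨i, hmem⟩ = w := Subtype.ext (funext hi)
  refine ⟨⟨i, hmem⟩, hw, fun j => Subtype.ext (sub_ext fun a ha h => ?_)⟩
  simp only [hw]
  exact hi' j a ha ((hi _).symm.trans h)

theorem exists_sub_eq_single (D : Decomp Γ p m β) (w : Word n m) {j : Fin d}
    (x : subtuples p β j (m j)) : ∃ i, D.word i = w ∧ D.sub i j = x := by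
  classical
  obtain ⟨i₀, hi₀⟩ := D.nonempty
  obtain ⟨i, h1, h2⟩ := D.exists_sub_eq w (Function.update (D.sub ⟨i₀, hi₀⟩) j x)
  exact ⟨i, h1, by rw [h2, Function.update_self]⟩

theorem word_sw (D : Decomp Γ p m β) (i : β) (k : ℕ) (hk : k + 1 < n) :
    D.word (D.sw i k hk) = (D.word i).sw k hk := rfl

theorem word_th (D : Decomp Γ p m β) (i : β) (h : 0 < n) : D.word (D.th i h) = D.word i := by
  refine Word.ext_nat fun a ha => ?_
  change p ((D.th i h).1 _) = p (i.1 _)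
  rw [th_apply]
  split_ifs with h0
  · subst h0; exact D.θ_part _
  · rfl

/-- Exchanging entries in different parts does not change the subtuples. -/
theorem sub_sw_ne (D : Decomp Γ p m β) {i : β} {k : ℕ} {hk : k + 1 < n}
    (h : p (i.1 ⟨k, by omega⟩) ≠ p (i.1 ⟨k + 1, hk⟩)) (j : Fin d) :
    D.sub (D.sw i k hk) j = D.sub i j := by
  refine Subtype.ext (sub_ext fun a ha hj => ?_).symm
  have ha' := Word.lt_of_swap hk ha
  have h1 : (D.sw i k hk).1 ⟨_, ha'⟩ = i.1 ⟨a, ha⟩ := by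
    rw [sw_apply]
    by_cases h1 : a = k
    · subst h1; simp
    by_cases h2 : a = k + 1
    · subst h2; simp
    · simp [Equiv.swap_apply_of_ne_of_ne h1 h2, h1, h2]
  rw [sub_apply (ha := ha') (by rw [h1]; exact hj)]
  · exact h1
  · exact (D.word i).cnt_sw_swap (hk := hk) h (ha := ha) hj

theorem word_sw_eq (D : Decomp Γ p m β) {i : β} {k : ℕ} {hk : k + 1 < n}
    (h : p (i.1 ⟨k, by omega⟩) = p (i.1 ⟨k + 1, hk⟩)) : D.word (D.sw i k hk) = D.word i :=
  Word.sw_eq_self (w := D.word i) h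

theorem sub_sw_other (D : Decomp Γ p m β) {i : β} {k : ℕ} {hk : k + 1 < n}
    (h : p (i.1 ⟨k, by omega⟩) = p (i.1 ⟨k + 1, hk⟩)) {j : Fin d}
    (hj : p (i.1 ⟨k, by omega⟩) ≠ j) : D.sub (D.sw i k hk) j = D.sub i j := by
  refine Subtype.ext (sub_ext fun a ha hja => ?_).symm
  have h1 : (D.sw i k hk).1 ⟨a, ha⟩ = i.1 ⟨a, ha⟩ := by
    rw [sw_apply, if_neg, if_neg]
    · rintro rfl; exact hj (h.trans hja)
    · rintro rfl; exact hj hja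
  rw [sub_apply (ha := ha) (by rw [h1]; exact hja) (by rw [D.word_sw_eq h])]
  exact h1

theorem sub_sw_self (D : Decomp Γ p m β) {i : β} {k : ℕ} {hk : k + 1 < n} {j : Fin d}
    (h : p (i.1 ⟨k, by omega⟩) = j) (h' : p (i.1 ⟨k + 1, hk⟩) = j) {r : ℕ}
    (hr : (D.word i).cnt j k = r) (hr' : r + 1 < m j) : (D.sub (D.sw i k hk) j).1 =
      (D.sub i j).1 ∘ Equiv.swap ⟨r, by omega⟩ ⟨r + 1, hr'⟩ := by
  have hcnt : (D.word i).cnt j (k + 1) = r + 1 := by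
    rw [Word.cnt_succ_self _ (ha := by omega) h, hr]
  symm
  -- Since the exchange is an involution, the identity may be solved for the subtuple of `i`, the
  -- form to which `sub_ext` applies.
  suffices (D.sub i j).1 =
      (D.sub (D.sw i k hk) j).1 ∘ Equiv.swap ⟨r, by omega⟩ ⟨r + 1, hr'⟩ by
    rw [this, Function.comp_assoc, ← Equiv.coe_trans, ← Equiv.Perm.mul_def, Equiv.swap_mul_self]
    rfl
  refine sub_ext fun a ha hja => ?_
  rw [Function.comp_apply]
  by_cases h1 : a = k
  · subst h1
    simp only [hr]
    rw [Equiv.swap_apply_left, sub_apply (a := a + 1) (ha := hk)]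
    · change (D.sw i a hk).1 _ = _; rw [sw_apply]; simp
    · rw [sw_apply]; simpa using h
    · rw [D.word_sw_eq (h.trans h'.symm)]; exact hcnt
  by_cases h2 : a = k + 1
  · subst h2
    simp only [hcnt]
    rw [Equiv.swap_apply_right, sub_apply (a := k) (ha := by omega)]
    · change (D.sw i k hk).1 _ = _; rw [sw_apply]; simp
    · rw [sw_apply]; simpa using h'
    · rw [D.word_sw_eq (h.trans h'.symm)]; exact hr
  · have h3 : (D.sw i k hk).1 ⟨a, ha⟩ = i.1 ⟨a, ha⟩ := by
      rw [sw_apply, if_neg h1, if_neg h2]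
    rw [Equiv.swap_apply_of_ne_of_ne, sub_apply (a := a) (ha := ha)]
    · exact h3
    · rw [h3]; exact hja
    · rw [D.word_sw_eq (h.trans h'.symm)]
    · intro h4
      rw [Fin.mk.injEq, ← hr] at h4
      exact h1 ((D.word i).cnt_inj (ha := ha) (hb := by omega) hja h h4)
    · intro h4
      rw [Fin.mk.injEq, ← hcnt] at h4
      exact h2 ((D.word i).cnt_inj (ha := ha) (hb := by omega) hja h' h4)

theorem sub_th_other (D : Decomp Γ p m β) {i : β} {h : 0 < n} {j : Fin d}
    (hj : p (i.1 ⟨0, h⟩) ≠ j) : D.sub (D.th i h) j = D.sub i j := by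
  refine Subtype.ext (sub_ext fun a ha hja => ?_).symm
  have h1 : (D.th i h).1 ⟨a, ha⟩ = i.1 ⟨a, ha⟩ := by
    rw [th_apply, if_neg]
    rintro rfl; exact hj hja
  rw [sub_apply (ha := ha) (by rw [h1]; exact hja) (by rw [D.word_th])]
  exact h1

theorem sub_th_self (D : Decomp Γ p m β) {i : β} {h : 0 < n} {j : Fin d}
    (hj : p (i.1 ⟨0, h⟩) = j) (h0 : 0 < m j) (hp : ∀ i, p (Γ.θ i) = p i) :
    (D.sub (D.th i h) j).1 = Function.update (D.sub i j).1 ⟨0, h0⟩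
      ((Γ.full (part p j) (part_stable hp j)).θ ((D.sub i j).1 ⟨0, h0⟩)) := by
  refine sub_ext fun a ha hja => ?_
  rw [th_apply] at hja ⊢
  by_cases h1 : a = 0
  · subst h1
    rw [if_pos rfl] at hja ⊢
    have : (D.word (D.th i h)).cnt j 0 = 0 := Word.cnt_zero _ _
    simp only [this, Function.update_self]
    rw [sub_apply (ha := h) hj (Word.cnt_zero _ _)]
    rfl
  · rw [if_neg h1] at hja ⊢
    rw [Function.update_of_ne, sub_apply (ha := ha) hja (by rw [D.word_th])]
    intro h2
    rw [Fin.mk.injEq, D.word_th] at h2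
    have := (D.word i).cnt_lt_cnt (ha := h) hj (Nat.pos_of_ne_zero h1)
    omega

/-- The sets of subtuples are stable under the generators of `B_{m j}`. -/
theorem stable_sub (D : Decomp Γ p m β) (hp : ∀ i, p (Γ.θ i) = p i) (j : Fin d) :
    Stable (subtuples p β j (m j)) (Γ.full (part p j) (part_stable hp j)) := by
  obtain ⟨i₀, hi₀⟩ := D.nonempty
  -- In a sorted word with `j` first, consecutive entries of the subtuple are adjacent in the tuple,
  -- and the first entry of the subtuple is the first entry of the tuple. So the generators of `B_{m
  -- j}` are induced by generators of `B_n`.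
  obtain ⟨u, hu⟩ := Word.exists_monotone (Word.first j) (D.word ⟨i₀, hi₀⟩)
  refine ⟨?_, ?_, ?_⟩
  · have := D.finite
    refine Finite.of_surjective (fun i => D.sub i j) fun x => ?_
    obtain ⟨i, -, hi⟩ := D.exists_sub_eq_single u x
    exact ⟨i, hi⟩
  · intro x hx r hr
    obtain ⟨i, hi, hix⟩ := D.exists_sub_eq_single u ⟨x, hx⟩
    obtain ⟨k, hk, h1, h2, h3⟩ := Word.adjacent_of_sorted hu hr
    rw [← hi] at h1 h2 h3
    have := D.sub_sw_self h1 h2 h3 hr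
    rw [hix] at this
    rw [← this]
    exact (D.sub _ j).2
  · intro x hx h0
    obtain ⟨i, hi, hix⟩ := D.exists_sub_eq_single u ⟨x, hx⟩
    obtain ⟨h, h1⟩ := Word.apply_of_sorted hu (Word.first_self j) h0
    rw [← hi] at h1
    have := D.sub_th_self h1 h0 hp
    rw [hix] at this
    rw [← this]
    exact (D.sub _ j).2

end Decomp

/-! ### The tensor product of the algebras of the parts -/

section Full

variable (hp : ∀ i, p (Γ.θ i) = p i) {j : Fin d}

theorem full_arrows (x y : part p j) :
    (Γ.full (part p j) (part_stable hp j)).arrows x y = Γ.arrows x y := by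
  unfold InvQuiver.arrows
  rw [← Set.ncard_image_of_injective _ Subtype.val_injective]
  congr 1
  ext a
  constructor
  · rintro ⟨b, ⟨h1, h2⟩, rfl⟩
    exact ⟨congrArg Subtype.val h1, congrArg Subtype.val h2⟩
  · rintro ⟨h1, h2⟩
    exact ⟨⟨a, h1 ▸ x.2, h2 ▸ y.2⟩, ⟨Subtype.ext h1, Subtype.ext h2⟩, rfl⟩

theorem full_dot (x y : part p j) :
    (Γ.full (part p j) (part_stable hp j)).dot x y = Γ.dot x y :=
  congrArg₂ (· + ·) (full_arrows hp x y) (full_arrows hp y x)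

theorem full_d₂ (x y : part p j) :
    (Γ.full (part p j) (part_stable hp j)).d₂ x y = Γ.d₂ x y := by
  by_cases h : x = y
  · subst h; exact (if_pos rfl).trans (if_pos rfl).symm
  · exact (if_neg h).trans
      ((congrArg _ (full_dot hp x y)).trans (if_neg fun h' => h (Subtype.ext h')).symm)

variable {R : Type*} [Ring R]

theorem full_Q (x y : part p j) (a b : R) :
    Q (Γ.full (part p j) (part_stable hp j)) x y a b = Q Γ x y a b := by
  by_cases h : x = y
  · subst h; exact (if_pos rfl).trans (if_pos rfl).symm
  · refine (if_neg h).trans (Eq.trans ?_ (if_neg fun h' => h (Subtype.ext h')).symm)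
    rw [full_arrows hp x y, full_dot hp x y]

theorem full_divQ (x y : part p j) (a b c : R) :
    divQ (Γ.full (part p j) (part_stable hp j)) x y a b c = divQ Γ x y a b c := by
  by_cases h : x = y
  · subst h; exact (if_pos rfl).trans (if_pos rfl).symm
  · refine (if_neg h).trans (Eq.trans ?_ (if_neg fun h' => h (Subtype.ext h')).symm)
    rw [full_arrows hp x y, full_dot hp x y]

theorem full_oddQ (x y : part p j) (a b : R) :
    oddQ (Γ.full (part p j) (part_stable hp j)) x y a b = oddQ Γ x y a b := by
  by_cases h : x = y
  · subst h; exact (if_pos rfl).trans (if_pos rfl).symm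
  · refine (if_neg h).trans (Eq.trans ?_ (if_neg fun h' => h (Subtype.ext h')).symm)
    rw [full_arrows hp x y, full_dot hp x y]

theorem full_oddQ₂ (x y : part p j) (a b : R) :
    oddQ₂ (Γ.full (part p j) (part_stable hp j)) x y a b = oddQ₂ Γ x y a b := by
  by_cases h : x = y
  · subst h; exact (if_pos rfl).trans (if_pos rfl).symm
  · refine (if_neg h).trans (Eq.trans ?_ (if_neg fun h' => h (Subtype.ext h')).symm)
    rw [full_arrows hp x y, full_dot hp x y]

end Full

theorem arrows_eq_zero (hA : ∀ a, p (Γ.o a) = p (Γ.t a)) {x y : I} (h : p x ≠ p y) :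
    Γ.arrows x y = 0 := by
  unfold InvQuiver.arrows
  rw [Set.ncard_eq_zero (Γ.finite_arrows x y)]
  ext a
  simp only [Set.mem_ofPred_eq, Set.mem_empty_iff_false, iff_false]
  rintro ⟨rfl, rfl⟩
  exact h (hA a)

theorem dot_eq_zero (hA : ∀ a, p (Γ.o a) = p (Γ.t a)) {x y : I} (h : p x ≠ p y) :
    Γ.dot x y = 0 := by
  rw [InvQuiver.dot, arrows_eq_zero hA h, arrows_eq_zero hA h.symm]

/-- Without arrows both exponents are `0`. This is what makes `ψ_k` invertible between different
parts and is the origin of the matrix units. -/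
theorem Q_eq_one (hA : ∀ a, p (Γ.o a) = p (Γ.t a)) {x y : I} (h : p x ≠ p y) {R : Type*} [Ring R]
    (a b : R) : Q Γ x y a b = 1 := by
  rw [Q, if_neg fun h' => h (congrArg p h'), arrows_eq_zero hA h, dot_eq_zero hA h]
  simp

/-- The sum is over an empty range. This and its two analogues below remove the corrections of the
braid relations when the two vertices lie in different parts. -/
theorem divQ_eq_zero (hA : ∀ a, p (Γ.o a) = p (Γ.t a)) {x y : I} (h : p x ≠ p y) {R : Type*}
    [Ring R] (a b c : R) : divQ Γ x y a b c = 0 := by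
  rw [divQ, if_neg fun h' => h (congrArg p h'), dot_eq_zero hA h]
  simp

theorem oddQ_eq_zero (hA : ∀ a, p (Γ.o a) = p (Γ.t a)) {x y : I} (h : p x ≠ p y) {R : Type*}
    [Ring R] (a b : R) : oddQ Γ x y a b = 0 := by
  rw [oddQ, if_neg fun h' => h (congrArg p h'), dot_eq_zero hA h]
  simp

theorem oddQ₂_eq_zero (hA : ∀ a, p (Γ.o a) = p (Γ.t a)) {x y : I} (h : p x ≠ p y) {R : Type*}
    [Ring R] (a b : R) : oddQ₂ Γ x y a b = 0 := by
  rw [oddQ₂, if_neg fun h' => h (congrArg p h'), dot_eq_zero hA h]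
  simp

/-- The algebra `V_{β^(j)}(Γ^(j), λ^(j), γ^(j))`. -/
abbrev VP (Γ : InvQuiver I A) (lam : I → ℕ) (γ : I → K) (hp : ∀ i, p (Γ.θ i) = p i)
    (β : Set (Fin n → I)) (m : Fin d → ℕ) (j : Fin d) : Type (max u w) :=
  V (Γ.full (part p j) (part_stable hp j)) (fun i => lam i) (fun i => γ i) (subtuples p β j (m j))

/-- Transfer of the relations between two representations of the same elements. -/
theorem RepAt.transfer {C B B' : Type*} [Ring C] [Ring B] [Ring B'] [Algebra K C] [Algebra K B]
    [Algebra K B'] {lam : I → ℕ} {γ : I → K} {Y P : ℕ → C} {E : β → C} {i : β} {z : B} {z' : B'}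
    (f : C →ₐ[K] B) (g : C →ₐ[K] B') (tr : ∀ a b, f a * z = f b * z → g a * z' = g b * z')
    (h : RepAt Γ lam γ (fun a => f (Y a)) (fun b => f (P b)) (fun x => f (E x)) i z) :
    RepAt Γ lam γ (fun a => g (Y a)) (fun b => g (P b)) (fun x => g (E x)) i z' := by
  classical
  constructor
  -- Each relation is rewritten as an equation `f a * z = f b * z` with explicit `a`, `b` in the
  -- source algebra, which `tr` carries over to `z'`.
  case' e_same =>
    have hf := h.e_same
    have hg := tr (E i) 1
  case' e_ne =>
    intro x hx
    have hf := h.e_ne x hx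
    have hg := tr (E x) 0
  case' y_y =>
    intro a b ha hb
    have hf := h.y_y a b ha hb
    have hg := tr (Y a * Y b) (Y b * Y a)
  case' e_y_same =>
    intro a ha
    have hf := h.e_y_same a ha
    have hg := tr (E i * Y a) (Y a)
  case' e_y_ne =>
    intro a ha x hx
    have hf := h.e_y_ne a ha x hx
    have hg := tr (E x * Y a) 0
  case' e_psi_same =>
    intro k hk x hx
    have hf := h.e_psi_same k hk x hx
    have hg := tr (E x * P (k + 1)) (P (k + 1))
  case' e_psi_ne =>
    intro k hk x hx
    have hf := h.e_psi_ne k hk x hx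
    have hg := tr (E x * P (k + 1)) 0
  case' psi_y_left =>
    intro k hk
    have hf := h.psi_y_left k hk
    have hg := tr (P (k + 1) * Y k) (Y (k + 1) * P (k + 1) +
      if i.1 ⟨k, by omega⟩ = i.1 ⟨k + 1, hk⟩ then -1 else 0)
  case' psi_y_right =>
    intro k hk
    have hf := h.psi_y_right k hk
    have hg := tr (P (k + 1) * Y (k + 1)) (Y k * P (k + 1) +
      if i.1 ⟨k, by omega⟩ = i.1 ⟨k + 1, hk⟩ then 1 else 0)
  case' psi_y_far =>
    intro k a hk ha h1 h2
    have hf := h.psi_y_far k a hk ha h1 h2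
    have hg := tr (P (k + 1) * Y a) (Y a * P (k + 1))
  case' psi_psi =>
    intro k l hl hkl
    have hf := h.psi_psi k l hl hkl
    have hg := tr (P (k + 1) * P (l + 1)) (P (l + 1) * P (k + 1))
  case' psi_sq =>
    intro k hk
    have hf := h.psi_sq k hk
    have hg := tr (P (k + 1) * P (k + 1))
      (Q Γ (i.1 ⟨k, by omega⟩) (i.1 ⟨k + 1, hk⟩) (Y k) (Y (k + 1)))
  case' braid_eq =>
    intro k hk hi
    have hf := h.braid_eq k hk hi
    have hg := tr (P (k + 2) * P (k + 1) * P (k + 2)) (P (k + 1) * P (k + 2) * P (k + 1) +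
      divQ Γ (i.1 ⟨k, by omega⟩) (i.1 ⟨k + 1, by omega⟩) (Y k) (Y (k + 1)) (Y (k + 2)))
  case' braid_ne =>
    intro k hk hi
    have hf := h.braid_ne k hk hi
    have hg := tr (P (k + 2) * P (k + 1) * P (k + 2)) (P (k + 1) * P (k + 2) * P (k + 1))
  case' e_psi0_same =>
    intro h0 x hx
    have hf := h.e_psi0_same h0 x hx
    have hg := tr (E x * P 0) (P 0)
  case' e_psi0_ne =>
    intro h0 x hx
    have hf := h.e_psi0_ne h0 x hx
    have hg := tr (E x * P 0) 0
  case' psi0_psi =>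
    intro k hk
    have hf := h.psi0_psi k hk
    have hg := tr (P 0 * P (k + 2)) (P (k + 2) * P 0)
  case' psi0_y0 =>
    intro h0
    have hf := h.psi0_y0 h0
    have hg := tr (P 0 * Y 0) ((2 * γ (i.1 ⟨0, h0⟩)) • 1 - Y 0 * P 0)
  case' psi0_y =>
    intro a ha
    have hf := h.psi0_y a ha
    have hg := tr (P 0 * Y (a + 1)) (Y (a + 1) * P 0)
  case' psi0_sq_eq =>
    intro h0 hi
    have hf := h.psi0_sq_eq h0 hi
    have hg := tr (P 0 * P 0) ((-1) ^ lam (Γ.θ (i.1 ⟨0, h0⟩)) *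
      Y 0 ^ (lam (i.1 ⟨0, h0⟩) + lam (Γ.θ (i.1 ⟨0, h0⟩))))
  case' psi0_sq_ne =>
    intro h0 hi
    have hf := h.psi0_sq_ne h0 hi
    have hg := tr (P 0 * P 0) 0
  case' braid4_opp =>
    intro h0 h1 h2
    have hf := h.braid4_opp h0 h1 h2
    have hg := tr (P 0 * P 1 * P 0 * P 1) (P 1 * P 0 * P 1 * P 0 +
      (-1) ^ lam (Γ.θ (i.1 ⟨0, by omega⟩)) *
        divPow (lam (i.1 ⟨0, by omega⟩) + lam (Γ.θ (i.1 ⟨0, by omega⟩))) (Y 0) (Y 1) * P 1)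
  case' braid4_zero =>
    intro h0 h1 h2
    have hf := h.braid4_zero h0 h1 h2
    have hg := tr (P 0 * P 1 * P 0 * P 1) (P 1 * P 0 * P 1 * P 0 +
      γ (i.1 ⟨1, h0⟩) • (oddQ Γ (i.1 ⟨1, h0⟩) (i.1 ⟨0, by omega⟩) (Y 0) (Y 1) * P 0))
  case' braid4_ne =>
    intro h0 h1
    have hf := h.braid4_ne h0 h1
    have hg := tr (P 0 * P 1 * P 0 * P 1) (P 1 * P 0 * P 1 * P 0 +
      γ (i.1 ⟨1, h0⟩) • (oddQ₂ Γ (i.1 ⟨1, h0⟩) (i.1 ⟨0, by omega⟩) (Y 0) (Y 1) *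
        (Y 0 * P 0 - γ (i.1 ⟨0, by omega⟩) • 1)))
  all_goals simp only [map_mul, map_add, map_sub, map_neg, map_zero, map_one, map_pow, map_smul,
    map_Q, map_divQ, map_oddQ, map_oddQ₂, map_divPow, zero_mul, one_mul, add_mul, sub_mul,
    neg_mul, smul_mul_assoc, mul_assoc, apply_ite f, apply_ite g, ite_mul] at hf hg ⊢
  all_goals exact hg hf

theorem RepAt.map {B B' : Type*} [Ring B] [Ring B'] [Algebra K B] [Algebra K B']
    {lam : I → ℕ} {γ : I → K} {Y P : ℕ → B} {E : β → B} {i : β} {z : B}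
    (h : RepAt Γ lam γ Y P E i z) (f : B →ₐ[K] B') {z' : B'} (hz : f z * z' = z') :
    RepAt Γ lam γ (fun a => f (Y a)) (fun b => f (P b)) (fun x => f (E x)) i z' :=
  RepAt.transfer (AlgHom.id K B) f (fun a b hab => by
    rw [AlgHom.id_apply, AlgHom.id_apply] at hab
    rw [← hz, ← mul_assoc, ← map_mul, hab, map_mul, mul_assoc]) h

end Decomp

/-! ### The tensor product of the algebras of the parts -/

section Tensor

variable {I : Type u} {A : Type v} {K : Type w} [CommRing K] {d n : ℕ}
  {Γ : InvQuiver I A} {p : I → Fin d} {m : Fin d → ℕ} {β : Set (Fin n → I)}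

namespace Decomp

/-- The tensor product of the algebras of the parts. -/
abbrev T (D : Decomp Γ p m β) (lam : I → ℕ) (γ : I → K) : Type (max u w) :=
  ⨂[K] j, VP Γ lam γ D.θ_part β m j

variable (D : Decomp Γ p m β) (lam : I → ℕ) (γ : I → K)

/-- The inclusion of a factor of the tensor product. -/
noncomputable abbrev inj (j : Fin d) : VP Γ lam γ D.θ_part β m j →ₐ[K] D.T lam γ :=
  PiTensorProduct.singleAlgHom j

/-- The idempotent of the tensor product that is attached to the subtuples of a tuple. -/
noncomputable def eT (i : β) : D.T lam γ := PiTensorProduct.tprod K fun j => V.e (D.sub i j)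

variable {D lam γ}

theorem inj_mul_tprod (j : Fin d) (g : VP Γ lam γ D.θ_part β m j)
    (b : ∀ j, VP Γ lam γ D.θ_part β m j) : D.inj lam γ j g * PiTensorProduct.tprod K b =
      PiTensorProduct.tprod K (Function.update b j (g * b j)) := by
  refine (PiTensorProduct.tprod_mul_tprod _ _).trans (congrArg _ (funext fun l => ?_))
  by_cases h : l = j
  · subst h; simp
  · simp [h]

theorem inj_comm {j l : Fin d} (h : j ≠ l) (g : VP Γ lam γ D.θ_part β m j)
    (g' : VP Γ lam γ D.θ_part β m l) (x : D.T lam γ) :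
    D.inj lam γ j g * (D.inj lam γ l g' * x) = D.inj lam γ l g' * (D.inj lam γ j g * x) := by
  rw [← mul_assoc, ← mul_assoc]
  congr 1
  exact (Pi.mulSingle_commute h g g').tprod

theorem inj_e_mul_eT (j : Fin d) (i : β) :
    D.inj lam γ j (V.e (D.sub i j)) * D.eT lam γ i = D.eT lam γ i := by
  rw [eT, inj_mul_tprod]
  congr 1
  exact Function.update_eq_self_iff.mpr (V.e_mul_self _)

theorem eT_mul_tprod {i : β} {b : ∀ j, VP Γ lam γ D.θ_part β m j}
    (h : ∀ j, V.e (D.sub i j) * b j = b j) :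
    D.eT lam γ i * PiTensorProduct.tprod K b = PiTensorProduct.tprod K b :=
  (PiTensorProduct.tprod_mul_tprod _ _).trans (congrArg _ (funext h))

theorem eT_mul_self (i : β) : D.eT lam γ i * D.eT lam γ i = D.eT lam γ i :=
  eT_mul_tprod fun _ => V.e_mul_self _

/-- Some subtuple differs, and that tensor factor of the product vanishes. The words must agree:
tuples with different words and the same subtuples give the same idempotent. -/
theorem eT_mul_ne {i i' : β} (hw : D.word i = D.word i') (h : i ≠ i') :
    D.eT lam γ i * D.eT lam γ i' = 0 := by
  obtain ⟨j, hj⟩ : ∃ j, D.sub i j ≠ D.sub i' j := by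
    by_contra! h'
    exact h (eq_of_sub hw h')
  refine (PiTensorProduct.tprod_mul_tprod _ _).trans ?_
  exact MultilinearMap.map_coord_zero _ j (V.e_mul_ne hj)

theorem eT_eq {i i' : β} (h : ∀ j, D.sub i j = D.sub i' j) : D.eT lam γ i = D.eT lam γ i' := by
  simp only [eT, h]

theorem eT_y {i : β} (j : Fin d) (r : ℕ) :
    D.eT lam γ i * (D.inj lam γ j (V.y r) * D.eT lam γ i) =
      D.inj lam γ j (V.y r) * D.eT lam γ i := by
  rw [eT, inj_mul_tprod]
  refine eT_mul_tprod fun l => ?_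
  by_cases h : l = j
  · subst h
    simp only [Function.update_self]
    exact V.e_y _ (V.e_mul_self _)
  · simp only [Function.update_of_ne h]
    exact V.e_mul_self _

theorem eT_psi {i : β} {k : ℕ} {hk : k + 1 < n} {j : Fin d}
    (h : p (i.1 ⟨k, by omega⟩) = j) (h' : p (i.1 ⟨k + 1, hk⟩) = j) {r : ℕ}
    (hr : (D.word i).cnt j k = r) :
    D.eT lam γ (D.sw i k hk) * (D.inj lam γ j (V.psi (r + 1)) * D.eT lam γ i) =
      D.inj lam γ j (V.psi (r + 1)) * D.eT lam γ i := by
  have hr' : r + 1 < m j := by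
    have := (D.word i).cnt_lt (ha := hk) h'
    rwa [Word.cnt_succ_self _ (ha := by omega) h, hr] at this
  rw [eT, eT, inj_mul_tprod]
  refine eT_mul_tprod fun l => ?_
  by_cases hl : l = j
  · subst hl
    simp only [Function.update_self]
    rw [← mul_assoc, ← V.psi_mul_e hr' (D.sub_sw_self h h' hr hr'), mul_assoc, V.e_mul_self]
  · simp only [Function.update_of_ne hl]
    rw [D.sub_sw_other (h.trans h'.symm) fun h2 => hl (h2.symm.trans h)]
    exact V.e_mul_self _

theorem eT_psi0 {i : β} {h : 0 < n} {j : Fin d} (hj : p (i.1 ⟨0, h⟩) = j) :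
    D.eT lam γ (D.th i h) * (D.inj lam γ j (V.psi 0) * D.eT lam γ i) =
      D.inj lam γ j (V.psi 0) * D.eT lam γ i := by
  have h0 : 0 < m j := by
    have := (D.word i).cnt_lt (ha := h) hj
    rwa [Word.cnt_zero] at this
  rw [eT, eT, inj_mul_tprod]
  refine eT_mul_tprod fun l => ?_
  by_cases hl : l = j
  · subst hl
    simp only [Function.update_self]
    rw [← mul_assoc, ← V.psi0_mul_e h0 (D.sub_th_self hj h0 D.θ_part), mul_assoc, V.e_mul_self]
  · simp only [Function.update_of_ne hl]
    rw [D.sub_th_other fun h2 => hl (h2.symm.trans hj)]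
    exact V.e_mul_self _

/-- The factor `e(i^(j))` of `eT i` absorbs the idempotent of the part, so relations of the part `j`
may be applied directly to `eT i`. -/
theorem rep_inj (D : Decomp Γ p m β) (lam : I → ℕ) (γ : I → K) (j : Fin d) (i : β) :
    RepAt (Γ.full (part p j) (part_stable D.θ_part j)) (fun x => lam x) (fun x => γ x)
      (fun r => D.inj lam γ j (V.y r)) (fun r => D.inj lam γ j (V.psi r))
      (fun x => D.inj lam γ j (V.e x)) (D.sub i j) (D.eT lam γ i) :=
  ((D.stable_sub D.θ_part j).rep (D.sub i j)).map (D.inj lam γ j) (inj_e_mul_eT j i)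

/-- Expanding the tensor product of the identities `1 = ∑ e(x)` gives one term for each family of
subtuples, hence one for each tuple with word `u`. -/
theorem sum_eT [Fintype β] (u : Word n m) :
    ∑ i : β, (if D.word i = u then D.eT lam γ i else 0) = 1 := by
  classical
  have hfin : ∀ j, Finite (subtuples p β j (m j)) := fun j => (D.stable_sub D.θ_part j).finite
  have := fun j => Fintype.ofFinite (subtuples p β j (m j))
  have h1 : (1 : D.T lam γ) = PiTensorProduct.tprod K fun j =>
      ∑ x : subtuples p β j (m j), (V.e x : VP Γ lam γ D.θ_part β m j) := by
    rw [PiTensorProduct.one_def]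
    congr 1
    funext j
    exact V.sum_e.symm
  rw [h1, MultilinearMap.map_sum, ← Finset.sum_filter]
  refine Finset.sum_bij (fun i _ j => D.sub i j) (fun _ _ => Finset.mem_univ _) ?_ ?_
    fun _ _ => rfl
  · intro i hi i' hi' h
    simp only [Finset.mem_filter, Finset.mem_univ, true_and] at hi hi'
    exact eq_of_sub (hi.trans hi'.symm) (congrFun h)
  · intro x _
    obtain ⟨i, hi, h⟩ := D.exists_sub_eq u x
    exact ⟨i, by simpa using hi, funext h⟩

end Decomp

/-! ### Monomial matrices -/

section Mon

variable {W : Type*} [Fintype W] [DecidableEq W] {R : Type*} [Ring R]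

/-- The matrix with entry `b w` in position `(σ w, w)` and zeros elsewhere. -/
def mon (σ : W → W) (b : W → R) : Matrix W W R := fun u w => if u = σ w then b w else 0

theorem mon_mul_single (σ : W → W) (b : W → R) (w v : W) (x : R) :
    mon σ b * Matrix.single w v x = Matrix.single (σ w) v (b w * x) := by
  ext s t
  by_cases ht : t = v
  · subst ht
    rw [Matrix.mul_single_apply_same, mon, Matrix.single_apply]
    by_cases hs : s = σ w
    · simp [hs]
    · simp [hs, Ne.symm hs]
  · rw [Matrix.mul_single_apply_of_ne _ _ _ _ _ ht, Matrix.single_apply,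
      if_neg fun h => ht h.2.symm]

end Mon

end Tensor

/-! ### Matrices for the generators, and their relations -/

section ToMatrix

variable {I : Type u} {A : Type v} {K : Type w} [CommRing K] {d n : ℕ}
  {Γ : InvQuiver I A} {p : I → Fin d} {m : Fin d → ℕ} {β : Set (Fin n → I)}

namespace Decomp

variable (D : Decomp Γ p m β) (lam : I → ℕ) (γ : I → K)

/-- The diagonal entries of the image of `y_{a+1}`. -/
noncomputable def entryY (a : ℕ) (w : Word n m) : D.T lam γ :=
  if h : a < n then D.inj lam γ (w.1 ⟨a, h⟩) (V.y (w.cnt (w.1 ⟨a, h⟩) a)) else 0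

/-- The image of `y_{a+1}`. -/
noncomputable def matY (a : ℕ) : Matrix (Word n m) (Word n m) (D.T lam γ) :=
  Matrix.diagonalAlgHom K (D.entryY lam γ a)

/-- The image of `ψ_b`. -/
noncomputable def matPsi : ℕ → Matrix (Word n m) (Word n m) (D.T lam γ)
  | 0 => mon id fun w =>
      if h : 0 < n then D.inj lam γ (w.1 ⟨0, h⟩) (V.psi 0) else 0
  | k + 1 => mon (fun w => if hk : k + 1 < n then w.sw k hk else w) fun w =>
      if hk : k + 1 < n then
        if w.1 ⟨k, by omega⟩ = w.1 ⟨k + 1, hk⟩ then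
          D.inj lam γ (w.1 ⟨k, by omega⟩) (V.psi (w.cnt (w.1 ⟨k, by omega⟩) k + 1))
        else 1
      else 0

/-- The image of `e(i)`. -/
noncomputable def matE (i : β) : Matrix (Word n m) (Word n m) (D.T lam γ) :=
  Matrix.single (D.word i) (D.word i) (D.eT lam γ i)

variable {D lam γ}

theorem sub_eq_iff {i : β} {j : Fin d} {a b : ℕ} {ha : a < n} {hb : b < n}
    (h : p (i.1 ⟨a, ha⟩) = j) (h' : p (i.1 ⟨b, hb⟩) = j) {r s : ℕ}
    {hr : r < m j} {hs : s < m j} (e : (D.word i).cnt j a = r) (e' : (D.word i).cnt j b = s) :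
    (D.sub i j).1 ⟨r, hr⟩ = (D.sub i j).1 ⟨s, hs⟩ ↔ i.1 ⟨a, ha⟩ = i.1 ⟨b, hb⟩ := by
  rw [sub_apply h e, sub_apply h' e']
  exact Subtype.ext_iff

theorem entryY_eq {w : Word n m} {a : ℕ} {ha : a < n} {j : Fin d} {r : ℕ} (h : w.1 ⟨a, ha⟩ = j)
    (hr : w.cnt j a = r) : D.entryY lam γ a w = D.inj lam γ j (V.y r) := by
  subst h hr
  rw [entryY, dif_pos ha]

theorem diag_mul_single (f : Word n m → D.T lam γ) (w v : Word n m) (x : D.T lam γ) :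
    Matrix.diagonalAlgHom K f * Matrix.single w v x = Matrix.single w v (f w * x) := by
  ext s t
  rw [Matrix.diagonalAlgHom_apply, Matrix.diagonal_mul, Matrix.single_apply, Matrix.single_apply]
  by_cases hs : w = s
  · subst hs; simp
  · simp [hs]

theorem matY_mul {w v : Word n m} {a : ℕ} {ha : a < n} {j : Fin d} {r : ℕ} {x : D.T lam γ}
    (h : w.1 ⟨a, ha⟩ = j) (hr : w.cnt j a = r) : D.matY lam γ a * Matrix.single w v x =
      Matrix.single w v (D.inj lam γ j (V.y r) * x) := by
  rw [matY, diag_mul_single, entryY_eq h hr]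

theorem matPsi_mul_same {w v : Word n m} {k : ℕ} {hk : k + 1 < n} {j : Fin d} {r : ℕ}
    {x : D.T lam γ} (h : w.1 ⟨k, by omega⟩ = j) (h' : w.1 ⟨k + 1, hk⟩ = j)
    (hr : w.cnt j k = r) : D.matPsi lam γ (k + 1) * Matrix.single w v x =
      Matrix.single w v (D.inj lam γ j (V.psi (r + 1)) * x) := by
  subst h hr
  rw [matPsi, mon_mul_single, dif_pos hk, dif_pos hk, if_pos h'.symm, Word.sw_eq_self h'.symm]

theorem matPsi_mul_ne {w v : Word n m} {k : ℕ} {hk : k + 1 < n} {x : D.T lam γ}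
    (h : w.1 ⟨k, by omega⟩ ≠ w.1 ⟨k + 1, hk⟩) : D.matPsi lam γ (k + 1) * Matrix.single w v x =
      Matrix.single (w.sw k hk) v x := by
  rw [matPsi, mon_mul_single, dif_pos hk, dif_pos hk, if_neg h, one_mul]

theorem matPsi_zero_mul {w v : Word n m} {h : 0 < n} {j : Fin d} {x : D.T lam γ}
    (hj : w.1 ⟨0, h⟩ = j) : D.matPsi lam γ 0 * Matrix.single w v x =
      Matrix.single w v (D.inj lam γ j (V.psi 0) * x) := by
  subst hj
  rw [matPsi, mon_mul_single, dif_pos h]; rfl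

theorem matE_mul {i : β} {w v : Word n m} {x : D.T lam γ} (hw : D.word i = w)
    (hx : D.eT lam γ i * x = x) : D.matE lam γ i * Matrix.single w v x = Matrix.single w v x := by
  subst hw
  rw [matE, Matrix.single_mul_single_same, hx]

theorem matE_mul_ne {i i' : β} {w v : Word n m} {x : D.T lam γ} (hw : D.word i = w)
    (hx : D.eT lam γ i * x = x) (h : i' ≠ i) : D.matE lam γ i' * Matrix.single w v x = 0 := by
  subst hw
  rw [matE]
  by_cases hw : D.word i' = D.word i
  · rw [hw, Matrix.single_mul_single_same, ← hx, ← mul_assoc, eT_mul_ne hw h, zero_mul,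
      Matrix.single_zero]
  · rw [Matrix.single_mul_single_of_ne _ _ _ _ hw]

theorem exists_matPsi_mul (i : β) (v : Word n m) (k : ℕ) (hk : k + 1 < n) :
    ∃ x, D.matPsi lam γ (k + 1) * Matrix.single (D.word i) v (D.eT lam γ i) =
      Matrix.single (D.word (D.sw i k hk)) v x ∧ D.eT lam γ (D.sw i k hk) * x = x := by
  by_cases h : p (i.1 ⟨k, by omega⟩) = p (i.1 ⟨k + 1, hk⟩)
  · rw [matPsi_mul_same (hk := hk) (j := p (i.1 ⟨k, by omega⟩)) rfl h.symm rfl, D.word_sw_eq h]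
    exact ⟨_, rfl, eT_psi rfl h.symm rfl⟩
  · rw [matPsi_mul_ne (hk := hk) h]
    refine ⟨_, rfl, ?_⟩
    rw [eT_eq (D.sub_sw_ne h), eT_mul_self]

/-- An exchange of different letters moves the letter at `a` but preserves its rank, so the same
element of the same tensor factor acts before and after. -/
theorem matY_swap_mul {w v : Word n m} {k : ℕ} {hk : k + 1 < n} {x : D.T lam γ}
    (h : w.1 ⟨k, by omega⟩ ≠ w.1 ⟨k + 1, hk⟩) {a : ℕ} (ha : a < n) :
    D.matY lam γ (Equiv.swap k (k + 1) a) * Matrix.single (w.sw k hk) v x =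
      Matrix.single (w.sw k hk) v (D.entryY lam γ a w * x) := by
  rw [entryY_eq (ha := ha) rfl rfl, matY_mul (ha := Word.lt_of_swap hk ha) (w.sw_apply_swap hk ha)
    (w.cnt_sw_swap (ha := ha) h rfl)]

/-- Diagonal matrices are the image of a product algebra, so polynomials in them are evaluated entry
by entry. -/
theorem matY_Q (x y : I) (a b : ℕ) (w v : Word n m) (z : D.T lam γ) :
    Q Γ x y (D.matY lam γ a) (D.matY lam γ b) * Matrix.single w v z =
      Matrix.single w v (Q Γ x y (D.entryY lam γ a w) (D.entryY lam γ b w) * z) := by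
  rw [matY, matY, ← map_Q, diag_mul_single]
  congr 2
  exact map_Q Γ (Pi.evalAlgHom K (fun _ => D.T lam γ) w) _ _ _ _

theorem matY_divQ (x y : I) (a b c : ℕ) (w v : Word n m) (z : D.T lam γ) :
    divQ Γ x y (D.matY lam γ a) (D.matY lam γ b) (D.matY lam γ c) * Matrix.single w v z =
      Matrix.single w v
        (divQ Γ x y (D.entryY lam γ a w) (D.entryY lam γ b w) (D.entryY lam γ c w) * z) := by
  rw [matY, matY, matY, ← map_divQ, diag_mul_single]
  congr 2
  exact map_divQ Γ (Pi.evalAlgHom K (fun _ => D.T lam γ) w) _ _ _ _ _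

theorem matY_oddQ (x y : I) (a b : ℕ) (w v : Word n m) (z : D.T lam γ) :
    oddQ Γ x y (D.matY lam γ a) (D.matY lam γ b) * Matrix.single w v z =
      Matrix.single w v (oddQ Γ x y (D.entryY lam γ a w) (D.entryY lam γ b w) * z) := by
  rw [matY, matY, ← map_oddQ, diag_mul_single]
  congr 2
  exact map_oddQ Γ (Pi.evalAlgHom K (fun _ => D.T lam γ) w) _ _ _ _

theorem matY_oddQ₂ (x y : I) (a b : ℕ) (w v : Word n m) (z : D.T lam γ) :
    oddQ₂ Γ x y (D.matY lam γ a) (D.matY lam γ b) * Matrix.single w v z =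
      Matrix.single w v (oddQ₂ Γ x y (D.entryY lam γ a w) (D.entryY lam γ b w) * z) := by
  rw [matY, matY, ← map_oddQ₂, diag_mul_single]
  congr 2
  exact map_oddQ₂ Γ (Pi.evalAlgHom K (fun _ => D.T lam γ) w) _ _ _ _

theorem matY_pow (l c a : ℕ) (w v : Word n m) (z : D.T lam γ) :
    (-1) ^ l * D.matY lam γ a ^ c * Matrix.single w v z =
      Matrix.single w v ((-1) ^ l * D.entryY lam γ a w ^ c * z) := by
  rw [matY, ← map_pow, ← map_one (Matrix.diagonalAlgHom K (n := Word n m) (α := D.T lam γ)),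
    ← map_neg, ← map_pow, ← map_mul, diag_mul_single]
  rfl

theorem matY_divPow (l c a b : ℕ) (w v : Word n m) (z : D.T lam γ) :
    (-1) ^ l * divPow c (D.matY lam γ a) (D.matY lam γ b) * Matrix.single w v z =
      Matrix.single w v
        ((-1) ^ l * divPow c (D.entryY lam γ a w) (D.entryY lam γ b w) * z) := by
  rw [matY, matY, ← map_divPow (K := K),
    ← map_one (Matrix.diagonalAlgHom K (n := Word n m) (α := D.T lam γ)),
    ← map_neg, ← map_pow, ← map_mul, diag_mul_single]
  congr 2
  rw [Pi.mul_apply]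
  congr 1
  exact map_divPow (Pi.evalAlgHom K (fun _ => D.T lam γ) w) _ _ _

/-- The pattern of the checks that follow: entries in one part are consecutive entries of a
subtuple, and the relation is that of the tensor factor; entries in different parts are only
exchanged by `ψ`, and what remains is bookkeeping of words and ranks. -/
theorem matPsi_matY_left (i : β) (v : Word n m) (k : ℕ) (hk : k + 1 < n) :
    D.matPsi lam γ (k + 1) * (D.matY lam γ k * Matrix.single (D.word i) v (D.eT lam γ i)) =
      D.matY lam γ (k + 1) * (D.matPsi lam γ (k + 1) *
        Matrix.single (D.word i) v (D.eT lam γ i)) +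
      (open Classical in if i.1 ⟨k, by omega⟩ = i.1 ⟨k + 1, hk⟩ then
        -Matrix.single (D.word i) v (D.eT lam γ i) else 0) := by
  by_cases h : p (i.1 ⟨k, by omega⟩) = p (i.1 ⟨k + 1, hk⟩)
  · obtain ⟨j, hj⟩ : ∃ j, p (i.1 ⟨k, by omega⟩) = j := ⟨_, rfl⟩
    obtain ⟨r, hr⟩ : ∃ r, (D.word i).cnt j k = r := ⟨_, rfl⟩
    have hj' := h.symm.trans hj
    have hr' : (D.word i).cnt j (k + 1) = r + 1 := by
      rw [Word.cnt_succ_self _ (ha := by omega) hj, hr]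
    have hm : r + 1 < m j := by rw [← hr']; exact (D.word i).cnt_lt hj'
    rw [matY_mul (ha := by omega) hj hr, matPsi_mul_same (hk := hk) hj hj' hr,
      matPsi_mul_same (hk := hk) hj hj' hr, matY_mul (ha := hk) hj' hr',
      (D.rep_inj lam γ j i).psi_y_left r hm]
    have hi := sub_eq_iff (D := D) hj hj' hr hr' (hr := by omega) (hs := hm)
    split_ifs with e1 e2 e2
    · simp [Matrix.single_add, Matrix.single_neg]
    · exact absurd (hi.mp e1) e2
    · exact absurd (hi.mpr e2) e1
    · simp
  · have h1 := matY_swap_mul (D := D) (lam := lam) (γ := γ) (v := v) (x := D.eT lam γ i)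
      (w := D.word i) h (a := k) (by omega)
    rw [Equiv.swap_apply_left] at h1
    rw [if_neg fun h' => h (congrArg p h'), add_zero, matPsi_mul_ne (hk := hk) h, h1, matY,
      diag_mul_single, matPsi_mul_ne (hk := hk) h]

theorem matPsi_matY_right (i : β) (v : Word n m) (k : ℕ) (hk : k + 1 < n) :
    D.matPsi lam γ (k + 1) * (D.matY lam γ (k + 1) *
        Matrix.single (D.word i) v (D.eT lam γ i)) =
      D.matY lam γ k * (D.matPsi lam γ (k + 1) *
        Matrix.single (D.word i) v (D.eT lam γ i)) +
      (open Classical in if i.1 ⟨k, by omega⟩ = i.1 ⟨k + 1, hk⟩ then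
        Matrix.single (D.word i) v (D.eT lam γ i) else 0) := by
  by_cases h : p (i.1 ⟨k, by omega⟩) = p (i.1 ⟨k + 1, hk⟩)
  · obtain ⟨j, hj⟩ : ∃ j, p (i.1 ⟨k, by omega⟩) = j := ⟨_, rfl⟩
    obtain ⟨r, hr⟩ : ∃ r, (D.word i).cnt j k = r := ⟨_, rfl⟩
    have hj' := h.symm.trans hj
    have hr' : (D.word i).cnt j (k + 1) = r + 1 := by
      rw [Word.cnt_succ_self _ (ha := by omega) hj, hr]
    have hm : r + 1 < m j := by rw [← hr']; exact (D.word i).cnt_lt hj'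
    rw [matY_mul (ha := hk) hj' hr', matPsi_mul_same (hk := hk) hj hj' hr,
      matPsi_mul_same (hk := hk) hj hj' hr, matY_mul (ha := by omega) hj hr,
      (D.rep_inj lam γ j i).psi_y_right r hm]
    have hi := sub_eq_iff (D := D) hj hj' hr hr' (hr := by omega) (hs := hm)
    split_ifs with e1 e2 e2
    · simp [Matrix.single_add]
    · exact absurd (hi.mp e1) e2
    · exact absurd (hi.mpr e2) e1
    · simp
  · have h1 := matY_swap_mul (D := D) (lam := lam) (γ := γ) (v := v) (x := D.eT lam γ i)
      (w := D.word i) h (a := k + 1) hk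
    rw [Equiv.swap_apply_right] at h1
    rw [if_neg fun h' => h (congrArg p h'), add_zero, matPsi_mul_ne (hk := hk) h, h1, matY,
      diag_mul_single, matPsi_mul_ne (hk := hk) h]

theorem matPsi_matY_far (i : β) (v : Word n m) (k a : ℕ) (hk : k + 1 < n) (ha : a < n)
    (h1 : a ≠ k) (h2 : a ≠ k + 1) :
    D.matPsi lam γ (k + 1) * (D.matY lam γ a * Matrix.single (D.word i) v (D.eT lam γ i)) =
      D.matY lam γ a * (D.matPsi lam γ (k + 1) *
        Matrix.single (D.word i) v (D.eT lam γ i)) := by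
  by_cases h : p (i.1 ⟨k, by omega⟩) = p (i.1 ⟨k + 1, hk⟩)
  · obtain ⟨j, hj⟩ : ∃ j, p (i.1 ⟨k, by omega⟩) = j := ⟨_, rfl⟩
    obtain ⟨r, hr⟩ : ∃ r, (D.word i).cnt j k = r := ⟨_, rfl⟩
    have hj' := h.symm.trans hj
    have hr' : (D.word i).cnt j (k + 1) = r + 1 := by
      rw [Word.cnt_succ_self _ (ha := by omega) hj, hr]
    have hm : r + 1 < m j := by rw [← hr']; exact (D.word i).cnt_lt hj'
    obtain ⟨l, hl⟩ : ∃ l, p (i.1 ⟨a, ha⟩) = l := ⟨_, rfl⟩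
    obtain ⟨s, hs⟩ : ∃ s, (D.word i).cnt l a = s := ⟨_, rfl⟩
    rw [matY_mul (ha := ha) hl hs, matPsi_mul_same (hk := hk) hj hj' hr,
      matPsi_mul_same (hk := hk) hj hj' hr, matY_mul (ha := ha) hl hs]
    by_cases hjl : j = l
    · subst hjl
      rw [(D.rep_inj lam γ j i).psi_y_far r s hm]
      · rw [← hs]; exact (D.word i).cnt_lt hl
      · rw [← hs, ← hr]; exact fun h' => h1 ((D.word i).cnt_inj hl hj h')
      · rw [← hs, ← hr']; exact fun h' => h2 ((D.word i).cnt_inj hl hj' h')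
    · rw [inj_comm hjl]
  · have h3 := matY_swap_mul (D := D) (lam := lam) (γ := γ) (v := v) (x := D.eT lam γ i)
      (w := D.word i) h (a := a) ha
    rw [Equiv.swap_apply_of_ne_of_ne h1 h2] at h3
    rw [matPsi_mul_ne (hk := hk) h, h3, matY, diag_mul_single, matPsi_mul_ne (hk := hk) h]

theorem matPsi_matPsi (i : β) (v : Word n m) (k l : ℕ) (hl : l + 1 < n) (hkl : k + 1 < l) :
    D.matPsi lam γ (k + 1) * (D.matPsi lam γ (l + 1) *
      Matrix.single (D.word i) v (D.eT lam γ i)) = D.matPsi lam γ (l + 1) *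
        (D.matPsi lam γ (k + 1) * Matrix.single (D.word i) v (D.eT lam γ i)) := by
  have hk : k + 1 < n := by omega
  generalize hw : D.word i = w
  have a1 : (w.sw k hk).1 ⟨l, by omega⟩ = w.1 ⟨l, by omega⟩ := by
    rw [Word.sw_apply, if_neg (by omega), if_neg (by omega)]
  have a2 : (w.sw k hk).1 ⟨l + 1, by omega⟩ = w.1 ⟨l + 1, by omega⟩ := by
    rw [Word.sw_apply, if_neg (by omega), if_neg (by omega)]
  have a3 : (w.sw l hl).1 ⟨k, by omega⟩ = w.1 ⟨k, by omega⟩ := by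
    rw [Word.sw_apply, if_neg (by omega), if_neg (by omega)]
  have a4 : (w.sw l hl).1 ⟨k + 1, by omega⟩ = w.1 ⟨k + 1, by omega⟩ := by
    rw [Word.sw_apply, if_neg (by omega), if_neg (by omega)]
  have c1 : ∀ j, (w.sw k hk).cnt j l = w.cnt j l := fun j => w.cnt_sw (by omega) (by omega)
  have c2 : ∀ j, (w.sw l hl).cnt j k = w.cnt j k := fun j => w.cnt_sw (by omega) (by omega)
  by_cases h : w.1 ⟨k, by omega⟩ = w.1 ⟨k + 1, hk⟩
  · by_cases h' : w.1 ⟨l, by omega⟩ = w.1 ⟨l + 1, hl⟩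
    · obtain ⟨j, hj⟩ : ∃ j, w.1 ⟨k, by omega⟩ = j := ⟨_, rfl⟩
      obtain ⟨r, hr⟩ : ∃ r, w.cnt j k = r := ⟨_, rfl⟩
      obtain ⟨j', hj'⟩ : ∃ j', w.1 ⟨l, by omega⟩ = j' := ⟨_, rfl⟩
      obtain ⟨s, hs⟩ : ∃ s, w.cnt j' l = s := ⟨_, rfl⟩
      rw [matPsi_mul_same (hk := hk) hj (h.symm.trans hj) hr,
        matPsi_mul_same (hk := hl) hj' (h'.symm.trans hj') hs,
        matPsi_mul_same (hk := hk) hj (h.symm.trans hj) hr,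
        matPsi_mul_same (hk := hl) hj' (h'.symm.trans hj') hs]
      by_cases hjj : j = j'
      · subst hjj
        rw [(D.rep_inj lam γ j i).psi_psi]
        · rw [← hs, ← w.cnt_succ_self hj']
          exact w.cnt_lt (ha := hl) (h'.symm.trans hj')
        · rw [← hs, ← hr, ← w.cnt_succ_self hj]
          exact w.cnt_lt_cnt (ha := hk) (h.symm.trans hj) hkl
      · rw [inj_comm hjj]
    · rw [matPsi_mul_ne (hk := hl) h', matPsi_mul_same (hk := hk) rfl h.symm rfl,
        matPsi_mul_ne (hk := hl) h', matPsi_mul_same (hk := hk) a3 (a4.trans h.symm) (c2 _)]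
  · by_cases h' : w.1 ⟨l, by omega⟩ = w.1 ⟨l + 1, hl⟩
    · rw [matPsi_mul_ne (hk := hk) h, matPsi_mul_same (hk := hl) rfl h'.symm rfl,
        matPsi_mul_ne (hk := hk) h, matPsi_mul_same (hk := hl) a1 (a2.trans h'.symm) (c1 _)]
    · rw [matPsi_mul_ne (hk := hk) h, matPsi_mul_ne (hk := hl) h',
        matPsi_mul_ne (hk := hk) (by rwa [a3, a4]), matPsi_mul_ne (hk := hl) (by rwa [a1, a2]),
        Word.sw_comm _ _ _ hkl]

theorem matPsi_sq (i : β) (v : Word n m) (k : ℕ) (hk : k + 1 < n) :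
    D.matPsi lam γ (k + 1) * (D.matPsi lam γ (k + 1) *
      Matrix.single (D.word i) v (D.eT lam γ i)) =
    Q Γ (i.1 ⟨k, by omega⟩) (i.1 ⟨k + 1, hk⟩) (D.matY lam γ k) (D.matY lam γ (k + 1)) *
      Matrix.single (D.word i) v (D.eT lam γ i) := by
  by_cases h : p (i.1 ⟨k, by omega⟩) = p (i.1 ⟨k + 1, hk⟩)
  · obtain ⟨j, hj⟩ : ∃ j, p (i.1 ⟨k, by omega⟩) = j := ⟨_, rfl⟩
    obtain ⟨r, hr⟩ : ∃ r, (D.word i).cnt j k = r := ⟨_, rfl⟩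
    have hj' := h.symm.trans hj
    have hr' : (D.word i).cnt j (k + 1) = r + 1 := by
      rw [Word.cnt_succ_self _ (ha := by omega) hj, hr]
    have hm : r + 1 < m j := by rw [← hr']; exact (D.word i).cnt_lt hj'
    rw [matPsi_mul_same (hk := hk) hj hj' hr, matPsi_mul_same (hk := hk) hj hj' hr, matY_Q,
      entryY_eq (ha := by omega) hj hr, entryY_eq (ha := hk) hj' hr',
      (D.rep_inj lam γ j i).psi_sq r hm, full_Q D.θ_part, sub_apply (D := D) hj hr,
      sub_apply (D := D) hj' hr']
  · rw [Q_eq_one D.arrows_part h, one_mul, matPsi_mul_ne (hk := hk) h,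
      matPsi_mul_ne (hk := hk), Word.sw_sw]
    rw [Word.sw_apply, Word.sw_apply]
    simpa using fun h' : (D.word i).1 ⟨k + 1, hk⟩ = (D.word i).1 ⟨k, by omega⟩ => h h'.symm

theorem matPsi_braid_same (i : β) (v : Word n m) (k : ℕ) (hk : k + 2 < n)
    (h1 : p (i.1 ⟨k, by omega⟩) = p (i.1 ⟨k + 1, by omega⟩))
    (h2 : p (i.1 ⟨k, by omega⟩) = p (i.1 ⟨k + 2, hk⟩)) :
    D.matPsi lam γ (k + 2) * (D.matPsi lam γ (k + 1) * (D.matPsi lam γ (k + 2) *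
      Matrix.single (D.word i) v (D.eT lam γ i))) =
    D.matPsi lam γ (k + 1) * (D.matPsi lam γ (k + 2) * (D.matPsi lam γ (k + 1) *
      Matrix.single (D.word i) v (D.eT lam γ i))) +
      (open Classical in if i.1 ⟨k, by omega⟩ = i.1 ⟨k + 2, hk⟩ then
        divQ Γ (i.1 ⟨k, by omega⟩) (i.1 ⟨k + 1, by omega⟩) (D.matY lam γ k)
          (D.matY lam γ (k + 1)) (D.matY lam γ (k + 2)) *
          Matrix.single (D.word i) v (D.eT lam γ i) else 0) := by
  obtain ⟨j, hj⟩ : ∃ j, p (i.1 ⟨k, by omega⟩) = j := ⟨_, rfl⟩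
  obtain ⟨r, hr⟩ : ∃ r, (D.word i).cnt j k = r := ⟨_, rfl⟩
  have hj' := h1.symm.trans hj
  have hj'' := h2.symm.trans hj
  have hr' : (D.word i).cnt j (k + 1) = r + 1 := by
    rw [Word.cnt_succ_self _ (ha := by omega) hj, hr]
  have hr'' : (D.word i).cnt j (k + 2) = r + 2 := by
    rw [Word.cnt_succ_self _ (ha := by omega) hj', hr']
  have hm : r + 2 < m j := by rw [← hr'']; exact (D.word i).cnt_lt hj''
  rw [matPsi_mul_same (k := k + 1) (hk := hk) hj' hj'' hr',
    matPsi_mul_same (k := k) (hk := by omega) hj hj' hr,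
    matPsi_mul_same (k := k + 1) (hk := hk) hj' hj'' hr',
    matPsi_mul_same (k := k) (hk := by omega) hj hj' hr,
    matPsi_mul_same (k := k + 1) (hk := hk) hj' hj'' hr',
    matPsi_mul_same (k := k) (hk := by omega) hj hj' hr, matY_divQ,
    entryY_eq (ha := by omega) hj hr, entryY_eq (ha := by omega) hj' hr',
    entryY_eq (ha := by omega) hj'' hr'']
  have R := D.rep_inj lam γ j i
  split_ifs with hi
  · rw [R.braid_eq r hm ((sub_eq_iff hj hj'' hr hr'').mpr hi), full_divQ D.θ_part,
      sub_apply (D := D) hj hr, sub_apply (D := D) hj' hr', Matrix.single_add]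
  · rw [R.braid_ne r hm fun h => hi ((sub_eq_iff hj hj'' hr hr'').mp h), add_zero]

/-- In either product at most one `ψ` meets two equal letters, namely when exactly two of the three
letters agree. It is the same `ψ` of the same factor on both sides, because passing the third letter
does not change the ranks. The other factors only permute the word, and the two resulting words
agree. -/
theorem matPsi_braid_not_same (i : β) (v : Word n m) (k : ℕ) (hk : k + 2 < n)
    (h : ¬ (p (i.1 ⟨k, by omega⟩) = p (i.1 ⟨k + 1, by omega⟩) ∧
      p (i.1 ⟨k, by omega⟩) = p (i.1 ⟨k + 2, hk⟩))) :
    D.matPsi lam γ (k + 2) * (D.matPsi lam γ (k + 1) * (D.matPsi lam γ (k + 2) *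
      Matrix.single (D.word i) v (D.eT lam γ i))) =
    D.matPsi lam γ (k + 1) * (D.matPsi lam γ (k + 2) * (D.matPsi lam γ (k + 1) *
      Matrix.single (D.word i) v (D.eT lam γ i))) := by
  obtain ⟨w, hw⟩ : ∃ w, D.word i = w := ⟨_, rfl⟩
  have hab : p (i.1 ⟨k, by omega⟩) = w.1 ⟨k, by omega⟩ := by rw [← hw]; rfl
  have hb : p (i.1 ⟨k + 1, by omega⟩) = w.1 ⟨k + 1, by omega⟩ := by rw [← hw]; rfl
  have hc : p (i.1 ⟨k + 2, by omega⟩) = w.1 ⟨k + 2, by omega⟩ := by rw [← hw]; rfl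
  rw [hab, hb, hc] at h
  rw [hw]
  have n1 : ¬ k + 1 + 1 = k := by omega
  have n2 : ¬ k = k + 1 + 1 := by omega
  have k1 : k + 1 < n := by omega
  by_cases hac : w.1 ⟨k, by omega⟩ = w.1 ⟨k + 2, hk⟩
  · have hab : w.1 ⟨k, by omega⟩ ≠ w.1 ⟨k + 1, by omega⟩ := fun h' => h ⟨h', hac⟩
    rw [matPsi_mul_ne (k := k + 1) (hk := hk) fun h' => hab (hac.trans h'.symm),
      matPsi_mul_ne (k := k) (hk := k1) hab,
      matPsi_mul_same (k := k) (hk := k1) (j := w.1 ⟨k, by omega⟩)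
        (r := w.cnt (w.1 ⟨k, by omega⟩) k),
      matPsi_mul_ne (k := k + 1) (hk := hk), Word.sw_sw,
      matPsi_mul_same (k := k + 1) (hk := hk) (j := w.1 ⟨k, by omega⟩)
        (r := w.cnt (w.1 ⟨k, by omega⟩) k),
      matPsi_mul_ne (k := k) (hk := k1), Word.sw_sw]
    · simpa [Word.sw_apply] using hab.symm
    · simp [Word.sw_apply]
    · simp [Word.sw_apply, n1, hac]
    · exact w.cnt_sw_left (hk := k1) hab.symm
    · simpa [Word.sw_apply, n1, n2] using fun h' => hab (hac.trans h')
    · simp [Word.sw_apply, n2]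
    · simp [Word.sw_apply, hac]
    · exact w.cnt_sw (by omega) (by omega)
  by_cases hab : w.1 ⟨k, by omega⟩ = w.1 ⟨k + 1, by omega⟩
  · have hbc : w.1 ⟨k + 1, by omega⟩ ≠ w.1 ⟨k + 2, hk⟩ := fun h' => hac (hab.trans h')
    rw [matPsi_mul_ne (k := k + 1) (hk := hk) hbc,
      matPsi_mul_ne (k := k) (hk := k1),
      matPsi_mul_same (k := k + 1) (hk := hk) (j := w.1 ⟨k, by omega⟩)
        (r := w.cnt (w.1 ⟨k, by omega⟩) k),
      matPsi_mul_same (k := k) (hk := k1) (j := w.1 ⟨k, by omega⟩) rfl hab.symm rfl,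
      matPsi_mul_ne (k := k + 1) (hk := hk) hbc, matPsi_mul_ne (k := k) (hk := k1)]
    · simpa [Word.sw_apply, n2] using hac
    · simp [Word.sw_apply, n2]
    · simp [Word.sw_apply, n1, hab]
    · rw [Word.cnt_sw_left, Word.cnt_sw _ (by omega) (by omega)]
      simpa [Word.sw_apply] using Ne.symm hac
    · simpa [Word.sw_apply, n2] using hac
  by_cases hbc : w.1 ⟨k + 1, by omega⟩ = w.1 ⟨k + 2, hk⟩
  · rw [matPsi_mul_same (k := k + 1) (hk := hk) (j := w.1 ⟨k + 1, by omega⟩) rfl hbc.symm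
        (w.cnt_succ_ne hab), matPsi_mul_ne (k := k) (hk := k1) hab,
      matPsi_mul_ne (k := k + 1) (hk := hk), matPsi_mul_ne (k := k) (hk := k1) hab,
      matPsi_mul_ne (k := k + 1) (hk := hk),
      matPsi_mul_same (k := k) (hk := k1) (j := w.1 ⟨k + 1, by omega⟩)
        (r := w.cnt (w.1 ⟨k + 1, by omega⟩) k)]
    · simp [Word.sw_apply, n2]
    · simp [Word.sw_apply, n1, hbc]
    · rw [Word.cnt_sw _ (by omega) (by omega), Word.cnt_sw _ (by omega) (by omega)]
    · simpa [Word.sw_apply, n1] using hac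
    · simpa [Word.sw_apply, n1] using hac
  · rw [matPsi_mul_ne (k := k + 1) (hk := hk) hbc, matPsi_mul_ne (k := k) (hk := k1) hab,
      matPsi_mul_ne (k := k + 1) (hk := hk), matPsi_mul_ne (k := k) (hk := k1),
      matPsi_mul_ne (k := k + 1) (hk := hk), matPsi_mul_ne (k := k) (hk := k1),
      Word.sw_braid]
    · simpa [Word.sw_apply, n1, n2] using hbc
    · simpa [Word.sw_apply, n1, n2] using hab
    · simpa [Word.sw_apply, n1, n2] using hac
    · simpa [Word.sw_apply, n1, n2] using hac

theorem matPsi_braid (i : β) (v : Word n m) (k : ℕ) (hk : k + 2 < n) :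
    D.matPsi lam γ (k + 2) * (D.matPsi lam γ (k + 1) * (D.matPsi lam γ (k + 2) *
      Matrix.single (D.word i) v (D.eT lam γ i))) =
    D.matPsi lam γ (k + 1) * (D.matPsi lam γ (k + 2) * (D.matPsi lam γ (k + 1) *
      Matrix.single (D.word i) v (D.eT lam γ i))) +
      (open Classical in if i.1 ⟨k, by omega⟩ = i.1 ⟨k + 2, hk⟩ then
        divQ Γ (i.1 ⟨k, by omega⟩) (i.1 ⟨k + 1, by omega⟩) (D.matY lam γ k)
          (D.matY lam γ (k + 1)) (D.matY lam γ (k + 2)) *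
          Matrix.single (D.word i) v (D.eT lam γ i) else 0) := by
  by_cases h : p (i.1 ⟨k, by omega⟩) = p (i.1 ⟨k + 1, by omega⟩) ∧
      p (i.1 ⟨k, by omega⟩) = p (i.1 ⟨k + 2, hk⟩)
  · exact matPsi_braid_same i v k hk h.1 h.2
  · rw [matPsi_braid_not_same i v k hk h]
    split_ifs with hi
    · rw [divQ_eq_zero D.arrows_part fun h' => h ⟨h', congrArg p hi⟩, zero_mul, add_zero]
    · rw [add_zero]

theorem matPsi_zero_matPsi (i : β) (v : Word n m) (k : ℕ) (hk : k + 2 < n) :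
    D.matPsi lam γ 0 * (D.matPsi lam γ (k + 2) *
      Matrix.single (D.word i) v (D.eT lam γ i)) = D.matPsi lam γ (k + 2) *
        (D.matPsi lam γ 0 * Matrix.single (D.word i) v (D.eT lam γ i)) := by
  have h0 : 0 < n := by omega
  generalize hw : D.word i = w
  by_cases h : w.1 ⟨k + 1, by omega⟩ = w.1 ⟨k + 2, hk⟩
  · obtain ⟨j, hj⟩ : ∃ j, w.1 ⟨k + 1, by omega⟩ = j := ⟨_, rfl⟩
    obtain ⟨r, hr⟩ : ∃ r, w.cnt j (k + 1) = r := ⟨_, rfl⟩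
    obtain ⟨l, hl⟩ : ∃ l, w.1 ⟨0, h0⟩ = l := ⟨_, rfl⟩
    rw [matPsi_mul_same (k := k + 1) (hk := hk) hj (h.symm.trans hj) hr,
      matPsi_zero_mul (h := h0) hl, matPsi_zero_mul (h := h0) hl,
      matPsi_mul_same (k := k + 1) (hk := hk) hj (h.symm.trans hj) hr]
    by_cases hjl : l = j
    · subst hjl
      have h1 := w.cnt_lt_cnt (ha := h0) hl (Nat.succ_pos k)
      rw [Nat.succ_eq_add_one, hr] at h1
      obtain ⟨s, rfl⟩ : ∃ s, r = s + 1 := ⟨r - 1, by omega⟩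
      rw [(D.rep_inj lam γ l i).psi0_psi]
      have h2 := w.cnt_lt (ha := hk) (h.symm.trans hj)
      rwa [w.cnt_succ_self hj, hr] at h2
    · rw [inj_comm hjl]
  · rw [matPsi_mul_ne (k := k + 1) (hk := hk) h,
      matPsi_zero_mul (h := h0) (w := w.sw (k + 1) hk) (j := w.1 ⟨0, h0⟩)
        (by rw [Word.sw_apply, if_neg (by omega), if_neg (by omega)]),
      matPsi_zero_mul (h := h0) (w := w) rfl, matPsi_mul_ne (k := k + 1) (hk := hk) h]

theorem matPsi_zero_matY (i : β) (v : Word n m) (a : ℕ) (ha : a + 1 < n) :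
    D.matPsi lam γ 0 * (D.matY lam γ (a + 1) *
      Matrix.single (D.word i) v (D.eT lam γ i)) = D.matY lam γ (a + 1) *
        (D.matPsi lam γ 0 * Matrix.single (D.word i) v (D.eT lam γ i)) := by
  have h0 : 0 < n := by omega
  generalize hw : D.word i = w
  obtain ⟨j, hj⟩ : ∃ j, w.1 ⟨a + 1, ha⟩ = j := ⟨_, rfl⟩
  obtain ⟨r, hr⟩ : ∃ r, w.cnt j (a + 1) = r := ⟨_, rfl⟩
  obtain ⟨l, hl⟩ : ∃ l, w.1 ⟨0, h0⟩ = l := ⟨_, rfl⟩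
  rw [matY_mul (ha := ha) hj hr, matPsi_zero_mul (h := h0) hl, matPsi_zero_mul (h := h0) hl,
    matY_mul (ha := ha) hj hr]
  by_cases hjl : l = j
  · subst hjl
    have h1 := w.cnt_lt_cnt (ha := h0) hl (Nat.succ_pos a)
    rw [Nat.succ_eq_add_one, hr] at h1
    obtain ⟨s, rfl⟩ : ∃ s, r = s + 1 := ⟨r - 1, by omega⟩
    rw [(D.rep_inj lam γ l i).psi0_y]
    rw [← hr]
    exact w.cnt_lt (ha := ha) hj
  · rw [inj_comm hjl]

end Decomp

end ToMatrix

/-! ### The homomorphism to the matrix algebra -/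

section ToMatrix

variable {I : Type u} {A : Type v} {K : Type w} [CommRing K] {d n : ℕ}
  {Γ : InvQuiver I A} {p : I → Fin d} {m : Fin d → ℕ} {β : Set (Fin n → I)}
  {D : Decomp Γ p m β} {lam : I → ℕ} {γ : I → K}

namespace Decomp

/-- On a word that begins with different letters `j`, `l`, the product `ψ_1 ψ_0 ψ_1` acts as the
`ψ_0` of the factor `l`. So the two sides are the products of the `ψ_0` of two different factors in
both orders. -/
theorem matPsi_braid4_ne (i : β) (v : Word n m) (hn : 1 < n)
    (h : p (i.1 ⟨0, by omega⟩) ≠ p (i.1 ⟨1, hn⟩)) :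
    D.matPsi lam γ 0 * (D.matPsi lam γ 1 * (D.matPsi lam γ 0 * (D.matPsi lam γ 1 *
      Matrix.single (D.word i) v (D.eT lam γ i)))) =
    D.matPsi lam γ 1 * (D.matPsi lam γ 0 * (D.matPsi lam γ 1 * (D.matPsi lam γ 0 *
      Matrix.single (D.word i) v (D.eT lam γ i)))) := by
  have h0 : 0 < n := by omega
  obtain ⟨w, hw⟩ : ∃ w, D.word i = w := ⟨_, rfl⟩
  have ha : p (i.1 ⟨0, h0⟩) = w.1 ⟨0, h0⟩ := by rw [← hw]; rfl
  have hb : p (i.1 ⟨1, hn⟩) = w.1 ⟨1, hn⟩ := by rw [← hw]; rfl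
  rw [ha, hb] at h
  rw [hw]
  have h' : (w.sw 0 hn).1 ⟨0, h0⟩ ≠ (w.sw 0 hn).1 ⟨0 + 1, hn⟩ := by
    simpa [Word.sw_apply] using h.symm
  rw [matPsi_mul_ne (k := 0) (hk := hn) h,
    matPsi_zero_mul (h := h0) (w := w.sw 0 hn) (j := w.1 ⟨1, hn⟩) (by simp [Word.sw_apply]),
    matPsi_mul_ne (k := 0) (hk := hn) h', Word.sw_sw, matPsi_zero_mul (h := h0) (w := w) rfl,
    matPsi_zero_mul (h := h0) (w := w) rfl, matPsi_mul_ne (k := 0) (hk := hn) h,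
    matPsi_zero_mul (h := h0) (w := w.sw 0 hn) (j := w.1 ⟨1, hn⟩) (by simp [Word.sw_apply]),
    matPsi_mul_ne (k := 0) (hk := hn) h', Word.sw_sw, inj_comm h]

/-- The test vectors have a single nonzero entry, and the matrices of the generators send such
vectors to vectors of the same kind in column `v`. Every relation thus becomes one equation in the
tensor product. -/
theorem rep_mat (D : Decomp Γ p m β) (lam : I → ℕ) (γ : I → K) (i : β) (v : Word n m) :
    RepAt Γ lam γ (D.matY lam γ) (D.matPsi lam γ) (D.matE lam γ) i
      (Matrix.single (D.word i) v (D.eT lam γ i)) where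
  e_same := matE_mul rfl (eT_mul_self i)
  e_ne x hx := matE_mul_ne rfl (eT_mul_self i) hx
  y_y a b ha hb := by
    rw [← mul_assoc, ← mul_assoc, matY, matY, ← map_mul, ← map_mul, diag_mul_single,
      diag_mul_single]
    congr 2
    rw [Pi.mul_apply, Pi.mul_apply]
    generalize D.word i = w
    obtain ⟨j, hj⟩ : ∃ j, w.1 ⟨b, hb⟩ = j := ⟨_, rfl⟩
    rw [entryY_eq (ha := hb) hj rfl]
    by_cases h : w.1 ⟨a, ha⟩ = j
    · rw [entryY_eq (ha := ha) h rfl, ← map_mul, V.y_mul_y, map_mul]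
    · rw [entryY_eq (ha := ha) rfl rfl]
      simpa using inj_comm (D := D) (lam := lam) (γ := γ) h (V.y _) (V.y _) 1
  e_y_same a ha := by
    rw [matY, diag_mul_single, entryY_eq (ha := ha) rfl rfl]
    exact matE_mul rfl (eT_y _ _)
  e_y_ne a ha x hx := by
    rw [matY, diag_mul_single, entryY_eq (ha := ha) rfl rfl]
    exact matE_mul_ne rfl (eT_y _ _) hx
  e_psi_same k hk x hx := by
    obtain ⟨z, hz, h⟩ := exists_matPsi_mul (D := D) (lam := lam) (γ := γ) i v k hk
    rw [hz, show x = D.sw i k hk from Subtype.ext hx]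
    exact matE_mul rfl h
  e_psi_ne k hk x hx := by
    obtain ⟨z, hz, h⟩ := exists_matPsi_mul (D := D) (lam := lam) (γ := γ) i v k hk
    rw [hz]
    exact matE_mul_ne rfl h fun h' => hx (congrArg Subtype.val h')
  psi_y_left k hk := matPsi_matY_left i v k hk
  psi_y_right k hk := matPsi_matY_right i v k hk
  psi_y_far k a hk ha h1 h2 := matPsi_matY_far i v k a hk ha h1 h2
  psi_psi k l hl hkl := matPsi_matPsi i v k l hl hkl
  psi_sq k hk := matPsi_sq i v k hk
  braid_eq k hk h := by rw [matPsi_braid i v k hk, if_pos h]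
  braid_ne k hk h := by rw [matPsi_braid i v k hk, if_neg h, add_zero]
  e_psi0_same h x hx := by
    rw [matPsi_zero_mul (h := h) (j := p (i.1 ⟨0, h⟩)) rfl, ← D.word_th i h,
      show x = D.th i h from Subtype.ext hx]
    exact matE_mul rfl (eT_psi0 rfl)
  e_psi0_ne h x hx := by
    rw [matPsi_zero_mul (h := h) (j := p (i.1 ⟨0, h⟩)) rfl, ← D.word_th i h]
    exact matE_mul_ne rfl (eT_psi0 rfl) fun h' => hx (congrArg Subtype.val h')
  psi0_psi k hk := matPsi_zero_matPsi i v k hk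
  psi0_y0 h := by
    have hc := (D.word i).cnt_lt (ha := h) (j := p (i.1 ⟨0, h⟩)) rfl
    rw [Word.cnt_zero] at hc
    rw [matY_mul (ha := h) (j := p (i.1 ⟨0, h⟩)) rfl (Word.cnt_zero _ _),
      matPsi_zero_mul (h := h) (j := p (i.1 ⟨0, h⟩)) rfl,
      matPsi_zero_mul (h := h) (j := p (i.1 ⟨0, h⟩)) rfl,
      matY_mul (ha := h) (j := p (i.1 ⟨0, h⟩)) rfl (Word.cnt_zero _ _),
      (D.rep_inj lam γ _ i).psi0_y0 hc, sub_apply (D := D) (ha := h) rfl (Word.cnt_zero _ _),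
      Matrix.smul_single, sub_eq_add_neg, Matrix.single_add, ← Matrix.single_neg,
      ← sub_eq_add_neg]
  psi0_y a ha := matPsi_zero_matY i v a ha
  psi0_sq_eq h h0 := by
    have hc := (D.word i).cnt_lt (ha := h) (j := p (i.1 ⟨0, h⟩)) rfl
    rw [Word.cnt_zero] at hc
    have hs := sub_apply (D := D) (ha := h) (hr := hc) rfl (Word.cnt_zero _ _)
    rw [matPsi_zero_mul (h := h) (j := p (i.1 ⟨0, h⟩)) rfl,
      matPsi_zero_mul (h := h) (j := p (i.1 ⟨0, h⟩)) rfl,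
      (D.rep_inj lam γ _ i).psi0_sq_eq hc (by rw [hs]; exact h0), matY_pow,
      entryY_eq (ha := h) (j := p (i.1 ⟨0, h⟩)) rfl (Word.cnt_zero _ _), hs]
    rfl
  psi0_sq_ne h h0 := by
    have hc := (D.word i).cnt_lt (ha := h) (j := p (i.1 ⟨0, h⟩)) rfl
    rw [Word.cnt_zero] at hc
    have hs := sub_apply (D := D) (ha := h) (hr := hc) rfl (Word.cnt_zero _ _)
    rw [matPsi_zero_mul (h := h) (j := p (i.1 ⟨0, h⟩)) rfl,
      matPsi_zero_mul (h := h) (j := p (i.1 ⟨0, h⟩)) rfl,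
      (D.rep_inj lam γ _ i).psi0_sq_ne hc (by rw [hs]; exact h0), Matrix.single_zero]
  braid4_opp h h1 h2 := by
    have h0 : 0 < n := by omega
    obtain ⟨j, hj⟩ : ∃ j, p (i.1 ⟨0, h0⟩) = j := ⟨_, rfl⟩
    -- The parts are stable under `θ`, so `i_2 = θ(i_1)` forces both entries into one part.
    have hj' : p (i.1 ⟨0 + 1, h⟩) = j := by rw [← hj, ← D.θ_part (i.1 ⟨0, h0⟩), h2]
    have hr : (D.word i).cnt j 0 = 0 := Word.cnt_zero _ _
    have hr' : (D.word i).cnt j (0 + 1) = 1 := by rw [Word.cnt_succ_self _ (ha := h0) hj, hr]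
    have hm : 1 < m j := by rw [← hr']; exact (D.word i).cnt_lt hj'
    have hs := sub_apply (D := D) (ha := h0) (hr := by omega) hj hr
    have hs' := sub_apply (D := D) (ha := h) (hr := hm) hj' hr'
    have h1' := fun x => matPsi_mul_same (D := D) (lam := lam) (γ := γ) (v := v) (x := x)
      (k := 0) (hk := h) hj hj' hr
    have h0' := fun x => matPsi_zero_mul (D := D) (lam := lam) (γ := γ) (v := v) (x := x)
      (h := h0) (w := D.word i) hj
    simp only [zero_add] at h1'
    simp only [h0', h1', matY_divPow]
    rw [(D.rep_inj lam γ j i).braid4_opp hm (by rw [hs]; exact h1)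
      (by rw [hs, hs']; exact Subtype.ext h2), Matrix.single_add,
      entryY_eq (ha := h0) hj hr, entryY_eq (ha := h) hj' hr', hs]
    rfl
  braid4_zero h h1 h2 := by
    have h0 : 0 < n := by omega
    by_cases hp : p (i.1 ⟨0, h0⟩) = p (i.1 ⟨1, h⟩)
    · obtain ⟨j, hj⟩ : ∃ j, p (i.1 ⟨0, h0⟩) = j := ⟨_, rfl⟩
      have hj' : p (i.1 ⟨0 + 1, h⟩) = j := hp.symm.trans hj
      have hr : (D.word i).cnt j 0 = 0 := Word.cnt_zero _ _
      have hr' : (D.word i).cnt j (0 + 1) = 1 := by rw [Word.cnt_succ_self _ (ha := h0) hj, hr]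
      have hm : 1 < m j := by rw [← hr']; exact (D.word i).cnt_lt hj'
      have hs := sub_apply (D := D) (ha := h0) (hr := by omega) hj hr
      have hs' := sub_apply (D := D) (ha := h) (hr := hm) hj' hr'
      have h1' := fun x => matPsi_mul_same (D := D) (lam := lam) (γ := γ) (v := v) (x := x)
        (k := 0) (hk := h) hj hj' hr
      have h0' := fun x => matPsi_zero_mul (D := D) (lam := lam) (γ := γ) (v := v) (x := x)
        (h := h0) (w := D.word i) hj
      simp only [zero_add] at h1'
      simp only [h0', h1', matY_oddQ]
      rw [(D.rep_inj lam γ j i).braid4_zero hm (by rw [hs]; exact h1)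
        (by rw [hs, hs']; exact fun h' => h2 (congrArg Subtype.val h')), Matrix.single_add,
        entryY_eq (ha := h0) hj hr, entryY_eq (ha := h) hj' hr', hs, hs', full_oddQ D.θ_part,
        Matrix.smul_single]
    · rw [matPsi_braid4_ne i v h hp, oddQ_eq_zero D.arrows_part (Ne.symm hp), zero_mul, smul_zero,
        add_zero]
  braid4_ne h h1 := by
    have h0 : 0 < n := by omega
    by_cases hp : p (i.1 ⟨0, h0⟩) = p (i.1 ⟨1, h⟩)
    · obtain ⟨j, hj⟩ : ∃ j, p (i.1 ⟨0, h0⟩) = j := ⟨_, rfl⟩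
      have hj' : p (i.1 ⟨0 + 1, h⟩) = j := hp.symm.trans hj
      have hr : (D.word i).cnt j 0 = 0 := Word.cnt_zero _ _
      have hr' : (D.word i).cnt j (0 + 1) = 1 := by rw [Word.cnt_succ_self _ (ha := h0) hj, hr]
      have hm : 1 < m j := by rw [← hr']; exact (D.word i).cnt_lt hj'
      have hs := sub_apply (D := D) (ha := h0) (hr := by omega) hj hr
      have hs' := sub_apply (D := D) (ha := h) (hr := hm) hj' hr'
      have h1' := fun x => matPsi_mul_same (D := D) (lam := lam) (γ := γ) (v := v) (x := x)
        (k := 0) (hk := h) hj hj' hr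
      have h0' := fun x => matPsi_zero_mul (D := D) (lam := lam) (γ := γ) (v := v) (x := x)
        (h := h0) (w := D.word i) hj
      have hy := fun x => matY_mul (D := D) (lam := lam) (γ := γ) (v := v) (x := x)
        (ha := h0) (w := D.word i) hj hr
      have hsub : ∀ x y : D.T lam γ, Matrix.single (D.word i) v (x - y) =
          Matrix.single (D.word i) v x - Matrix.single (D.word i) v y := fun x y => by
        rw [sub_eq_add_neg, Matrix.single_add, ← Matrix.single_neg, sub_eq_add_neg]
      simp only [zero_add] at h1'
      simp only [h0', h1', hy, Matrix.smul_single, ← hsub, matY_oddQ₂]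
      rw [(D.rep_inj lam γ j i).braid4_ne hm (by rw [hs]; exact h1), Matrix.single_add,
        entryY_eq (ha := h0) hj hr, entryY_eq (ha := h) hj' hr', hs, hs', full_oddQ₂ D.θ_part]
    · rw [matPsi_braid4_ne i v h hp, oddQ₂_eq_zero D.arrows_part (Ne.symm hp), zero_mul, smul_zero,
        add_zero]

theorem sum_single_eT [Fintype β] :
    ∑ i : β, Matrix.single (D.word i) (D.word i) (D.eT lam γ i) = 1 := by
  ext u w
  rw [Matrix.sum_apply, Matrix.one_apply]
  by_cases h : u = w
  · subst h
    rw [if_pos rfl, ← sum_eT u]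
    exact Finset.sum_congr rfl fun i _ => by simp [Matrix.single_apply]
  · rw [if_neg h]
    refine Finset.sum_eq_zero fun i _ => ?_
    rw [Matrix.single_apply, if_neg]
    rintro ⟨h1, h2⟩
    exact h (h1.symm.trans h2)

/-- The homomorphism from `V_β(Γ, λ, γ)` to the matrix algebra over the tensor product. -/
noncomputable def toMat (D : Decomp Γ p m β) (lam : I → ℕ) (γ : I → K) :
    V Γ lam γ β →ₐ[K] Matrix (Word n m) (Word n m) (D.T lam γ) :=
  haveI := D.finite
  V.lift id _ (fun i => D.rep_mat lam γ i (D.word i)) fun b b' h => by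
    have := Fintype.ofFinite β
    rw [← mul_one b, ← mul_one b', ← sum_single_eT, Finset.mul_sum, Finset.mul_sum]
    exact Finset.sum_congr rfl fun i _ => h i

theorem toMat_gen (g : Gen β) : D.toMat lam γ (V.gen Γ lam γ β g) =
    genImage (D.matY lam γ) (D.matPsi lam γ) (D.matE lam γ) g := by
  have := D.finite
  unfold toMat
  rw [V.lift_gen]

theorem toMat_y {a : ℕ} (ha : a < n) : D.toMat lam γ (V.y a) = D.matY lam γ a := by
  rw [V.y_of_lt ha, toMat_gen]; rfl

theorem toMat_psi {a : ℕ} (ha : a < n) : D.toMat lam γ (V.psi a) = D.matPsi lam γ a := by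
  rw [V.psi_of_lt ha, toMat_gen]; rfl

theorem toMat_e (i : β) : D.toMat lam γ (V.e i) = D.matE lam γ i := toMat_gen _

end Decomp

end ToMatrix

/-! ### Homomorphisms out of tensor products -/

section CommLift

variable {K : Type*} [CommRing K] {d : ℕ} {B : Fin d → Type*} [∀ j, Ring (B j)]
  [∀ j, Algebra K (B j)] {R : Type*} [Ring R] [Algebra K R] (φ : ∀ j, B j →ₐ[K] R)
  (h : ∀ j l, j ≠ l → ∀ x y, φ j x * φ l y = φ l y * φ j x)

/-- The product of commuting homomorphisms. -/
def commProd : (∀ j, B j) →* R :=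
  MonoidHom.noncommPiCoprod (fun j => (φ j : B j →* R)) fun _ _ hjl x y => h _ _ hjl x y

/-- The dependence on one coordinate is isolated as a right factor `φ j a`; multilinearity of the
product is then immediate. -/
theorem commProd_update (x : ∀ j, B j) (j : Fin d) (a : B j) :
    commProd φ h (Function.update x j a) = commProd φ h (Function.update x j 1) * φ j a := by
  have h1 : Function.update x j a = Function.update x j 1 * Pi.mulSingle j a := by
    funext l
    by_cases hl : l = j
    · subst hl; simp
    · simp [hl]
  rw [h1, map_mul]
  congr 1
  exact MonoidHom.noncommPiCoprod_mulSingle ..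

/-- The homomorphism from a tensor product given by commuting homomorphisms. -/
noncomputable def commLift : (⨂[K] j, B j) →ₐ[K] R :=
  PiTensorProduct.liftAlgHom
    { toFun := commProd φ h
      map_update_add' := fun {inst} x j a b => by
        rw [Subsingleton.elim inst (instDecidableEqFin d), commProd_update, map_add, mul_add,
          ← commProd_update, ← commProd_update]
      map_update_smul' := fun {inst} x j c a => by
        rw [Subsingleton.elim inst (instDecidableEqFin d), commProd_update, map_smul,
          mul_smul_comm, ← commProd_update] }
    (map_one (commProd φ h)) (map_mul (commProd φ h))

theorem commLift_single (j : Fin d) (x : B j) :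
    commLift φ h (PiTensorProduct.singleAlgHom j x) = φ j x := by
  refine (PiTensorProduct.lift.tprod _).trans ?_
  change commProd φ h (Pi.mulSingle j x) = φ j x
  exact MonoidHom.noncommPiCoprod_mulSingle ..

end CommLift

/-! ### Homomorphisms out of matrix algebras -/

section MatLift

variable {K : Type*} [CommRing K] {n d : ℕ} {m : Fin d → ℕ} {R T : Type*} [Ring R] [Algebra K R]
  [Ring T] [Algebra K T] {e : Word n m → R} {s : ℕ → R} {M : Word n m → Word n m → R}

/-- The homomorphism from a matrix algebra given by matrix units and a homomorphism commuting with
them. -/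
noncomputable def MatUnits.lift (U : MatUnits e s M) (he : ∑ w, e w = 1) (f : T →ₐ[K] R)
    (hf : ∀ x w u, f x * M w u = M w u * f x) : Matrix (Word n m) (Word n m) T →ₐ[K] R :=
  AlgHom.ofLinearMap
    { toFun := fun N => ∑ w, ∑ u, M w u * f (N w u)
      map_add' := fun N N' => by
        simp only [Matrix.add_apply, map_add, mul_add, Finset.sum_add_distrib]
      map_smul' := fun c N => by
        simp only [Matrix.smul_apply, map_smul, mul_smul_comm, Finset.smul_sum,
          RingHom.id_apply] }
    (by
      rw [← he]
      refine Finset.sum_congr rfl fun w _ => ?_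
      rw [Finset.sum_eq_single w]
      · rw [Matrix.one_apply_eq, map_one, mul_one, U.diag]
      · intro u _ hu; rw [Matrix.one_apply_ne hu.symm, map_zero, mul_zero]
      · intro h; exact absurd (Finset.mem_univ w) h)
    (fun N N' => by
      change ∑ w, ∑ u, M w u * f ((N * N') w u) =
        (∑ w, ∑ v, M w v * f (N w v)) * ∑ v', ∑ u, M v' u * f (N' v' u)
      have h1 : ∀ w v v' u, M w v * f (N w v) * (M v' u * f (N' v' u)) =
          if v = v' then M w u * (f (N w v) * f (N' v' u)) else 0 := by
        intro w v v' u
        rw [mul_assoc, ← mul_assoc (f _), hf, mul_assoc, ← mul_assoc]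
        split_ifs with hv
        · rw [hv, U.mul]
        · rw [U.mul_ne _ _ _ _ hv, zero_mul]
      have h2 : ∀ w v, M w v * f (N w v) * ∑ v', ∑ u, M v' u * f (N' v' u) =
          ∑ u, M w u * (f (N w v) * f (N' v u)) := by
        intro w v
        rw [Finset.mul_sum, Finset.sum_eq_single v]
        · rw [Finset.mul_sum]
          exact Finset.sum_congr rfl fun u _ => by rw [h1, if_pos rfl]
        · intro v' _ hv
          rw [Finset.mul_sum]
          exact Finset.sum_eq_zero fun u _ => by rw [h1, if_neg hv.symm]
        · intro h; exact absurd (Finset.mem_univ v) h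
      rw [Finset.sum_mul]
      refine Finset.sum_congr rfl fun w _ => ?_
      rw [Finset.sum_mul, Finset.sum_congr rfl fun v _ => h2 w v, Finset.sum_comm]
      refine Finset.sum_congr rfl fun u _ => ?_
      rw [Matrix.mul_apply, map_sum, Finset.mul_sum]
      simp only [map_mul])

theorem MatUnits.lift_single (U : MatUnits e s M) (he : ∑ w, e w = 1) (f : T →ₐ[K] R)
    (hf : ∀ x w u, f x * M w u = M w u * f x) (w u : Word n m) (x : T) :
    U.lift he f hf (Matrix.single w u x) = M w u * f x := by
  change ∑ w', ∑ u', M w' u' * f (Matrix.single w u x w' u') = _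
  rw [Finset.sum_eq_single w, Finset.sum_eq_single u]
  · simp
  · intro v _ hv; rw [Matrix.single_apply_of_col_ne _ _ hv.symm, map_zero, mul_zero]
  · intro h; exact absurd (Finset.mem_univ u) h
  · intro v _ hv
    refine Finset.sum_eq_zero fun v' _ => ?_
    rw [Matrix.single_apply_of_row_ne hv.symm, map_zero, mul_zero]
  · intro h; exact absurd (Finset.mem_univ w) h

/-- The elements `∑ w, M w u * x * M u w`, for `x` commuting with `e u`. -/
noncomputable def MatUnits.spread (U : MatUnits e s M) (he : ∑ w, e w = 1) (u : Word n m) :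
    Subalgebra.centralizer K {e u} →ₐ[K] R :=
  AlgHom.ofLinearMap
    { toFun := fun x => ∑ w, M w u * x * M u w
      map_add' := fun x y => by
        simp [mul_add, add_mul, Finset.sum_add_distrib]
      map_smul' := fun c x => by simp [Finset.smul_sum] }
    (by
      rw [← he]
      exact Finset.sum_congr rfl fun w _ => by simp [U.mul, U.diag])
    (fun x y => by
      change ∑ w, M w u * (x * y : R) * M u w =
        (∑ w, M w u * x * M u w) * ∑ w, M w u * y * M u w
      rw [Finset.sum_mul]
      refine Finset.sum_congr rfl fun w _ => ?_
      rw [Finset.mul_sum, Finset.sum_eq_single w]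
      · have hy : e u * y.1 = y.1 * e u :=
          (Subalgebra.mem_centralizer_iff K).mp y.2 _ rfl
        have h1 : M u w * M w u = e u := by rw [U.mul, U.diag]
        generalize (x : R) = a, (y : R) = b at hy
        simp only [mul_assoc]
        rw [← mul_assoc (M u w) (M w u), h1, ← mul_assoc (e u) b, hy, mul_assoc b, U.e_mul]
      · intro v _ hv
        simp only [mul_assoc]
        rw [← mul_assoc (M u w), U.mul_ne _ _ _ _ hv.symm]
        simp
      · intro h; exact absurd (Finset.mem_univ w) h)

theorem MatUnits.spread_apply (U : MatUnits e s M) (he : ∑ w, e w = 1) (u : Word n m)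
    (x : Subalgebra.centralizer K {e u}) :
    U.spread (K := K) he u x = ∑ w, M w u * x * M u w := rfl

/-- Multiplication from the other side gives the same element, see `MatUnits.mul_spread`; hence the
spread elements commute with all matrix units. -/
theorem MatUnits.spread_mul (U : MatUnits e s M) (he : ∑ w, e w = 1) (u : Word n m)
    (x : Subalgebra.centralizer K {e u}) (w v : Word n m) :
    U.spread he u x * M w v = M w u * x * M u v := by
  rw [U.spread_apply, Finset.sum_mul, Finset.sum_eq_single w]
  · rw [mul_assoc, U.mul]
  · intro v' _ hv; rw [mul_assoc, U.mul_ne _ _ _ _ hv, mul_zero]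
  · intro h; exact absurd (Finset.mem_univ w) h

theorem MatUnits.mul_spread (U : MatUnits e s M) (he : ∑ w, e w = 1) (u : Word n m)
    (x : Subalgebra.centralizer K {e u}) (w v : Word n m) :
    M w v * U.spread he u x = M w u * x * M u v := by
  rw [U.spread_apply, Finset.mul_sum, Finset.sum_eq_single v]
  · rw [← mul_assoc, ← mul_assoc, U.mul]
  · intro v' _ hv; rw [← mul_assoc, ← mul_assoc, U.mul_ne _ _ _ _ hv.symm, zero_mul, zero_mul]
  · intro h; exact absurd (Finset.mem_univ v) h

end MatLift

section FromParts

variable {I : Type u} {A : Type v} {K : Type w} [CommRing K] {d n : ℕ}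
  {Γ : InvQuiver I A} {lam : I → ℕ} {γ : I → K} {β : Set (Fin n → I)}

/-! ### Sums of the idempotents -/

open Classical in
/-- The sum of the idempotents `e(i)` for `i` in a set. -/
noncomputable def V.eSet (S : Set β) : V Γ lam γ β := ∑ᶠ i : β, if i ∈ S then V.e i else 0

namespace V

theorem eSet_mul_mem [Finite β] {S : Set β} {i : β} (h : i ∈ S) :
    (eSet S * V.e i : V Γ lam γ β) = V.e i := by
  have := Fintype.ofFinite β
  rw [eSet, finsum_eq_sum_of_fintype, Finset.sum_mul, Finset.sum_eq_single i]
  · rw [if_pos h, e_mul_self]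
  · intro j _ hj
    split_ifs
    · exact e_mul_ne hj
    · exact zero_mul _
  · intro h; exact absurd (Finset.mem_univ i) h

theorem eSet_mul_notMem [Finite β] {S : Set β} {i : β} (h : i ∉ S) :
    (eSet S * V.e i : V Γ lam γ β) = 0 := by
  have := Fintype.ofFinite β
  rw [eSet, finsum_eq_sum_of_fintype, Finset.sum_mul]
  refine Finset.sum_eq_zero fun j _ => ?_
  split_ifs with hj
  · exact e_mul_ne fun h' => h (h' ▸ hj)
  · exact zero_mul _

theorem e_mul_e_comm (i j : β) : (V.e i * V.e j : V Γ lam γ β) = V.e j * V.e i := by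
  by_cases h : i = j
  · rw [h]
  · rw [e_mul_ne h, e_mul_ne (Ne.symm h)]

theorem eSet_comm [Finite β] {x : V Γ lam γ β} {S : Set β} (h : ∀ i, x * V.e i = V.e i * x) :
    x * eSet S = eSet S * x := by
  have := Fintype.ofFinite β
  rw [eSet, finsum_eq_sum_of_fintype, Finset.sum_mul, Finset.mul_sum]
  refine Finset.sum_congr rfl fun i _ => ?_
  split_ifs
  · exact h i
  · simp

theorem e_mul_eSet [Finite β] (i : β) (S : Set β) :
    (V.e i * eSet S : V Γ lam γ β) = eSet S * V.e i := eSet_comm fun j => e_mul_e_comm i j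

theorem eSet_mul_eSet_comm [Finite β] (S S' : Set β) :
    (eSet S * eSet S' : V Γ lam γ β) = eSet S' * eSet S :=
  eSet_comm fun j => (e_mul_eSet j S).symm

theorem y_mul_eSet [Finite β] (a : ℕ) (S : Set β) :
    (V.y a * eSet S : V Γ lam γ β) = eSet S * V.y a := eSet_comm fun j => y_mul_e a j

theorem ext_eSet [Finite β] {x y : V Γ lam γ β} {S : Set β}
    (h : ∀ i ∈ S, x * V.e i = y * V.e i) : x * eSet S = y * eSet S := by
  refine ext_e fun i => ?_
  rw [mul_assoc, mul_assoc]
  by_cases hi : i ∈ S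
  · rw [eSet_mul_mem hi, h i hi]
  · rw [eSet_mul_notMem hi, mul_zero, mul_zero]

theorem eSet_mul_eSet_of_subset [Finite β] {S S' : Set β} (h : S ⊆ S') :
    (eSet S' * eSet S : V Γ lam γ β) = eSet S := by
  rw [← one_mul (eSet S), ← mul_assoc]
  exact ext_eSet fun i hi => by rw [mul_one, eSet_mul_mem (h hi), one_mul]

theorem psi_mul_eSet (hβ : Stable β Γ) {k : ℕ} (hk : k + 1 < n) {S S' : Set β}
    (h : ∀ i, i ∈ S ↔ hβ.sw i k hk ∈ S') :
    (V.psi (k + 1) * eSet S : V Γ lam γ β) = eSet S' * V.psi (k + 1) := by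
  have := hβ.finite
  refine ext_e fun i => ?_
  rw [mul_assoc, mul_assoc, V.psi_mul_e hk (i := i) (i' := hβ.sw i k hk) rfl, ← mul_assoc (eSet _)]
  by_cases hi : i ∈ S
  · rw [eSet_mul_mem hi, eSet_mul_mem ((h i).mp hi), V.psi_mul_e hk (i' := hβ.sw i k hk) rfl]
  · rw [eSet_mul_notMem hi, eSet_mul_notMem fun h' => hi ((h i).mpr h'), zero_mul, mul_zero]

theorem psi0_mul_eSet (hβ : Stable β Γ) (h0 : 0 < n) {S S' : Set β}
    (h : ∀ i, i ∈ S ↔ hβ.th i h0 ∈ S') :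
    (V.psi 0 * eSet S : V Γ lam γ β) = eSet S' * V.psi 0 := by
  have := hβ.finite
  refine ext_e fun i => ?_
  rw [mul_assoc, mul_assoc, V.psi0_mul_e h0 (i := i) (i' := hβ.th i h0) rfl, ← mul_assoc (eSet _)]
  by_cases hi : i ∈ S
  · rw [eSet_mul_mem hi, eSet_mul_mem ((h i).mp hi), V.psi0_mul_e h0 (i' := hβ.th i h0) rfl]
  · rw [eSet_mul_notMem hi, eSet_mul_notMem fun h' => hi ((h i).mpr h'), zero_mul, mul_zero]

theorem psi_y_swap (hβ : Stable β Γ) {k : ℕ} (hk : k + 1 < n) {i : β}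
    (h : i.1 ⟨k, by omega⟩ ≠ i.1 ⟨k + 1, hk⟩) {a : ℕ} (ha : a < n) :
    (V.psi (k + 1) * (V.y a * V.e i) : V Γ lam γ β) =
      V.y (Equiv.swap k (k + 1) a) * (V.psi (k + 1) * V.e i) := by
  have R := hβ.rep (lam := lam) (γ := γ) i
  by_cases h1 : a = k
  · subst h1
    rw [R.psi_y_left a hk, if_neg h, add_zero, Equiv.swap_apply_left]
  by_cases h2 : a = k + 1
  · subst h2
    rw [R.psi_y_right k hk, if_neg h, add_zero, Equiv.swap_apply_right]
  · rw [R.psi_y_far k a hk ha h1 h2, Equiv.swap_apply_of_ne_of_ne h1 h2]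

end V

/-! ### Matrix units -/

namespace Word

variable {m : Fin d → ℕ}

/-- The position of the `r`-th letter `j`. -/
noncomputable def posN (w : Word n m) (j : Fin d) (r : ℕ) : ℕ :=
  if h : r < m j then (w.pos j ⟨r, h⟩).1 else 0

theorem posN_spec (w : Word n m) {j : Fin d} {r : ℕ} (hr : r < m j) :
    ∃ h : w.posN j r < n, w.1 ⟨w.posN j r, h⟩ = j ∧ w.cnt j (w.posN j r) = r := by
  simp only [posN, dif_pos hr]
  exact ⟨(w.pos j ⟨r, hr⟩).2, w.apply_pos j _, w.cnt_pos j _⟩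

theorem posN_eq (w : Word n m) {j : Fin d} {r a : ℕ} {ha : a < n} (h : w.1 ⟨a, ha⟩ = j)
    (hr : w.cnt j a = r) : w.posN j r = a := by
  obtain ⟨h1, h2, h3⟩ := w.posN_spec (j := j) (r := r) (by rw [← hr]; exact w.cnt_lt h)
  exact w.cnt_inj h2 h (h3.trans hr.symm)

theorem posN_sw (w : Word n m) {k : ℕ} {hk : k + 1 < n}
    (h : w.1 ⟨k, by omega⟩ ≠ w.1 ⟨k + 1, hk⟩) {j : Fin d} {r : ℕ} (hr : r < m j) :
    (w.sw k hk).posN j r = Equiv.swap k (k + 1) (w.posN j r) := by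
  obtain ⟨h1, h2, h3⟩ := w.posN_spec hr
  exact posN_eq _ ((w.sw_apply_swap hk h1).trans h2) ((w.cnt_sw_swap h h2).trans h3)

/-- The letters number `r` and `r + 1` that are equal to `j` are adjacent. -/
def Adj (w : Word n m) (j : Fin d) (r : ℕ) : Prop :=
  ∃ k, ∃ hk : k + 1 < n, w.1 ⟨k, by omega⟩ = j ∧ w.1 ⟨k + 1, hk⟩ = j ∧ w.cnt j k = r

end Word

namespace Decomp

variable {p : I → Fin d} {m : Fin d → ℕ} (D : Decomp Γ p m β)

/-- The sum of the idempotents `e(i)` for the tuples with a given word. -/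
noncomputable def eW (lam : I → ℕ) (γ : I → K) (w : Word n m) : V Γ lam γ β :=
  V.eSet {i | D.word i = w}

variable {D}

theorem ext_eW {x y : V Γ lam γ β} {w : Word n m}
    (h : ∀ i, D.word i = w → x * V.e i = y * V.e i) : x * D.eW lam γ w = y * D.eW lam γ w :=
  have := D.finite
  V.ext_eSet h

theorem eW_mul_e (i : β) : D.eW lam γ (D.word i) * V.e i = V.e i :=
  have := D.finite
  V.eSet_mul_mem rfl

theorem eW_mul_e_ne {i : β} {w : Word n m} (h : D.word i ≠ w) : D.eW lam γ w * V.e i = 0 :=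
  have := D.finite
  V.eSet_mul_notMem h

theorem y_mul_eW (a : ℕ) (w : Word n m) : V.y a * D.eW lam γ w = D.eW lam γ w * V.y a :=
  have := D.finite
  V.y_mul_eSet a _

theorem psi_mul_eW {k : ℕ} (hk : k + 1 < n) (w : Word n m) :
    V.psi (k + 1) * D.eW lam γ w = D.eW lam γ (w.sw k hk) * V.psi (k + 1) :=
  V.psi_mul_eSet D.toStable hk fun i =>
    ⟨fun h => congrArg (fun w : Word n m => w.sw k hk) h, fun h => by
      have := congrArg (fun w : Word n m => w.sw k hk) h
      simpa [D.word_sw] using this⟩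

theorem psi0_mul_eW (w : Word n m) :
    V.psi 0 * D.eW lam γ w = D.eW lam γ w * V.psi 0 := by
  by_cases h0 : 0 < n
  · refine V.psi0_mul_eSet D.toStable h0 fun i => ?_
    rw [Set.mem_ofPred_eq, Set.mem_ofPred_eq, D.word_th]
  · simp [V.psi, h0]

theorem sum_eW : ∑ w, D.eW lam γ w = 1 := by
  have := D.finite
  refine V.ext_e fun i => ?_
  rw [Finset.sum_mul, one_mul, Finset.sum_eq_single (D.word i)]
  · exact eW_mul_e i
  · intro w _ hw; exact eW_mul_e_ne hw.symm
  · intro h; exact absurd (Finset.mem_univ _) h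

/-- Both special relations come from entries in different parts: there `Q = 1`, and outer entries in
different parts are distinct, which is the case of the braid relation without correction. -/
theorem shuffle (D : Decomp Γ p m β) (lam : I → ℕ) (γ : I → K) :
    Shuffle (D.eW lam γ) fun k => V.psi (k + 1) where
  e_self w := by
    have := D.finite
    exact V.eSet_mul_eSet_of_subset subset_rfl
  e_ne w v h := by
    rw [← zero_mul (D.eW lam γ v)]
    exact ext_eW fun i hi => by rw [eW_mul_e_ne (hi.trans_ne h.symm), zero_mul]
  s_e k hk w := psi_mul_eW hk w
  s_sq k hk w h := by
    rw [← mul_assoc, ← one_mul (D.eW lam γ w), ← mul_assoc]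
    refine ext_eW fun i hi => ?_
    subst hi
    rw [mul_one, mul_assoc, (D.rep i).psi_sq k hk, Q_eq_one D.arrows_part h]
  s_comm k l hl hkl := V.psi_mul_psi hkl
  braid k hk w h := by
    simp only [← mul_assoc]
    refine ext_eW fun i hi => ?_
    subst hi
    simp only [mul_assoc]
    exact (D.rep i).braid_ne k hk fun h' => h (congrArg p h')

section

variable {M : Word n m → Word n m → V Γ lam γ β}
  (U : MatUnits (D.eW lam γ) (fun k => V.psi (k + 1)) M)
include U

/-- An exchange of different letters carries `y` along with its position, and the `r`-th letter `j`
remains the `r`-th letter `j`. -/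
theorem y_comm_matUnits {j : Fin d} {r : ℕ} (hr : r < m j) (w w' : Word n m) :
    M w' w * V.y (w.posN j r) = V.y (w'.posN j r) * M w' w := by
  refine U.intertwine 1 (fun w => V.y (w.posN j r)) (fun _ => True)
    (fun w _ => y_mul_eW _ _) (fun w _ hw => ?_) trivial trivial
  obtain ⟨k, hk, h⟩ := Word.exists_descent hw
  refine ⟨w.sw k hk, trivial, Word.key_sw_lt h, ?_⟩
  rw [U.sw_eq k hk w h.ne', mul_assoc, ← y_mul_eW, w.posN_sw h.ne' hr, ← mul_assoc, ← mul_assoc]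
  refine ext_eW fun i hi => ?_
  subst hi
  obtain ⟨h1, -, -⟩ := (D.word i).posN_spec hr
  rw [mul_assoc, mul_assoc, V.psi_y_swap D.toStable hk (fun h' => h.ne' (congrArg p h')) h1]

/-- Exchanging entries of different parts leaves all subtuples unchanged, so only the word in the
idempotent moves. -/
theorem eSet_comm_matUnits (j : Fin d) (x : subtuples p β j (m j)) (w w' : Word n m) :
    M w' w * V.eSet {i | D.word i = w ∧ D.sub i j = x} =
      V.eSet {i | D.word i = w' ∧ D.sub i j = x} * M w' w := by
  have := D.finite
  refine U.intertwine 1 (fun w => V.eSet {i | D.word i = w ∧ D.sub i j = x}) (fun _ => True)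
    (fun w _ => V.eSet_mul_eSet_comm _ _) (fun w _ hw => ?_) trivial trivial
  obtain ⟨k, hk, h⟩ := Word.exists_descent hw
  refine ⟨w.sw k hk, trivial, Word.key_sw_lt h, ?_⟩
  rw [U.sw_eq k hk w h.ne', mul_assoc, eW, V.eSet_mul_eSet_comm, ← mul_assoc, ← mul_assoc]
  refine ext_eW fun i hi => ?_
  subst hi
  rw [mul_assoc, mul_assoc, V.psi_mul_e hk (i' := D.sw i k hk) rfl,
    ← mul_assoc (V.eSet _) (V.e _)]
  have hs := D.sub_sw_ne (i := i) (k := k) (hk := hk) (fun h' => h.ne' h') j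
  by_cases hx : D.sub i j = x
  · rw [V.eSet_mul_mem, V.eSet_mul_mem, V.psi_mul_e hk (i' := D.sw i k hk) rfl]
    · exact ⟨rfl, hs.trans hx⟩
    · exact ⟨rfl, hx⟩
  · rw [V.eSet_mul_notMem, V.eSet_mul_notMem, mul_zero, zero_mul]
    · exact fun h' => hx (hs.symm.trans h'.2)
    · exact fun h' => hx h'.2

/-- The words are sorted in the order that puts `j` first. A word beginning with `j` then has no
descent at its first position, so only `ψ_k` with `k ≥ 2` are used, and these commute with `ψ_0`. -/
theorem psi0_comm_matUnits {j : Fin d} {h0 : 0 < n} {w w' : Word n m} (hw : w.1 ⟨0, h0⟩ = j)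
    (hw' : w'.1 ⟨0, h0⟩ = j) : M w' w * V.psi 0 = V.psi 0 * M w' w := by
  refine U.intertwine (Word.first j) (fun _ => V.psi 0) (fun w => w.1 ⟨0, h0⟩ = j)
    (fun w _ => psi0_mul_eW _) (fun w hw hm => ?_) hw hw'
  obtain ⟨k, hk, h⟩ := Word.exists_descent hm
  obtain ⟨k, rfl⟩ : ∃ l, k = l + 1 := by
    refine ⟨k - 1, ?_⟩
    rcases Nat.eq_zero_or_pos k with rfl | hk0
    · rw [hw, Fin.lt_def, Word.first_self] at h
      exact absurd h (Nat.not_lt_zero _)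
    · omega
  refine ⟨w.sw (k + 1) hk, ?_, Word.key_sw_lt h, ?_⟩
  · rw [Word.sw_apply, if_neg (by omega), if_neg (by omega), hw]
  · rw [U.sw_eq (k + 1) hk w fun h' => h.ne' (congrArg _ h'), mul_assoc, ← psi0_mul_eW, ← mul_assoc,
      ← V.psi0_mul_psi,
      mul_assoc]

/-- A descent that does not touch the two adjacent letters `j` gives an exchange commuting with
their `ψ`. If it touches them, a single exchange would separate the pair; instead the neighbouring
letter is moved past both of them by two exchanges, each at a descent. The braid relation then
carries `ψ` to the new position, without correction since the outer entries lie in different parts.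
-/
theorem psi_comm_matUnits_step {j : Fin d} {r : ℕ} {w : Word n m} (hw : w.Adj j r)
    (hm : ¬ Monotone ((1 : Equiv.Perm (Fin d)) ∘ w.1)) :
    ∃ v : Word n m, v.Adj j r ∧ v.key 1 < w.key 1 ∧
      M v w * V.psi (w.posN j r + 1) = V.psi (v.posN j r + 1) * M v w := by
  obtain ⟨k, hk, h1, h2, hr⟩ := hw
  have hc : V.psi (k + 1) * D.eW lam γ w = D.eW lam γ w * V.psi (k + 1) := by
    rw [psi_mul_eW hk, Word.sw_eq_self (h1.trans h2.symm)]
  rw [w.posN_eq h1 hr]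
  obtain ⟨l, hl, h⟩ := Word.exists_descent hm
  have h' : w.1 ⟨l + 1, hl⟩ < w.1 ⟨l, by omega⟩ := h
  rcases Nat.lt_trichotomy l k with hlk | rfl | hlk
  · rcases Nat.lt_or_ge (l + 1) k with hlk' | hlk'
    · have e1 : (w.sw l hl).1 ⟨k, by omega⟩ = j := by
        rw [Word.sw_apply, if_neg (by omega), if_neg (by omega), h1]
      have e2 : (w.sw l hl).1 ⟨k + 1, hk⟩ = j := by
        rw [Word.sw_apply, if_neg (by omega), if_neg (by omega), h2]
      have e3 : (w.sw l hl).cnt j k = r := by rw [Word.cnt_sw _ (by omega) (by omega), hr]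
      refine ⟨w.sw l hl, ⟨k, hk, e1, e2, e3⟩, Word.key_sw_lt h, ?_⟩
      rw [Word.posN_eq _ e1 e3, U.sw_eq l hl w h'.ne', mul_assoc, ← hc, ← mul_assoc,
        V.psi_mul_psi hlk', mul_assoc]
    · obtain rfl : k = l + 1 := by omega
      have n1 : ¬ l + 1 + 1 = l := by omega
      have n2 : ¬ l = l + 1 + 1 := by omega
      have hj : w.1 ⟨l, by omega⟩ ≠ j := fun h3 => h'.ne (h1.trans h3.symm)
      have d2 : (w.sw l hl).1 ⟨l + 1 + 1, hk⟩ < (w.sw l hl).1 ⟨l + 1, hl⟩ := by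
        simpa [Word.sw_apply, n1, h2, ← h1] using h'
      have e1 : ((w.sw l hl).sw (l + 1) hk).1 ⟨l, by omega⟩ = j := by
        simp [Word.sw_apply, n2, h1]
      have e2 : ((w.sw l hl).sw (l + 1) hk).1 ⟨l + 1, by omega⟩ = j := by
        simp [Word.sw_apply, n1, h2]
      have e3 : ((w.sw l hl).sw (l + 1) hk).cnt j l = r := by
        rw [Word.cnt_sw _ (by omega) (by omega), Word.cnt_sw _ (by omega) (by omega), ← hr,
          Word.cnt_succ_ne _ hj]
      refine ⟨(w.sw l hl).sw (l + 1) hk, ⟨l, hl, e1, e2, e3⟩,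
        (Word.key_sw_lt (π := 1) (w := w.sw l hl) (k := l + 1) (hk := hk) d2).trans
          (Word.key_sw_lt h), ?_⟩
      rw [Word.posN_eq _ e1 e3, ← U.s_mul (l + 1) hk _ _ d2.ne', U.sw_eq l hl w h'.ne',
        mul_assoc, mul_assoc, ← hc, ← mul_assoc, ← mul_assoc, ← mul_assoc, ← mul_assoc]
      refine ext_eW fun i hi => ?_
      subst hi
      simp only [mul_assoc]
      exact (D.rep i).braid_ne l hk fun h3 => h'.ne (h1.trans (h2.symm.trans (congrArg p h3).symm))
  · exact absurd (h2.trans h1.symm) h'.ne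
  · rcases Nat.lt_or_ge (k + 1) l with hlk' | hlk'
    · have e1 : (w.sw l hl).1 ⟨k, by omega⟩ = j := by
        rw [Word.sw_apply, if_neg (by omega), if_neg (by omega), h1]
      have e2 : (w.sw l hl).1 ⟨k + 1, hk⟩ = j := by
        rw [Word.sw_apply, if_neg (by omega), if_neg (by omega), h2]
      have e3 : (w.sw l hl).cnt j k = r := by rw [Word.cnt_sw _ (by omega) (by omega), hr]
      refine ⟨w.sw l hl, ⟨k, hk, e1, e2, e3⟩, Word.key_sw_lt h, ?_⟩
      rw [Word.posN_eq _ e1 e3, U.sw_eq l hl w h'.ne', mul_assoc, ← hc, ← mul_assoc,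
        ← V.psi_mul_psi hlk', mul_assoc]
    · obtain rfl : l = k + 1 := by omega
      have n1 : ¬ k + 1 + 1 = k := by omega
      have n2 : ¬ k = k + 1 + 1 := by omega
      have hj : w.1 ⟨k + 1 + 1, hl⟩ ≠ j := fun h3 => h'.ne (h3.trans h2.symm)
      have d2 : (w.sw (k + 1) hl).1 ⟨k + 1, hk⟩ < (w.sw (k + 1) hl).1 ⟨k, by omega⟩ := by
        simpa [Word.sw_apply, n2, h1, ← h2] using h'
      have e1 : ((w.sw (k + 1) hl).sw k hk).1 ⟨k + 1, by omega⟩ = j := by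
        simp [Word.sw_apply, n2, h1]
      have e2 : ((w.sw (k + 1) hl).sw k hk).1 ⟨k + 1 + 1, by omega⟩ = j := by
        simp [Word.sw_apply, n1, h2]
      have e3 : ((w.sw (k + 1) hl).sw k hk).cnt j (k + 1) = r := by
        rw [Word.cnt_sw_left, Word.cnt_sw _ (by omega) (by omega), hr]
        simpa [Word.sw_apply] using hj
      refine ⟨(w.sw (k + 1) hl).sw k hk, ⟨k + 1, hl, e1, e2, e3⟩,
        (Word.key_sw_lt (π := 1) (w := w.sw (k + 1) hl) (k := k) (hk := hk) d2).trans
          (Word.key_sw_lt h), ?_⟩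
      rw [Word.posN_eq _ e1 e3, ← U.s_mul k hk _ _ d2.ne', U.sw_eq (k + 1) hl w h'.ne',
        mul_assoc, mul_assoc, ← hc, ← mul_assoc, ← mul_assoc, ← mul_assoc, ← mul_assoc]
      refine ext_eW fun i hi => ?_
      subst hi
      simp only [mul_assoc]
      exact ((D.rep i).braid_ne k hl fun h3 => hj ((congrArg p h3).symm.trans h1)).symm

theorem psi_comm_matUnits {j : Fin d} {r : ℕ} {w w' : Word n m} (hw : w.Adj j r)
    (hw' : w'.Adj j r) :
    M w' w * V.psi (w.posN j r + 1) = V.psi (w'.posN j r + 1) * M w' w := by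
  refine U.intertwine 1 (fun w => V.psi (w.posN j r + 1)) (fun w => w.Adj j r) ?_
    (fun w hw hm => psi_comm_matUnits_step U hw hm) hw hw'
  rintro w ⟨k, hk, h1, h2, hr⟩
  rw [w.posN_eq h1 hr, psi_mul_eW hk, Word.sw_eq_self (h1.trans h2.symm)]

end

end Decomp

end FromParts

/-! ### The homomorphisms from the algebras of the parts -/

section FromPart

variable {I : Type u} {A : Type v} {K : Type w} [CommRing K] {d n : ℕ}
  {Γ : InvQuiver I A} {lam : I → ℕ} {γ : I → K} {β : Set (Fin n → I)}
  {p : I → Fin d} {m : Fin d → ℕ} {D : Decomp Γ p m β}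

namespace Decomp

/-- The word that begins with all the letters `j` and is sorted otherwise. -/
noncomputable def sorted (D : Decomp Γ p m β) (j : Fin d) : Word n m :=
  (Word.exists_monotone (Word.first j) (D.word ⟨_, D.nonempty.some_mem⟩)).choose

theorem sorted_mono (D : Decomp Γ p m β) (j : Fin d) :
    Monotone (Word.first j ∘ (D.sorted j).1) :=
  (Word.exists_monotone (Word.first j) (D.word ⟨_, D.nonempty.some_mem⟩)).choose_spec

theorem sorted_apply (D : Decomp Γ p m β) {j : Fin d} {a : ℕ} (ha : a < m j) :
    ∃ h : a < n, (D.sorted j).1 ⟨a, h⟩ = j :=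
  Word.apply_of_sorted (D.sorted_mono j) (Word.first_self j) ha

theorem sorted_cnt (D : Decomp Γ p m β) {j : Fin d} {a : ℕ} (ha : a ≤ m j) :
    (D.sorted j).cnt j a = a :=
  Word.cnt_of_sorted (D.sorted_mono j) (Word.first_self j) ha

theorem sorted_adj (D : Decomp Γ p m β) (j : Fin d) {l : Fin d} {r : ℕ} (hr : r + 1 < m l) :
    (D.sorted j).Adj l r :=
  Word.adjacent_of_sorted (D.sorted_mono j) hr

theorem sorted_posN (D : Decomp Γ p m β) {j : Fin d} {r : ℕ} (hr : r < m j) :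
    (D.sorted j).posN j r = r := by
  obtain ⟨h, h'⟩ := D.sorted_apply hr
  exact Word.posN_eq _ h' (D.sorted_cnt hr.le)

theorem psi_mul_eW_sorted (j : Fin d) {r : ℕ} (hr : r < m j) :
    V.psi r * D.eW lam γ (D.sorted j) = D.eW lam γ (D.sorted j) * V.psi r := by
  cases r with
  | zero => exact psi0_mul_eW _
  | succ r =>
    obtain ⟨h1, h2⟩ := D.sorted_apply (show r < m j by omega)
    obtain ⟨h3, h4⟩ := D.sorted_apply hr
    rw [psi_mul_eW h3, Word.sw_eq_self (h2.trans h4.symm)]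

/-- The elements `y_{r+1}`, `ψ_r` and the sums of the `e(i)` that satisfy the relations of the
part `j` in the corner of the sorted word. -/
theorem rep_sorted {j : Fin d} {i : β} (hi : D.word i = D.sorted j) {P : ℕ → V Γ lam γ β}
    (hP : ∀ r < m j, P r = V.psi r) :
    RepAt (Γ.full (part p j) (part_stable D.θ_part j)) (fun x => lam x) (fun x => γ x)
      (V.y : ℕ → V Γ lam γ β) P
      (fun x => V.eSet {i | D.word i = D.sorted j ∧ D.sub i j = x}) (D.sub i j) (V.e i) := by
  have := D.finite
  have hn : ∀ r < m j, r < n := fun r hr => (D.sorted_apply hr).1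
  have hc : ∀ r (hr : r < m j), p (i.1 ⟨r, hn r hr⟩) = j := fun r hr => by
    have h := (D.sorted_apply hr).2
    rw [← hi] at h
    exact h
  -- The letters `j` come first, so rank and position coincide; hence `y_{r+1}` and `ψ_r` of the
  -- part, including `ψ_0`, are those of the whole algebra.
  have hcnt : ∀ r ≤ m j, (D.word i).cnt j r = r := fun r hr => by rw [hi, D.sorted_cnt hr]
  have hs : ∀ r (hr : r < m j), (D.sub i j).1 ⟨r, hr⟩ = ⟨i.1 ⟨r, hn r hr⟩, hc r hr⟩ :=
    fun r hr => sub_apply (hc r hr) (hcnt r hr.le)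
  have heq : ∀ r s (hr : r < m j) (hs : s < m j), (D.sub i j).1 ⟨r, hr⟩ = (D.sub i j).1 ⟨s, hs⟩ ↔
      i.1 ⟨r, hn r hr⟩ = i.1 ⟨s, hn s hs⟩ := fun r s hr hs =>
    sub_eq_iff (hc r hr) (hc s hs) (hcnt r hr.le) (hcnt s hs.le)
  have hw : ∀ k (hk : k + 1 < m j), p (i.1 ⟨k, hn k (by omega)⟩) = p (i.1 ⟨k + 1, hn _ hk⟩) :=
    fun k hk => (hc k (by omega)).trans (hc _ hk).symm
  have hsw : ∀ k (hk : k + 1 < m j), (D.sub (D.sw i k (hn _ hk)) j).1 =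
      (D.sub i j).1 ∘ Equiv.swap ⟨k, by omega⟩ ⟨k + 1, hk⟩ := fun k hk =>
    D.sub_sw_self (hc k (by omega)) (hc _ hk) (hcnt k (by omega)) hk
  have R := D.rep (lam := lam) (γ := γ) i
  constructor
  · exact V.eSet_mul_mem ⟨hi, rfl⟩
  · exact fun x hx => V.eSet_mul_notMem fun h => hx h.2.symm
  · exact fun a b ha hb => R.y_y a b (hn a ha) (hn b hb)
  · intro a ha
    rw [V.y_mul_e, ← mul_assoc, V.eSet_mul_mem]
    exact ⟨hi, rfl⟩
  · intro a ha x hx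
    rw [V.y_mul_e, ← mul_assoc, V.eSet_mul_notMem fun h => hx h.2.symm, zero_mul]
  · intro k hk x hx
    rw [hP _ hk, V.psi_mul_e (hn _ hk) (i' := D.sw i k (hn _ hk)) rfl, ← mul_assoc,
      V.eSet_mul_mem]
    exact ⟨(D.word_sw_eq (hw k hk)).trans hi, Subtype.ext ((hsw k hk).trans hx.symm)⟩
  · intro k hk x hx
    rw [hP _ hk, V.psi_mul_e (hn _ hk) (i' := D.sw i k (hn _ hk)) rfl, ← mul_assoc,
      V.eSet_mul_notMem, zero_mul]
    exact fun h => hx ((congrArg Subtype.val h.2).symm.trans (hsw k hk))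
  · intro k hk
    rw [hP _ hk, R.psi_y_left k (hn _ hk)]
    have h := heq k (k + 1) (by omega) hk
    split_ifs with h1 h2 h2
    · rfl
    · exact absurd (h.mpr h1) h2
    · exact absurd (h.mp h2) h1
    · rfl
  · intro k hk
    rw [hP _ hk, R.psi_y_right k (hn _ hk)]
    have h := heq k (k + 1) (by omega) hk
    split_ifs with h1 h2 h2
    · rfl
    · exact absurd (h.mpr h1) h2
    · exact absurd (h.mp h2) h1
    · rfl
  · intro k a hk ha h1 h2
    rw [hP _ hk]
    exact R.psi_y_far k a (hn _ hk) (hn _ ha) h1 h2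
  · intro k l hl hkl
    rw [hP _ hl, hP (k + 1) (by omega)]
    exact R.psi_psi k l (hn _ hl) hkl
  · intro k hk
    rw [hP _ hk, R.psi_sq k (hn _ hk), full_Q D.θ_part, hs, hs]
  · intro k hk h
    rw [hP _ hk, hP (k + 1) (by omega), R.braid_eq k (hn _ hk) ((heq _ _ _ _).mp h),
      full_divQ D.θ_part, hs, hs]
  · intro k hk h
    rw [hP _ hk, hP (k + 1) (by omega), R.braid_ne k (hn _ hk) fun h' => h ((heq _ _ _ _).mpr h')]
  · intro h x hx
    rw [hP 0 h, V.psi0_mul_e (hn 0 h) (i' := D.th i (hn 0 h)) rfl, ← mul_assoc, V.eSet_mul_mem]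
    exact ⟨(D.word_th i _).trans hi,
      Subtype.ext ((D.sub_th_self (hc 0 h) h D.θ_part).trans hx.symm)⟩
  · intro h x hx
    rw [hP 0 h, V.psi0_mul_e (hn 0 h) (i' := D.th i (hn 0 h)) rfl, ← mul_assoc,
      V.eSet_mul_notMem, zero_mul]
    exact fun h' => hx ((congrArg Subtype.val h'.2).symm.trans
      (D.sub_th_self (hc 0 h) h D.θ_part))
  · intro k hk
    rw [hP 0 (by omega), hP _ hk]
    exact R.psi0_psi k (hn _ hk)
  · intro h
    rw [hP 0 h, R.psi0_y0 (hn 0 h), hs]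
  · intro a ha
    rw [hP 0 (by omega)]
    exact R.psi0_y a (hn _ ha)
  · intro h h0
    rw [hs] at h0
    rw [hP 0 h, R.psi0_sq_eq (hn 0 h) h0, hs]
    rfl
  · intro h h0
    rw [hs] at h0
    rw [hP 0 h, R.psi0_sq_ne (hn 0 h) h0]
  · intro h h1 h2
    rw [hs] at h1
    rw [hs, hs] at h2
    rw [hP 0 (by omega), hP 1 h, R.braid4_opp (hn 1 h) h1 (congrArg Subtype.val h2), hs]
    rfl
  · intro h h1 h2
    rw [hs] at h1
    rw [hs, hs] at h2
    rw [hP 0 (by omega), hP 1 h, R.braid4_zero (hn 1 h) h1 fun h' => h2 (Subtype.ext h'),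
      full_oddQ D.θ_part, hs, hs]
  · intro h h1
    rw [hs] at h1
    rw [hP 0 (by omega), hP 1 h, R.braid4_ne (hn 1 h) h1, full_oddQ₂ D.θ_part, hs, hs]

section

variable (D lam γ)

/-- The element `y_{r+1}` in the centralizer of the idempotent of the sorted word. -/
noncomputable def cornerY (j : Fin d) (r : ℕ) :
    Subalgebra.centralizer K {D.eW lam γ (D.sorted j)} :=
  ⟨V.y r, by
    rw [Subalgebra.mem_centralizer_iff]
    rintro _ rfl
    exact (y_mul_eW _ _).symm⟩

/-- The element `ψ_r` in the centralizer of the idempotent of the sorted word. -/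
noncomputable def cornerPsi (j : Fin d) (r : ℕ) :
    Subalgebra.centralizer K {D.eW lam γ (D.sorted j)} :=
  if hr : r < m j then ⟨V.psi r, by
    rw [Subalgebra.mem_centralizer_iff]
    rintro _ rfl
    exact (psi_mul_eW_sorted j hr).symm⟩ else 0

/-- The sum of the `e(i)` with a given subtuple in the part `j`, in the centralizer of the
idempotent of the sorted word. -/
noncomputable def cornerE (j : Fin d) (x : subtuples p β j (m j)) :
    Subalgebra.centralizer K {D.eW lam γ (D.sorted j)} :=
  ⟨V.eSet {i | D.word i = D.sorted j ∧ D.sub i j = x}, by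
    have := D.finite
    rw [Subalgebra.mem_centralizer_iff]
    rintro _ rfl
    exact V.eSet_mul_eSet_comm _ _⟩

end

variable {M : Word n m → Word n m → V Γ lam γ β}
  (U : MatUnits (D.eW lam γ) (fun k => V.psi (k + 1)) M)

/-- The homomorphism from the algebra of a part. -/
noncomputable def fromPart (j : Fin d) : VP Γ lam γ D.θ_part β m j →ₐ[K] V Γ lam γ β :=
  haveI := (D.stable_sub D.θ_part j).finite
  V.lift (fun s : Word n m × {i : β // D.word i = D.sorted j} => D.sub s.2 j)
    (fun s => M s.1 (D.sorted j) * V.e s.2.1)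
    (Y := fun r => U.spread sum_eW (D.sorted j) (D.cornerY lam γ j r))
    (P := fun r => U.spread sum_eW (D.sorted j) (D.cornerPsi lam γ j r))
    (E := fun x => U.spread sum_eW (D.sorted j) (D.cornerE lam γ j x))
    (fun s => by
      refine RepAt.transfer (Subalgebra.val _) (U.spread (K := K) sum_eW (D.sorted j)) ?_
        (rep_sorted s.2.2 (P := fun r => Subalgebra.val _ (D.cornerPsi lam γ j r)) fun r hr => ?_)
      · intro a b hab
        -- The spread of `x` acts on a test vector by applying `x` in the sorted corner and then the
        -- matrix unit, so equations in that corner carry over to the whole algebra.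
        have h : ∀ x : Subalgebra.centralizer K {D.eW lam γ (D.sorted j)},
            U.spread sum_eW (D.sorted j) x * (M s.1 (D.sorted j) * V.e s.2.1) =
              M s.1 (D.sorted j) * (x.1 * V.e s.2.1) := fun x => by
          have h1 := eW_mul_e (D := D) (lam := lam) (γ := γ) s.2.1
          rw [s.2.2] at h1
          rw [← mul_assoc, U.spread_mul, U.diag, mul_assoc, h1, mul_assoc]
        rw [h, h]
        exact congrArg _ hab
      · simp only [cornerPsi, dif_pos hr]
        rfl)
    (fun b b' h => by
      -- The test vectors separate: summing over `i` recovers the matrix units out of the sorted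
      -- word, and every `e(w)` factors through such a unit.
      have h1 : ∀ w, b * M w (D.sorted j) = b' * M w (D.sorted j) := fun w => by
        rw [← U.mul_e, ← mul_assoc, ← mul_assoc]
        refine ext_eW fun i hi => ?_
        rw [mul_assoc, mul_assoc]
        exact h (w, ⟨i, hi⟩)
      rw [← mul_one b, ← mul_one b', ← sum_eW (D := D), Finset.mul_sum, Finset.mul_sum]
      refine Finset.sum_congr rfl fun w _ => ?_
      rw [← U.diag, ← U.mul w (D.sorted j) w, ← mul_assoc, h1, mul_assoc])

theorem fromPart_gen (j : Fin d) (g) : fromPart U j (V.gen _ _ _ _ g) =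
    genImage (fun r => U.spread sum_eW (D.sorted j) (D.cornerY lam γ j r))
      (fun r => U.spread sum_eW (D.sorted j) (D.cornerPsi lam γ j r))
      (fun x => U.spread sum_eW (D.sorted j) (D.cornerE lam γ j x)) g := by
  have := (D.stable_sub D.θ_part j).finite
  unfold fromPart
  rw [V.lift_gen]

theorem fromPart_comm_matUnits (j : Fin d) (x) (w v : Word n m) :
    fromPart U j x * M w v = M w v * fromPart U j x := by
  have h : ∀ x, fromPart U j x ∈ Subalgebra.centralizer K {M w v} := fun x =>
    V.mem_of_gen_mem ((Subalgebra.centralizer K {M w v}).comap (fromPart U j)) (fun g => by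
      rw [Subalgebra.mem_comap, Subalgebra.mem_centralizer_iff, fromPart_gen]
      rintro _ rfl
      cases g <;> exact (U.mul_spread sum_eW _ _ _ _).trans (U.spread_mul sum_eW _ _ _ _).symm) x
  exact ((Subalgebra.mem_centralizer_iff K).mp (h x) _ rfl).symm

/-- If `x` is carried to `y` along the matrix unit from the sorted word to `w`, then `y` is the
value of the spread on the component of `w`. This turns the intertwining lemmas into formulas for
`fromPart` on every component. -/
theorem spread_mul_eW {j : Fin d} {w : Word n m}
    (x : Subalgebra.centralizer K {D.eW lam γ (D.sorted j)}) {y : V Γ lam γ β}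
    (h : M w (D.sorted j) * x = y * M w (D.sorted j)) :
    U.spread sum_eW (D.sorted j) x * D.eW lam γ w = y * D.eW lam γ w := by
  rw [← U.diag w, U.spread_mul, h, mul_assoc, U.mul]

theorem fromPart_y {j : Fin d} {w : Word n m} {r a : ℕ} {ha : a < n} (h : w.1 ⟨a, ha⟩ = j)
    (hr : w.cnt j a = r) : fromPart U j (V.y r) * D.eW lam γ w = V.y a * D.eW lam γ w := by
  have hm : r < m j := by rw [← hr]; exact w.cnt_lt h
  rw [V.y_of_lt hm, fromPart_gen]
  refine spread_mul_eW U _ ?_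
  have := y_comm_matUnits U hm (D.sorted j) w
  rwa [D.sorted_posN hm, w.posN_eq h hr] at this

theorem fromPart_e (j : Fin d) (x) (w : Word n m) :
    fromPart U j (V.e x) * D.eW lam γ w = V.eSet {i | D.word i = w ∧ D.sub i j = x} := by
  have := D.finite
  refine (congrArg (· * D.eW lam γ w) (fromPart_gen U j (.e x))).trans ?_
  refine (spread_mul_eW U _ (eSet_comm_matUnits U j x _ w)).trans ?_
  rw [eW, V.eSet_mul_eSet_comm, V.eSet_mul_eSet_of_subset fun i hi => hi.1]

theorem fromPart_psi {j : Fin d} {w : Word n m} {r k : ℕ} {hk : k + 1 < n}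
    (h : w.1 ⟨k, by omega⟩ = j) (h' : w.1 ⟨k + 1, hk⟩ = j) (hr : w.cnt j k = r) :
    fromPart U j (V.psi (r + 1)) * D.eW lam γ w = V.psi (k + 1) * D.eW lam γ w := by
  have hm : r + 1 < m j := by rw [← hr, ← w.cnt_succ_self h]; exact w.cnt_lt h'
  rw [V.psi_of_lt hm, fromPart_gen]
  refine spread_mul_eW U _ ?_
  have := psi_comm_matUnits U (D.sorted_adj j hm) ⟨k, hk, h, h', hr⟩
  rw [D.sorted_posN (by omega), w.posN_eq h hr] at this
  simpa only [cornerPsi, dif_pos hm] using this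

theorem fromPart_psi0 {j : Fin d} {w : Word n m} {h0 : 0 < n} (h : w.1 ⟨0, h0⟩ = j) :
    fromPart U j (V.psi 0) * D.eW lam γ w = V.psi 0 * D.eW lam γ w := by
  have hm : 0 < m j := by rw [← w.cnt_zero j]; exact w.cnt_lt h
  rw [V.psi_of_lt hm, fromPart_gen]
  refine spread_mul_eW U _ ?_
  have := psi0_comm_matUnits U (D.sorted_apply hm).2 h
  simpa only [cornerPsi, dif_pos hm] using this

end Decomp

end FromPart

/-! ### The images of different parts commute -/

section Commute

variable {I : Type u} {A : Type v} {K : Type w} [CommRing K] {d n : ℕ}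
  {Γ : InvQuiver I A} {lam : I → ℕ} {γ : I → K} {β : Set (Fin n → I)}
  {p : I → Fin d} {m : Fin d → ℕ} {D : Decomp Γ p m β}
  {M : Word n m → Word n m → V Γ lam γ β}
  (U : MatUnits (D.eW lam γ) (fun k => V.psi (k + 1)) M)

namespace Decomp

include U in
-- Elements that commute with the matrix units have conjugate components on all words, so
-- commutation may be tested on one word, chosen to suit the two elements.
theorem comm_of_eW {a b : V Γ lam γ β} (ha : ∀ w v, a * M w v = M w v * a)
    (hb : ∀ w v, b * M w v = M w v * b) (w : Word n m)
    (h : a * (b * D.eW lam γ w) = b * (a * D.eW lam γ w)) : a * b = b * a := by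
  rw [← mul_one (a * b), ← mul_one (b * a), ← sum_eW (D := D), Finset.mul_sum, Finset.mul_sum]
  refine Finset.sum_congr rfl fun v _ => ?_
  have h1 : ∀ {a b : V Γ lam γ β}, (∀ w v, a * M w v = M w v * a) →
      (∀ w v, b * M w v = M w v * b) →
      a * b * D.eW lam γ v = M v w * (a * (b * D.eW lam γ w)) * M w v := fun {a b} ha hb => by
    rw [← U.diag v, ← U.mul v w v, mul_assoc a, ← mul_assoc b, hb, mul_assoc, ← mul_assoc a, ha]
    simp only [mul_assoc, U.e_mul]
  rw [h1 ha hb, h1 hb ha, h]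

/-- The element `a` is given by `x` on the component of the word `w`. -/
def IsLocal (D : Decomp Γ p m β) (a x : V Γ lam γ β) (w : Word n m) : Prop :=
  a * D.eW lam γ w = x * D.eW lam γ w ∧ x * D.eW lam γ w = D.eW lam γ w * x

theorem IsLocal.mul {a b x y : V Γ lam γ β} {w : Word n m} (ha : D.IsLocal a x w)
    (hb : D.IsLocal b y w) : D.IsLocal (a * b) (x * y) w := by
  constructor
  · rw [mul_assoc, hb.1, hb.2, ← mul_assoc, ha.1, mul_assoc, ← hb.2, mul_assoc]
  · rw [mul_assoc, hb.2, ← mul_assoc, ha.2, mul_assoc]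

theorem fromPart_comm_of_local {j l : Fin d} {g g'} {x y : V Γ lam γ β} {w : Word n m}
    (ha : D.IsLocal (fromPart U j g) x w) (hb : D.IsLocal (fromPart U l g') y w)
    (h : x * (y * D.eW lam γ w) = y * (x * D.eW lam γ w)) :
    fromPart U j g * fromPart U l g' = fromPart U l g' * fromPart U j g := by
  refine comm_of_eW U (fromPart_comm_matUnits U j g) (fromPart_comm_matUnits U l g') w ?_
  rw [← mul_assoc, ← mul_assoc, (ha.mul hb).1, (hb.mul ha).1, mul_assoc, h, mul_assoc]

theorem isLocal_y {j : Fin d} {r : ℕ} (hr : r < m j) (w : Word n m) :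
    D.IsLocal (fromPart U j (V.y r)) (V.y (w.posN j r)) w := by
  obtain ⟨h1, h2, h3⟩ := w.posN_spec hr
  exact ⟨fromPart_y U h2 h3, y_mul_eW _ _⟩

theorem isLocal_e (j : Fin d) (x) (w : Word n m) :
    D.IsLocal (fromPart U j (V.e x)) (V.eSet {i | D.word i = w ∧ D.sub i j = x}) w := by
  have := D.finite
  refine ⟨?_, V.eSet_mul_eSet_comm _ _⟩
  rw [fromPart_e, eW, V.eSet_mul_eSet_comm, V.eSet_mul_eSet_of_subset fun i hi => hi.1]

theorem isLocal_psi {j : Fin d} {w : Word n m} {r k : ℕ} {hk : k + 1 < n}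
    (h : w.1 ⟨k, by omega⟩ = j) (h' : w.1 ⟨k + 1, hk⟩ = j) (hr : w.cnt j k = r) :
    D.IsLocal (fromPart U j (V.psi (r + 1))) (V.psi (k + 1)) w :=
  ⟨fromPart_psi U h h' hr, by rw [psi_mul_eW hk, Word.sw_eq_self (h.trans h'.symm)]⟩

theorem isLocal_psi0 {j : Fin d} {w : Word n m} {h0 : 0 < n} (h : w.1 ⟨0, h0⟩ = j) :
    D.IsLocal (fromPart U j (V.psi 0)) (V.psi 0) w :=
  ⟨fromPart_psi0 U h, psi0_mul_eW w⟩

variable {j l : Fin d}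

theorem comm_y_y {r s : ℕ} (hr : r < m j) (hs : s < m l) :
    fromPart U j (V.y r) * fromPart U l (V.y s) =
      fromPart U l (V.y s) * fromPart U j (V.y r) := by
  refine fromPart_comm_of_local U (isLocal_y U hr (D.sorted j)) (isLocal_y U hs _) ?_
  rw [← mul_assoc, ← mul_assoc, V.y_mul_y]

theorem comm_y_e {r : ℕ} (hr : r < m j) (x) :
    fromPart U j (V.y r) * fromPart U l (V.e x) =
      fromPart U l (V.e x) * fromPart U j (V.y r) := by
  have := D.finite
  refine fromPart_comm_of_local U (isLocal_y U hr (D.sorted j)) (isLocal_e U l x _) ?_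
  rw [← mul_assoc, ← mul_assoc, V.y_mul_eSet]

theorem comm_e_e (x x') :
    fromPart U j (V.e x) * fromPart U l (V.e x') =
      fromPart U l (V.e x') * fromPart U j (V.e x) := by
  have := D.finite
  refine fromPart_comm_of_local U (isLocal_e U j x (D.sorted j)) (isLocal_e U l x' _) ?_
  rw [← mul_assoc, ← mul_assoc, V.eSet_mul_eSet_comm]

theorem comm_psi_y (hjl : j ≠ l) {r s : ℕ} (hr : r + 1 < m j) (hs : s < m l) :
    fromPart U j (V.psi (r + 1)) * fromPart U l (V.y s) =
      fromPart U l (V.y s) * fromPart U j (V.psi (r + 1)) := by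
  obtain ⟨k, hk, h1, h2, h3⟩ := D.sorted_adj j hr
  obtain ⟨h4, h5, h6⟩ := (D.sorted j).posN_spec hs
  refine fromPart_comm_of_local U (isLocal_psi U h1 h2 h3) (isLocal_y U hs _) ?_
  rw [← mul_assoc, ← mul_assoc]
  refine ext_eW fun i hi => ?_
  rw [mul_assoc, mul_assoc]
  refine (D.rep i).psi_y_far k _ hk h4 ?_ ?_
  · intro h; simp only [h] at h5; exact hjl (h1.symm.trans h5)
  · intro h; simp only [h] at h5; exact hjl (h2.symm.trans h5)

theorem comm_psi_e (hjl : j ≠ l) {r : ℕ} (hr : r + 1 < m j) (x) :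
    fromPart U j (V.psi (r + 1)) * fromPart U l (V.e x) =
      fromPart U l (V.e x) * fromPart U j (V.psi (r + 1)) := by
  obtain ⟨k, hk, h1, h2, h3⟩ := D.sorted_adj j hr
  refine fromPart_comm_of_local U (isLocal_psi U h1 h2 h3) (isLocal_e U l x _) ?_
  rw [← mul_assoc, ← mul_assoc]
  congr 1
  have hs : (D.sorted j).sw k hk = D.sorted j := Word.sw_eq_self (h1.trans h2.symm)
  have key : ∀ i, D.word i = D.sorted j →
      D.word (D.sw i k hk) = D.sorted j ∧ D.sub (D.sw i k hk) l = D.sub i l := by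
    intro i hi
    have h4 : p (i.1 ⟨k, by omega⟩) = j := by rw [← hi] at h1; exact h1
    have h5 : p (i.1 ⟨k + 1, hk⟩) = j := by rw [← hi] at h2; exact h2
    exact ⟨by rw [D.word_sw, hi, hs],
      D.sub_sw_other (h4.trans h5.symm) fun h6 => hjl (h4.symm.trans h6)⟩
  refine V.psi_mul_eSet D.toStable hk fun i => ⟨fun h => ?_, fun h => ?_⟩
  · have := key i h.1
    exact ⟨this.1, this.2.trans h.2⟩
  · have hi : D.word i = D.sorted j := by
      rw [← hs, ← h.1, D.word_sw, Word.sw_sw]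
    exact ⟨hi, (key i hi).2.symm.trans h.2⟩

theorem comm_psi0_y (hjl : j ≠ l) {s : ℕ} (h0 : 0 < m j) (hs : s < m l) :
    fromPart U j (V.psi 0) * fromPart U l (V.y s) =
      fromPart U l (V.y s) * fromPart U j (V.psi 0) := by
  obtain ⟨h1, h2⟩ := D.sorted_apply h0
  obtain ⟨h4, h5, h6⟩ := (D.sorted j).posN_spec hs
  refine fromPart_comm_of_local U (isLocal_psi0 U h2) (isLocal_y U hs _) ?_
  rw [← mul_assoc, ← mul_assoc]
  congr 1
  cases h : (D.sorted j).posN l s with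
  | zero => simp only [h] at h5; exact absurd (h2.symm.trans h5) hjl
  | succ a => exact V.psi0_mul_y a

theorem comm_psi0_e (hjl : j ≠ l) (h0 : 0 < m j) (x) :
    fromPart U j (V.psi 0) * fromPart U l (V.e x) =
      fromPart U l (V.e x) * fromPart U j (V.psi 0) := by
  obtain ⟨h1, h2⟩ := D.sorted_apply h0
  refine fromPart_comm_of_local U (isLocal_psi0 U h2) (isLocal_e U l x _) ?_
  rw [← mul_assoc, ← mul_assoc]
  congr 1
  refine V.psi0_mul_eSet D.toStable h1 fun i => ?_
  rw [Set.mem_ofPred_eq, Set.mem_ofPred_eq, D.word_th]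
  refine and_congr_right fun hi => ?_
  rw [D.sub_th_other]
  rw [← hi] at h2
  exact fun h => hjl (h2.symm.trans h)

theorem comm_psi_psi (hjl : j ≠ l) {r s : ℕ} (hr : r + 1 < m j) (hs : s + 1 < m l) :
    fromPart U j (V.psi (r + 1)) * fromPart U l (V.psi (s + 1)) =
      fromPart U l (V.psi (s + 1)) * fromPart U j (V.psi (r + 1)) := by
  obtain ⟨k, hk, h1, h2, h3⟩ := D.sorted_adj j hr
  obtain ⟨k', hk', h1', h2', h3'⟩ := D.sorted_adj j hs
  refine fromPart_comm_of_local U (isLocal_psi U h1 h2 h3) (isLocal_psi U h1' h2' h3') ?_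
  rw [← mul_assoc, ← mul_assoc]
  congr 1
  have e1 : k ≠ k' := by rintro rfl; exact hjl (h1.symm.trans h1')
  have e2 : k ≠ k' + 1 := by rintro rfl; exact hjl (h1.symm.trans h2')
  have e3 : k + 1 ≠ k' := by rintro rfl; exact hjl (h2.symm.trans h1')
  rcases Nat.lt_or_ge k k' with h | h
  · exact V.psi_mul_psi (by omega)
  · exact (V.psi_mul_psi (by omega)).symm

theorem comm_psi0_psi (hjl : j ≠ l) {s : ℕ} (h0 : 0 < m j) (hs : s + 1 < m l) :
    fromPart U j (V.psi 0) * fromPart U l (V.psi (s + 1)) =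
      fromPart U l (V.psi (s + 1)) * fromPart U j (V.psi 0) := by
  obtain ⟨h1, h2⟩ := D.sorted_apply h0
  obtain ⟨k, hk, h1', h2', h3'⟩ := D.sorted_adj j hs
  refine fromPart_comm_of_local U (isLocal_psi0 U h2) (isLocal_psi U h1' h2' h3') ?_
  rw [← mul_assoc, ← mul_assoc]
  congr 1
  cases k with
  | zero => exact absurd (h2.symm.trans h1') hjl
  | succ k => exact V.psi0_mul_psi k

theorem exists_word_begin (D : Decomp Γ p m β) (hjl : j ≠ l) (hj : 0 < m j) (hl : 0 < m l) :
    ∃ (w : Word n m) (h : 1 < n), w.1 ⟨0, by omega⟩ = j ∧ w.1 ⟨1, h⟩ = l := by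
  obtain ⟨h1, h2⟩ := D.sorted_apply hj
  obtain ⟨a, ha, h3, -⟩ := (D.sorted j).exists_cnt_eq l hl
  have ha0 : a ≠ 0 := by rintro rfl; exact hjl (h2.symm.trans h3)
  -- In a word that begins with `j`, an occurrence of `l` is exchanged with the second letter.
  refine ⟨(D.sorted j).perm (Equiv.swap ⟨1, by omega⟩ ⟨a, ha⟩), by omega, ?_, ?_⟩
  · change (D.sorted j).1 (Equiv.swap _ _ _) = j
    rw [Equiv.swap_apply_of_ne_of_ne, h2]
    · simp
    · simpa using ha0.symm
  · change (D.sorted j).1 (Equiv.swap _ _ _) = l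
    rw [Equiv.swap_apply_left, h3]

/-- Both elements claim the first position, so no word makes them distant. On a word beginning with
`j`, `l`, the one of part `l` is `ψ_1 ψ_0 ψ_1`: the word is exchanged, `ψ_0` is applied, and the
word is exchanged back. The commutation is then the four-term braid relation, whose correction
vanishes since there are no arrows between `j` and `l`. -/
theorem comm_psi0_psi0 (hjl : j ≠ l) (hj : 0 < m j) (hl : 0 < m l) :
    fromPart U j (V.psi 0) * fromPart U l (V.psi 0) =
      fromPart U l (V.psi 0) * fromPart U j (V.psi 0) := by
  obtain ⟨w, hn, h1, h2⟩ := D.exists_word_begin hjl hj hl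
  have hw : w.1 ⟨0, by omega⟩ ≠ w.1 ⟨0 + 1, hn⟩ := fun h => hjl (h1.symm.trans (h.trans h2))
  have hw' : (w.sw 0 hn).1 ⟨0, by omega⟩ ≠ (w.sw 0 hn).1 ⟨0 + 1, hn⟩ := by
    simpa [Word.sw_apply] using hw.symm
  have hb : fromPart U l (V.psi 0) * D.eW lam γ w =
      V.psi 1 * (V.psi 0 * V.psi 1) * D.eW lam γ w := by
    have e1 := U.sw_eq 0 hn w hw
    have e2 := U.sw_eq 0 hn _ hw'
    rw [Word.sw_sw] at e2
    simp only [zero_add] at e1 e2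
    have h3 : (w.sw 0 hn).1 ⟨0, by omega⟩ = l := by simpa [Word.sw_apply] using h2
    have e3 := fromPart_psi0 U (h0 := by omega) h3
    conv_lhs => rw [← U.diag w, ← U.mul w (w.sw 0 hn) w, ← mul_assoc, fromPart_comm_matUnits,
      mul_assoc, ← U.e_mul (w.sw 0 hn) w, ← mul_assoc (fromPart U l _), e3, mul_assoc (V.psi 0),
      U.e_mul, e1, e2]
    have e4 : D.eW lam γ (w.sw 0 hn) * (V.psi 0 * (V.psi 1 * D.eW lam γ w)) =
        V.psi 0 * (V.psi 1 * D.eW lam γ w) := by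
      rw [← mul_assoc, ← psi0_mul_eW, mul_assoc, ← e1, U.e_mul]
    rw [mul_assoc, e4]
    simp only [mul_assoc]
  have hc : ∀ v : Word n m, V.psi 1 * D.eW lam γ v = D.eW lam γ (v.sw 0 hn) * V.psi 1 :=
    fun v => psi_mul_eW hn v
  refine fromPart_comm_of_local U (isLocal_psi0 U h1) (y := V.psi 1 * (V.psi 0 * V.psi 1))
    ⟨hb, ?_⟩ ?_
  · rw [mul_assoc, mul_assoc, hc, ← mul_assoc (V.psi 0), psi0_mul_eW, mul_assoc, ← mul_assoc, hc,
      Word.sw_sw, mul_assoc]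
  · rw [← mul_assoc, ← mul_assoc (V.psi 1 * _)]
    refine ext_eW fun i hi => ?_
    have hp : p (i.1 ⟨0, by omega⟩) ≠ p (i.1 ⟨1, hn⟩) := by
      rw [← hi] at hw
      exact hw
    simp only [mul_assoc]
    have R := D.rep (lam := lam) (γ := γ) i
    by_cases h0 : γ (i.1 ⟨0, by omega⟩) = 0
    · rw [R.braid4_zero hn h0, oddQ_eq_zero D.arrows_part hp.symm, zero_mul, smul_zero, add_zero]
      -- The remaining case `θ(i_1) = i_2` of the relation is impossible, because `θ` preserves the
      -- parts.
      intro h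
      exact hp ((D.θ_part _).symm.trans (congrArg p h))
    · rw [R.braid4_ne hn h0, oddQ₂_eq_zero D.arrows_part hp.symm, zero_mul, smul_zero, add_zero]

theorem fromPart_comm_gen (hjl : j ≠ l) (g g') :
    fromPart U j (V.gen _ _ _ _ g) * fromPart U l (V.gen _ _ _ _ g') =
      fromPart U l (V.gen _ _ _ _ g') * fromPart U j (V.gen _ _ _ _ g) := by
  rcases g with ⟨a, ha⟩ | ⟨b, hb⟩ | x <;> rcases g' with ⟨a', ha'⟩ | ⟨b', hb'⟩ | x' <;>
    simp only [V.gen_y, V.gen_psi, V.gen_e]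
  · exact comm_y_y U ha ha'
  · cases b' with
    | zero => exact (comm_psi0_y U hjl.symm hb' ha).symm
    | succ b' => exact (comm_psi_y U hjl.symm hb' ha).symm
  · exact comm_y_e U ha x'
  · cases b with
    | zero => exact comm_psi0_y U hjl hb ha'
    | succ b => exact comm_psi_y U hjl hb ha'
  · cases b with
    | zero =>
      cases b' with
      | zero => exact comm_psi0_psi0 U hjl hb hb'
      | succ b' => exact comm_psi0_psi U hjl hb hb'
    | succ b =>
      cases b' with
      | zero => exact (comm_psi0_psi U hjl.symm hb' hb).symm
      | succ b' => exact comm_psi_psi U hjl hb hb'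
  · cases b with
    | zero => exact comm_psi0_e U hjl hb x'
    | succ b => exact comm_psi_e U hjl hb x'
  · exact (comm_y_e U ha' x).symm
  · cases b' with
    | zero => exact (comm_psi0_e U hjl.symm hb' x).symm
    | succ b' => exact (comm_psi_e U hjl.symm hb' x).symm
  · exact comm_e_e U x x'

theorem fromPart_comm (j l : Fin d) (hjl : j ≠ l) (x) (y) :
    fromPart U j x * fromPart U l y = fromPart U l y * fromPart U j x := by
  have h1 : ∀ g y, fromPart U l y ∈ Subalgebra.centralizer K {fromPart U j (V.gen _ _ _ _ g)} :=
    fun g y => V.mem_of_gen_mem ((Subalgebra.centralizer K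
      {fromPart U j (V.gen _ _ _ _ g)}).comap (fromPart U l)) (fun g' => by
        rw [Subalgebra.mem_comap, Subalgebra.mem_centralizer_iff]
        rintro _ rfl
        exact fromPart_comm_gen U hjl g g') y
  have h2 : ∀ x, fromPart U j x ∈ Subalgebra.centralizer K {fromPart U l y} :=
    fun x => V.mem_of_gen_mem ((Subalgebra.centralizer K {fromPart U l y}).comap
      (fromPart U j)) (fun g => by
        rw [Subalgebra.mem_comap, Subalgebra.mem_centralizer_iff]
        rintro _ rfl
        exact ((Subalgebra.mem_centralizer_iff K).mp (h1 g y) _ rfl).symm) x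
  exact ((Subalgebra.mem_centralizer_iff K).mp (h2 x) _ rfl).symm

end Decomp

end Commute

/-! ### The two homomorphisms are mutually inverse -/

section Inverse

variable {I : Type u} {A : Type v} {K : Type w} [CommRing K] {d n : ℕ}
  {Γ : InvQuiver I A} {lam : I → ℕ} {γ : I → K} {β : Set (Fin n → I)}
  {p : I → Fin d} {m : Fin d → ℕ} {D : Decomp Γ p m β}

namespace Decomp

/-- A pure tensor is a product of elements of the single factors, each of which lies in the
subalgebra generated by the images of the generators of its part. -/
theorem mem_of_inj_mem (S : Subalgebra K (D.T lam γ))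
    (h : ∀ j g, D.inj lam γ j (V.gen _ _ _ _ g) ∈ S) (t : D.T lam γ) : t ∈ S := by
  have h1 : ∀ j x, D.inj lam γ j x ∈ S := fun j x =>
    V.mem_of_gen_mem (S.comap (D.inj lam γ j)) (fun g => h j g) x
  induction t using PiTensorProduct.induction_on with
  | smul_tprod r b =>
    refine S.smul_mem ?_ r
    exact Submonoid.pi_mem_of_mulSingle_mem
      (H := S.toSubmonoid.comap (PiTensorProduct.tprodMonoidHom K)) b fun j => h1 j (b j)
  | add x y hx hy => exact S.add_mem hx hy

theorem algHom_ext_T {B : Type*} [Semiring B] [Algebra K B] {f g : D.T lam γ →ₐ[K] B}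
    (h : ∀ j x, f (D.inj lam γ j (V.gen _ _ _ _ x)) = g (D.inj lam γ j (V.gen _ _ _ _ x))) :
    f = g :=
  AlgHom.ext fun t => mem_of_inj_mem (AlgHom.equalizer f g) h t

theorem eW_eq_sum [Fintype β] (w : Word n m) :
    D.eW lam γ w = ∑ i : β, if D.word i = w then V.e i else 0 := by
  classical
  rw [eW, V.eSet, finsum_eq_sum_of_fintype]
  refine Finset.sum_congr rfl fun i _ => ?_
  simp only [Set.mem_ofPred_eq]
  congr

theorem toMat_eW (w : Word n m) : D.toMat lam γ (D.eW lam γ w) = Matrix.single w w 1 := by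
  have := D.finite
  have := Fintype.ofFinite β
  have hs : ∀ f : β → D.T lam γ, Matrix.single w w (∑ i, f i) = ∑ i, Matrix.single w w (f i) :=
    fun f => map_sum (Matrix.singleAddMonoidHom w w) f _
  rw [eW_eq_sum, map_sum, ← sum_eT w, hs]
  refine Finset.sum_congr rfl fun i _ => ?_
  split_ifs with h
  · rw [toMat_e, matE, h]
  · rw [map_zero, Matrix.single_zero]

variable {M : Word n m → Word n m → V Γ lam γ β}
  (U : MatUnits (D.eW lam γ) (fun k => V.psi (k + 1)) M)

include U in
-- Units into the sorted column are built from exchanges, for which the image is known, by induction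
-- along sorting. The image of a unit out of the sorted word is then forced, as the inverse of one
-- already computed.
theorem toMat_matUnits (w u : Word n m) : D.toMat lam γ (M w u) = Matrix.single w u 1 := by
  obtain ⟨w₀, h₀⟩ := Word.exists_monotone 1 w
  have h1 : ∀ w, D.toMat lam γ (M w w₀) = Matrix.single w w₀ 1 := by
    intro w
    induction w using Word.sort_induction 1 with
    | h w ih =>
      by_cases hw : Monotone w.1
      · obtain rfl := Word.eq_of_monotone (π := 1) h₀ hw
        rw [U.diag, toMat_eW]
      · obtain ⟨k, hk, h⟩ := Word.exists_descent (π := 1) hw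
        have h' : (w.sw k hk).1 ⟨k, by omega⟩ ≠ (w.sw k hk).1 ⟨k + 1, hk⟩ := by
          simpa [Word.sw_apply] using (show w.1 _ < w.1 _ from h).ne
        have h2 := U.s_mul k hk _ w₀ h'
        rw [Word.sw_sw] at h2
        rw [← h2, map_mul, ih _ (Word.key_sw_lt h), toMat_psi hk, matPsi_mul_ne h', Word.sw_sw]
  have h2 : D.toMat lam γ (M w₀ u) = Matrix.single w₀ u 1 := by
    have h3 : Matrix.single u w₀ 1 * D.toMat lam γ (M w₀ u) = Matrix.single u u 1 := by
      rw [← h1, ← map_mul, U.mul, U.diag, toMat_eW]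
    rw [← U.e_mul, map_mul, toMat_eW,
      show Matrix.single w₀ w₀ (1 : D.T lam γ) = Matrix.single w₀ u 1 * Matrix.single u w₀ 1 by
        simp, mul_assoc, h3]
    simp
  rw [← U.mul w w₀ u, map_mul, h1, h2]
  simp

/-- The homomorphism from the tensor product of the algebras of the parts. -/
noncomputable def ofTensor : D.T lam γ →ₐ[K] V Γ lam γ β := commLift (fromPart U) (fromPart_comm U)

theorem ofTensor_inj (j : Fin d) (x) : ofTensor U (D.inj lam γ j x) = fromPart U j x :=
  commLift_single ..

theorem ofTensor_comm_matUnits (t : D.T lam γ) (w u : Word n m) :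
    ofTensor U t * M w u = M w u * ofTensor U t := by
  have h := mem_of_inj_mem ((Subalgebra.centralizer K {M w u}).comap (ofTensor U)) (fun j g => by
    rw [Subalgebra.mem_comap, Subalgebra.mem_centralizer_iff, ofTensor_inj]
    rintro _ rfl
    exact (fromPart_comm_matUnits U j _ w u).symm) t
  exact ((Subalgebra.mem_centralizer_iff K).mp h _ rfl).symm

/-- The homomorphism from the matrix algebra over the tensor product to `V_β(Γ, λ, γ)`. -/
noncomputable def ofMat : Matrix (Word n m) (Word n m) (D.T lam γ) →ₐ[K] V Γ lam γ β :=
  U.lift sum_eW (ofTensor U) (ofTensor_comm_matUnits U)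

theorem ofMat_single (w u : Word n m) (t : D.T lam γ) :
    ofMat U (Matrix.single w u t) = M w u * ofTensor U t := U.lift_single ..

/-- The element commutes with the matrix units, so its image is determined by one diagonal entry,
repeated along the diagonal. -/
theorem toMat_fromPart_of {j : Fin d} {x} (v : Word n m)
    (h : D.toMat lam γ (fromPart U j x) * Matrix.single v v 1 =
      Matrix.single v v (D.inj lam γ j x)) :
    D.toMat lam γ (fromPart U j x) =
      Matrix.diagonalAlgHom K (fun _ : Word n m => D.inj lam γ j x) := by
  rw [← mul_one (D.toMat lam γ _), ← mul_one (Matrix.diagonalAlgHom K _),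
    ← map_one (D.toMat lam γ), ← sum_eW (D := D), map_sum, Finset.mul_sum, Finset.mul_sum]
  refine Finset.sum_congr rfl fun w _ => ?_
  have h1 : fromPart U j x * D.eW lam γ w = M w v * (fromPart U j x * M v v) * M v w := by
    rw [← mul_assoc, ← fromPart_comm_matUnits, mul_assoc, mul_assoc, U.mul, U.mul, U.diag]
  rw [← map_mul, h1, map_mul, map_mul, map_mul, toMat_matUnits U, toMat_matUnits U,
    toMat_matUnits U, h, toMat_eW, diag_mul_single]
  simp

theorem inj_e_mul_eT_ne {j : Fin d} {i : β} {x} (h : x ≠ D.sub i j) :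
    D.inj lam γ j (V.e x) * D.eT lam γ i = 0 := by
  rw [← inj_e_mul_eT j i, ← mul_assoc, ← map_mul, V.e_mul_ne h, map_zero, zero_mul]

theorem toMat_fromPart_gen (j : Fin d) (g) : D.toMat lam γ (fromPart U j (V.gen _ _ _ _ g)) =
    Matrix.diagonalAlgHom K (fun _ : Word n m => D.inj lam γ j (V.gen _ _ _ _ g)) := by
  have key : ∀ {g : Gen (subtuples p β j (m j))} {v : Word n m} {x : V Γ lam γ β},
      fromPart U j (V.gen _ _ _ _ g) * D.eW lam γ v = x * D.eW lam γ v →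
      D.toMat lam γ x * Matrix.single v v 1 =
        Matrix.single v v (D.inj lam γ j (V.gen _ _ _ _ g) * 1) →
      D.toMat lam γ (fromPart U j (V.gen _ _ _ _ g)) = Matrix.diagonalAlgHom K
        (fun _ : Word n m => D.inj lam γ j (V.gen _ _ _ _ g)) := fun {g v x} h1 h2 => by
    refine toMat_fromPart_of U v ?_
    rw [← toMat_eW, ← map_mul, h1, map_mul, toMat_eW, h2, mul_one]
  rcases g with ⟨r, hr⟩ | ⟨b, hb⟩ | x
  · obtain ⟨h1, h2, h3⟩ := (D.sorted j).posN_spec hr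
    refine key (v := D.sorted j) (x := V.y ((D.sorted j).posN j r)) ?_ ?_ <;> rw [V.gen_y]
    · exact fromPart_y U h2 h3
    · rw [toMat_y h1, matY_mul h2 h3]
  · cases b with
    | zero =>
      obtain ⟨h1, h2⟩ := D.sorted_apply hb
      refine key (v := D.sorted j) (x := V.psi 0) ?_ ?_ <;> rw [V.gen_psi]
      · exact fromPart_psi0 U h2
      · rw [toMat_psi h1, matPsi_zero_mul h2]
    | succ b =>
      obtain ⟨k, hk, h1, h2, h3⟩ := D.sorted_adj j hb
      refine key (v := D.sorted j) (x := V.psi (k + 1)) ?_ ?_ <;> rw [V.gen_psi]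
      · exact fromPart_psi U h1 h2 h3
      · rw [toMat_psi hk, matPsi_mul_same h1 h2 h3]
  · have := D.finite
    have := Fintype.ofFinite β
    refine toMat_fromPart_of U (D.sorted j) ?_
    rw [← toMat_eW, ← map_mul, V.gen_e, fromPart_e, V.eSet, finsum_eq_sum_of_fintype, map_sum,
      ← mul_one (D.inj lam γ j (V.e x)), ← sum_eT (D.sorted j), Finset.mul_sum]
    have hs : ∀ f : β → D.T lam γ, Matrix.single (D.sorted j) (D.sorted j) (∑ i, f i) =
        ∑ i, Matrix.single (D.sorted j) (D.sorted j) (f i) :=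
      fun f => map_sum (Matrix.singleAddMonoidHom (D.sorted j) (D.sorted j)) f _
    rw [hs]
    refine Finset.sum_congr rfl fun i _ => ?_
    simp only [Set.mem_ofPred_eq]
    by_cases h1 : D.word i = D.sorted j
    · rw [if_pos h1]
      by_cases h2 : D.sub i j = x
      · rw [if_pos ⟨h1, h2⟩, toMat_e, matE, h1, ← h2, inj_e_mul_eT]
      · rw [if_neg fun h => h2 h.2, map_zero, inj_e_mul_eT_ne (Ne.symm h2), Matrix.single_zero]
    · rw [if_neg fun h => h1 h.1, if_neg h1, map_zero, mul_zero, Matrix.single_zero]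

theorem toMat_ofTensor (t : D.T lam γ) : D.toMat lam γ (ofTensor U t) =
    Matrix.diagonalAlgHom K (fun _ : Word n m => t) :=
  DFunLike.congr_fun (algHom_ext_T (f := (D.toMat lam γ).comp (ofTensor U))
    (g := (Matrix.diagonalAlgHom K).comp (Pi.constAlgHom K (Word n m) (D.T lam γ))) fun j g => by
      refine (congrArg _ (ofTensor_inj U j _)).trans (toMat_fromPart_gen U j g)) t

theorem toMat_ofMat (N : Matrix (Word n m) (Word n m) (D.T lam γ)) :
    D.toMat lam γ (ofMat U N) = N := by
  induction N using Matrix.induction_on' with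
  | h_zero => simp
  | h_add N N' h h' => rw [map_add, map_add, h, h']
  | h_std_basis w u t =>
    rw [ofMat_single, ← ofTensor_comm_matUnits, map_mul, toMat_ofTensor, toMat_matUnits U,
      diag_mul_single, mul_one]

theorem e_mul_fromPart_e (i : β) (j : Fin d) :
    V.e i * fromPart U j (V.e (D.sub i j)) = V.e i := by
  have := D.finite
  have h : V.e i * D.eW lam γ (D.word i) = V.e i := by
    rw [eW, V.e_mul_eSet]
    exact eW_mul_e i
  rw [← h, mul_assoc, ← U.diag, ← fromPart_comm_matUnits, U.diag, fromPart_e, V.e_mul_eSet]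
  exact (V.eSet_mul_mem (by exact ⟨rfl, rfl⟩)).trans h.symm

/-- Another tuple of the same word differs from `i` in some subtuple, so its idempotent kills the
image of `eT i`. Applied to the decomposition of `1` into the `eT` of this word, the same vanishing
shows that `e(i)` is fixed. -/
theorem eW_mul_ofTensor_eT (i : β) : D.eW lam γ (D.word i) * ofTensor U (D.eT lam γ i) = V.e i := by
  have := D.finite
  have := Fintype.ofFinite β
  have h1 : ∀ i i' : β, D.word i' = D.word i → i' ≠ i → V.e i' * ofTensor U (D.eT lam γ i) = 0 := by
    intro i i' hw hne
    obtain ⟨j, hj⟩ : ∃ j, D.sub i' j ≠ D.sub i j := by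
      by_contra! h'
      exact hne (eq_of_sub hw h')
    rw [← e_mul_fromPart_e U i' j, mul_assoc, ← ofTensor_inj, ← map_mul, inj_e_mul_eT_ne hj,
      map_zero, mul_zero]
  have h2 : V.e i * ofTensor U (D.eT lam γ i) = V.e i := by
    have h3 := congrArg (fun t => V.e i * ofTensor U t) (sum_eT (D := D) (lam := lam) (γ := γ)
      (D.word i))
    simp only [map_sum, map_one, mul_one, Finset.mul_sum] at h3
    rw [Finset.sum_eq_single i, if_pos rfl] at h3
    · exact h3
    · intro i' _ hne
      split_ifs with hw
      · exact h1 i' i hw.symm hne.symm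
      · rw [map_zero, mul_zero]
    · exact fun h => absurd (Finset.mem_univ i) h
  rw [eW_eq_sum, Finset.sum_mul, Finset.sum_eq_single i, if_pos rfl, h2]
  · intro i' _ hne
    split_ifs with hw
    · exact h1 i i' hw hne
    · rw [zero_mul]
  · exact fun h => absurd (Finset.mem_univ i) h

/-- On each component a generator is the value of some `fromPart`, or an exchange and thus a matrix
unit, or an `e(i)` recovered from `eT i`. As `toMat` is already a left inverse, surjectivity
replaces the computation of the other composite. -/
theorem ofMat_surjective : Function.Surjective (ofMat U) := by
  have hW : ∀ x, (∀ w, x * D.eW lam γ w ∈ (ofMat U).range) → x ∈ (ofMat U).range := fun x h => by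
    rw [← mul_one x, ← sum_eW (D := D), Finset.mul_sum]
    exact Subalgebra.sum_mem _ fun w _ => h w
  have hP : ∀ j x w, fromPart U j x * D.eW lam γ w ∈ (ofMat U).range := fun j x w =>
    ⟨Matrix.single w w (D.inj lam γ j x), (ofMat_single U _ _ _).trans (by
      rw [ofTensor_inj, ← fromPart_comm_matUnits, U.diag])⟩
  intro x
  refine V.mem_of_gen_mem (ofMat U).range (fun g => ?_) x
  rcases g with ⟨a, ha⟩ | ⟨b, hb⟩ | i
  · refine hW _ fun w => ?_
    rw [V.gen_y, ← fromPart_y U (ha := ha) rfl rfl]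
    exact hP _ _ _
  · refine hW _ fun w => ?_
    rw [V.gen_psi]
    cases b with
    | zero =>
      rw [← fromPart_psi0 U (h0 := hb) rfl]
      exact hP _ _ _
    | succ b =>
      by_cases h : w.1 ⟨b, by omega⟩ = w.1 ⟨b + 1, hb⟩
      · rw [← fromPart_psi U (hk := hb) rfl h.symm rfl]
        exact hP _ _ _
      · rw [← U.sw_eq b hb w h]
        exact ⟨Matrix.single _ _ 1, (ofMat_single U _ _ _).trans (by rw [map_one, mul_one])⟩
  · exact ⟨Matrix.single _ _ (D.eT lam γ i), (ofMat_single U _ _ _).trans (by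
      rw [U.diag, eW_mul_ofTensor_eT, V.gen_e])⟩

theorem ofMat_toMat (x : V Γ lam γ β) : ofMat U (D.toMat lam γ x) = x := by
  obtain ⟨N, rfl⟩ := ofMat_surjective U x
  rw [toMat_ofMat]

/-- The isomorphism between `V_β(Γ, λ, γ)` and the matrix algebra over the tensor product. -/
noncomputable def matEquiv : V Γ lam γ β ≃ₐ[K] Matrix (Word n m) (Word n m) (D.T lam γ) :=
  AlgEquiv.ofAlgHom (D.toMat lam γ) (ofMat U) (AlgHom.ext (toMat_ofMat U))
    (AlgHom.ext (ofMat_toMat U))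

end Decomp

end Inverse

/-! ### Gradings on tensor products and on matrix algebras -/

section Gradings

variable {K : Type w} [CommRing K]

section TensorGrading

variable {d : ℕ} {B : Fin d → Type u} [∀ j, Ring (B j)] [∀ j, Algebra K (B j)]
  {𝒢 : ∀ j, ℤ → Submodule K (B j)}

theorem tprod_mem_tensorGrading {deg : Fin d → ℤ} {b : ∀ j, B j} (h : ∀ j, b j ∈ 𝒢 j (deg j)) :
    PiTensorProduct.tprod K b ∈ tensorGrading 𝒢 (∑ j, deg j) :=
  Submodule.subset_span ⟨deg, b, rfl, h, rfl⟩

theorem tprod_update_mem_tensorGrading {b : ∀ j, B j} (h : ∀ j, b j ∈ 𝒢 j 0) {j : Fin d} {x : B j}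
    {k : ℤ} (hx : x ∈ 𝒢 j k) :
    PiTensorProduct.tprod K (Function.update b j x) ∈ tensorGrading 𝒢 k := by
  have h1 := tprod_mem_tensorGrading (𝒢 := 𝒢) (deg := Function.update 0 j k)
    (b := Function.update b j x) fun l => by
      by_cases hl : l = j
      · subst hl; simpa using hx
      · simpa [hl] using h l
  simpa [Finset.sum_update_of_mem] using h1

instance tensorGrading_gradedMonoid [∀ j, SetLike.GradedMonoid (𝒢 j)] :
    SetLike.GradedMonoid (tensorGrading 𝒢) where
  one_mem := by
    have h := tprod_mem_tensorGrading (𝒢 := 𝒢) (deg := 0) (b := 1)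
      fun j => SetLike.GradedOne.one_mem (A := 𝒢 j)
    simpa [PiTensorProduct.one_def] using h
  mul_mem k l x y hx hy := by
    unfold tensorGrading at hx
    induction hx using Submodule.span_induction with
    | zero => rw [zero_mul]; exact Submodule.zero_mem _
    | add x x' _ _ h h' => rw [add_mul]; exact Submodule.add_mem _ h h'
    | smul c x _ h => rw [smul_mul_assoc]; exact Submodule.smul_mem _ _ h
    | mem x hx =>
      obtain ⟨deg, b, rfl, hb, rfl⟩ := hx
      unfold tensorGrading at hy
      induction hy using Submodule.span_induction with
      | zero => rw [mul_zero]; exact Submodule.zero_mem _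
      | add x x' _ _ h h' => rw [mul_add]; exact Submodule.add_mem _ h h'
      | smul c x _ h => rw [mul_smul_comm]; exact Submodule.smul_mem _ _ h
      | mem y hy =>
        obtain ⟨deg', b', rfl, hb', rfl⟩ := hy
        rw [PiTensorProduct.tprod_mul_tprod, ← Finset.sum_add_distrib]
        exact tprod_mem_tensorGrading (𝒢 := 𝒢) (deg := fun j => deg j + deg' j)
          fun j => SetLike.GradedMul.mul_mem (hb j) (hb' j)

theorem commLift_mem {R : Type*} [Ring R] [Algebra K R] {φ : ∀ j, B j →ₐ[K] R}
    {h : ∀ j l, j ≠ l → ∀ x y, φ j x * φ l y = φ l y * φ j x} {ℋ : ℤ → Submodule K R}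
    [SetLike.GradedMonoid ℋ] (hφ : ∀ j k x, x ∈ 𝒢 j k → φ j x ∈ ℋ k) {k : ℤ} {t : ⨂[K] j, B j}
    (ht : t ∈ tensorGrading 𝒢 k) : commLift φ h t ∈ ℋ k := by
  unfold tensorGrading at ht
  induction ht using Submodule.span_induction with
  | zero => rw [map_zero]; exact Submodule.zero_mem _
  | add x x' _ _ h h' => rw [map_add]; exact Submodule.add_mem _ h h'
  | smul c x _ h => rw [map_smul]; exact Submodule.smul_mem _ _ h
  | mem x hx =>
    obtain ⟨deg, b, rfl, hb, rfl⟩ := hx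
    -- Coordinates outside `s` are set to `1`; enlarging `s` by one index multiplies by one
    -- homogeneous factor and adds its degree.
    have key : ∀ s : Finset (Fin d), commProd φ h (s.piecewise b 1) ∈ ℋ (∑ j ∈ s, deg j) := by
      intro s
      induction s using Finset.induction_on with
      | empty => rw [Finset.piecewise_empty, map_one]; exact SetLike.GradedOne.one_mem
      | insert j s hj ih =>
        have h1 : Function.update (s.piecewise b 1) j 1 = s.piecewise b 1 := by
          rw [Function.update_eq_self_iff, Finset.piecewise_eq_of_notMem _ _ _ hj]; rfl
        rw [Finset.piecewise_insert, commProd_update, h1, Finset.sum_insert hj, add_comm]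
        exact SetLike.GradedMul.mul_mem ih (hφ j _ _ (hb j))
    have h1 := key Finset.univ
    rw [Finset.piecewise_univ] at h1
    have h2 : commLift φ h (PiTensorProduct.tprod K b) = commProd φ h b :=
      PiTensorProduct.lift.tprod _
    rwa [h2]

end TensorGrading

/-- The entrywise grading on the matrices with arbitrary index set. -/
def entryGrading {B : Type u} [Ring B] [Algebra K B] (W : Type*) (𝒢 : ℤ → Submodule K B) (k : ℤ) :
    Submodule K (Matrix W W B) where
  carrier := {M | ∀ s t, M s t ∈ 𝒢 k}
  zero_mem' _ _ := (𝒢 k).zero_mem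
  add_mem' hM hN s t := (𝒢 k).add_mem (hM s t) (hN s t)
  smul_mem' c _ hM s t := (𝒢 k).smul_mem c (hM s t)

section EntryGrading

variable {B : Type u} [Ring B] [Algebra K B] {W : Type*} {𝒢 : ℤ → Submodule K B} [DecidableEq W]

theorem single_mem_entryGrading {k : ℤ} {x : B} (hx : x ∈ 𝒢 k) (w u : W) :
    Matrix.single w u x ∈ entryGrading W 𝒢 k := fun s t => by
  rw [Matrix.single_apply]
  split_ifs
  · exact hx
  · exact zero_mem _

instance entryGrading_gradedMonoid [Fintype W] [SetLike.GradedMonoid 𝒢] :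
    SetLike.GradedMonoid (entryGrading W 𝒢) where
  one_mem s t := by
    rw [Matrix.one_apply]
    split_ifs
    · exact SetLike.GradedOne.one_mem
    · exact zero_mem _
  mul_mem k l M N hM hN s t := by
    rw [Matrix.mul_apply]
    exact sum_mem fun u _ => SetLike.GradedMul.mul_mem (hM s u) (hN u t)

end EntryGrading

/-- The transport of a structure of graded algebra along an isomorphism. -/
theorem gradedAlgebra_of_algEquiv {A B : Type*} [Ring A] [Algebra K A] [Ring B] [Algebra K B]
    (f : A ≃ₐ[K] B) {𝒢 : ℤ → Submodule K A} {ℋ : ℤ → Submodule K B} (h𝒢 : GradedAlgebra 𝒢)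
    (h : ∀ k, (𝒢 k).map f.toLinearMap = ℋ k) : Nonempty (GradedAlgebra ℋ) := by
  have hmem : ∀ {k x}, x ∈ 𝒢 k → f x ∈ ℋ k := fun {k x} hx => by
    rw [← h]; exact ⟨x, hx, rfl⟩
  have hmem' : ∀ {k y}, y ∈ ℋ k → ∃ x ∈ 𝒢 k, f x = y := fun {k y} hy => by
    rw [← h] at hy; exact hy
  have hi := (DirectSum.isInternal_submodule_iff_iSupIndep_and_iSup_eq_top 𝒢).mp
    (DirectSum.Decomposition.isInternal 𝒢)
  have hint : DirectSum.IsInternal ℋ := by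
    rw [DirectSum.isInternal_submodule_iff_iSupIndep_and_iSup_eq_top]
    obtain rfl : (fun k => (𝒢 k).map f.toLinearMap) = ℋ := funext h
    refine ⟨hi.1.map_orderIso (Submodule.orderIsoMapComap f.toLinearEquiv), ?_⟩
    rw [← Submodule.map_iSup, hi.2, Submodule.map_top]
    exact LinearMap.range_eq_top.mpr f.surjective
  have hm : SetLike.GradedMonoid ℋ :=
    { one_mem := by rw [← map_one f]; exact hmem SetLike.GradedOne.one_mem
      mul_mem := fun k l x y hx hy => by
        obtain ⟨x', hx', rfl⟩ := hmem' hx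
        obtain ⟨y', hy', rfl⟩ := hmem' hy
        rw [← map_mul]
        exact hmem (SetLike.GradedMul.mul_mem hx' hy') }
  let := hint.chooseDecomposition
  exact ⟨{ }⟩

end Gradings

/-! ### The isomorphism preserves degrees -/

section GradedMaps

variable {I : Type u} {A : Type v} {K : Type w} [CommRing K] {d n : ℕ}
  {Γ : InvQuiver I A} {lam : I → ℕ} {γ : I → K} {β : Set (Fin n → I)}
  {p : I → Fin d} {m : Fin d → ℕ} {D : Decomp Γ p m β}

namespace Decomp

/-- The gradings of the algebras of the parts. -/
noncomputable abbrev partGrading (D : Decomp Γ p m β) (lam : I → ℕ) (γ : I → K) (j : Fin d) :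
    ℤ → Submodule K (VP Γ lam γ D.θ_part β m j) :=
  V.grading (Γ.full (part p j) (part_stable D.θ_part j)) (fun i => lam i) (fun i => γ i)
    (subtuples p β j (m j))

theorem eT_mem (i : β) : D.eT lam γ i ∈ tensorGrading (D.partGrading lam γ) 0 := by
  have h := tprod_mem_tensorGrading (𝒢 := D.partGrading lam γ) (deg := 0)
    (b := fun j => V.e (D.sub i j)) fun j => V.e_mem_grading _
  simpa [eT] using h

theorem inj_mul_eT_mem {j : Fin d} {i : β} {x} {k : ℤ}
    (hx : x * V.e (D.sub i j) ∈ D.partGrading lam γ j k) :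
    D.inj lam γ j x * D.eT lam γ i ∈ tensorGrading (D.partGrading lam γ) k := by
  rw [eT, inj_mul_tprod]
  exact tprod_update_mem_tensorGrading (𝒢 := D.partGrading lam γ)
    (fun j => V.e_mem_grading _) hx

theorem inj_mem {j : Fin d} {x} {k : ℤ} (hx : x ∈ D.partGrading lam γ j k) :
    D.inj lam γ j x ∈ tensorGrading (D.partGrading lam γ) k :=
  tprod_update_mem_tensorGrading (𝒢 := D.partGrading lam γ) (b := 1)
    (fun _ => SetLike.GradedOne.one_mem) hx

theorem psiDeg_sub {j : Fin d} {i : β} {k r : ℕ} {hk : k + 1 < n}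
    (h : p (i.1 ⟨k, by omega⟩) = j) (h' : p (i.1 ⟨k + 1, hk⟩) = j)
    (hr : (D.word i).cnt j k = r) :
    psiDeg (Γ.full (part p j) (part_stable D.θ_part j)) (fun i => lam i) (fun i => γ i)
      (D.sub i j).1 (r + 1) = psiDeg Γ lam γ i.1 (k + 1) := by
  have hr' : (D.word i).cnt j (k + 1) = r + 1 := by
    rw [Word.cnt_succ_self _ (ha := by omega) h, hr]
  have hm : r + 1 < m j := by rw [← hr']; exact (D.word i).cnt_lt h'
  rw [psiDeg_succ _ hm, psiDeg_succ _ hk, sub_apply (D := D) h hr, sub_apply (D := D) h' hr',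
    full_d₂ D.θ_part]

theorem psiDeg_sub_zero {j : Fin d} {i : β} {h0 : 0 < n} (h : p (i.1 ⟨0, h0⟩) = j) :
    psiDeg (Γ.full (part p j) (part_stable D.θ_part j)) (fun i => lam i) (fun i => γ i)
      (D.sub i j).1 0 = psiDeg Γ lam γ i.1 0 := by
  have hr : (D.word i).cnt j 0 = 0 := Word.cnt_zero _ _
  have hm : 0 < m j := by rw [← hr]; exact (D.word i).cnt_lt h
  rw [psiDeg_zero _ hm, psiDeg_zero _ h0, sub_apply (D := D) h hr]
  rfl

/-- Across parts `d(i, j) = i·j = 0`. This is why the matrix algebra carries the entrywise grading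
without shifts. -/
theorem psiDeg_eq_zero (D : Decomp Γ p m β) {i : Fin n → I} {k : ℕ} {hk : k + 1 < n}
    (h : p (i ⟨k, by omega⟩) ≠ p (i ⟨k + 1, hk⟩)) : psiDeg Γ lam γ i (k + 1) = 0 := by
  rw [psiDeg_succ _ hk, d₂_ne fun h' => h (congrArg p h'), dot_eq_zero D.arrows_part h]
  rfl

theorem toMat_mem {k : ℤ} {x : V Γ lam γ β} (hx : x ∈ V.grading Γ lam γ β k) :
    D.toMat lam γ x ∈ entryGrading (Word n m) (tensorGrading (D.partGrading lam γ)) k := by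
  refine V.map_grading (entryGrading (Word n m) (tensorGrading (D.partGrading lam γ)))
    (D.toMat lam γ) (fun i => ?_) (fun a ha s t => ?_) (fun b i hb => ?_) hx
  · rw [toMat_e]
    exact single_mem_entryGrading (eT_mem i) _ _
  · rw [toMat_y ha, matY, Matrix.diagonalAlgHom_apply, Matrix.diagonal_apply]
    split_ifs
    · rw [entryY_eq (ha := ha) rfl rfl]
      exact inj_mem (V.y_mem_grading _)
    · exact zero_mem _
  · rw [map_mul, toMat_psi hb, toMat_e, matE]
    cases b with
    | zero =>
      rw [matPsi_zero_mul (h := hb) (j := p (i.1 ⟨0, hb⟩)) rfl,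
        ← psiDeg_sub_zero (D := D) (h0 := hb) rfl]
      exact single_mem_entryGrading (inj_mul_eT_mem (V.psi_e_mem_grading _ _)) _ _
    | succ b =>
      by_cases h : p (i.1 ⟨b, by omega⟩) = p (i.1 ⟨b + 1, hb⟩)
      · rw [matPsi_mul_same (hk := hb) (j := p (i.1 ⟨b, by omega⟩)) rfl h.symm rfl,
          ← psiDeg_sub (D := D) (hk := hb) rfl h.symm rfl]
        exact single_mem_entryGrading (inj_mul_eT_mem (V.psi_e_mem_grading _ _)) _ _
      · rw [matPsi_mul_ne (hk := hb) h, D.psiDeg_eq_zero h]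
        exact single_mem_entryGrading (eT_mem i) _ _

theorem mul_eSet_mem {x : V Γ lam γ β} {S : Set β} {k : ℤ}
    (h : ∀ i ∈ S, x * V.e i ∈ V.grading Γ lam γ β k) (D : Decomp Γ p m β) :
    x * V.eSet S ∈ V.grading Γ lam γ β k := by
  have := D.finite
  have := Fintype.ofFinite β
  rw [V.eSet, finsum_eq_sum_of_fintype, Finset.mul_sum]
  refine sum_mem fun i _ => ?_
  split_ifs with hi
  · exact h i hi
  · rw [mul_zero]; exact zero_mem _

theorem eSet_mem (S : Set β) (D : Decomp Γ p m β) : V.eSet S ∈ V.grading Γ lam γ β 0 := by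
  rw [← one_mul (V.eSet S)]
  exact mul_eSet_mem (fun i _ => by rw [one_mul]; exact V.e_mem_grading i) D

theorem psi_mul_eW_mem {k : ℕ} {hk : k + 1 < n} {w : Word n m}
    (h : w.1 ⟨k, by omega⟩ ≠ w.1 ⟨k + 1, hk⟩) :
    V.psi (k + 1) * D.eW lam γ w ∈ V.grading Γ lam γ β 0 := by
  refine mul_eSet_mem (fun i hi => ?_) D
  rw [← D.psiDeg_eq_zero (lam := lam) (γ := γ) (i := i.1) (k := k) (hk := hk) (by
    rw [← hi] at h; exact h)]
  exact V.psi_e_mem_grading _ _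

variable {M : Word n m → Word n m → V Γ lam γ β}
  (U : MatUnits (D.eW lam γ) (fun k => V.psi (k + 1)) M)

include U in
-- Matrix units are products of exchanges of different letters, in both directions, and these have
-- degree `0`.
theorem matUnits_mem (w u : Word n m) : M w u ∈ V.grading Γ lam γ β 0 := by
  obtain ⟨w₀, h₀⟩ := Word.exists_monotone 1 w
  have hmul : ∀ {x y : V Γ lam γ β}, x ∈ V.grading Γ lam γ β 0 → y ∈ V.grading Γ lam γ β 0 →
      x * y ∈ V.grading Γ lam γ β 0 := fun hx hy => by
    have := SetLike.GradedMul.mul_mem hx hy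
    rwa [add_zero] at this
  have key : ∀ w, M w w₀ ∈ V.grading Γ lam γ β 0 ∧ M w₀ w ∈ V.grading Γ lam γ β 0 := by
    intro w
    induction w using Word.sort_induction 1 with
    | h w ih =>
      by_cases hw : Monotone w.1
      · obtain rfl := Word.eq_of_monotone (π := 1) h₀ hw
        rw [U.diag]
        exact ⟨eSet_mem _ D, eSet_mem _ D⟩
      · obtain ⟨k, hk, h⟩ := Word.exists_descent (π := 1) hw
        have h1 : w.1 ⟨k, by omega⟩ ≠ w.1 ⟨k + 1, hk⟩ := (show w.1 _ < w.1 _ from h).ne'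
        have h2 : (w.sw k hk).1 ⟨k, by omega⟩ ≠ (w.sw k hk).1 ⟨k + 1, hk⟩ := by
          simpa [Word.sw_apply] using h1.symm
        have e1 := U.sw_eq k hk _ h2
        rw [Word.sw_sw] at e1
        have ih := ih _ (Word.key_sw_lt h)
        rw [← U.mul w (w.sw k hk) w₀, ← U.mul w₀ (w.sw k hk) w, e1, U.sw_eq k hk w h1]
        exact ⟨hmul (psi_mul_eW_mem h2) ih.1, hmul ih.2 (psi_mul_eW_mem h1)⟩
  rw [← U.mul w w₀ u]
  exact hmul (key w).1 (key u).2

/-- The components on the various words are conjugate by matrix units of degree `0`, so homogeneity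
can be tested on one word. -/
theorem fromPart_mem_of {j : Fin d} {x} {k : ℤ} (v : Word n m)
    (h : fromPart U j x * D.eW lam γ v ∈ V.grading Γ lam γ β k) :
    fromPart U j x ∈ V.grading Γ lam γ β k := by
  rw [← mul_one (fromPart U j x), ← sum_eW (D := D), Finset.mul_sum]
  refine sum_mem fun w _ => ?_
  have h1 : fromPart U j x * D.eW lam γ w = M w v * (fromPart U j x * D.eW lam γ v) * M v w := by
    rw [← U.diag v, ← mul_assoc, ← fromPart_comm_matUnits, mul_assoc, mul_assoc, U.mul, U.mul,
      U.diag]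
  rw [h1]
  have := SetLike.GradedMul.mul_mem (SetLike.GradedMul.mul_mem (matUnits_mem U w v) h)
    (matUnits_mem U v w)
  rwa [zero_add, add_zero] at this

theorem fromPart_psi_e_mem {j : Fin d} {v : Word n m} {b c : ℕ} {x}
    (h : fromPart U j (V.psi b) * D.eW lam γ v = V.psi c * D.eW lam γ v) {k : ℤ}
    (hk : ∀ i, D.word i = v → D.sub i j = x → psiDeg Γ lam γ i.1 c = k) :
    fromPart U j (V.psi b * V.e x) ∈ V.grading Γ lam γ β k := by
  have := D.finite
  refine fromPart_mem_of U v ?_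
  have h1 : fromPart U j (V.psi b * V.e x) * D.eW lam γ v =
      V.psi c * V.eSet {i | D.word i = v ∧ D.sub i j = x} := by
    have h2 : D.eW lam γ v * V.eSet {i | D.word i = v ∧ D.sub i j = x} =
        V.eSet {i | D.word i = v ∧ D.sub i j = x} :=
      V.eSet_mul_eSet_of_subset fun i hi => hi.1
    rw [map_mul, mul_assoc, fromPart_e, ← h2, ← mul_assoc, h, mul_assoc]
  rw [h1]
  refine mul_eSet_mem (fun i hi => ?_) D
  rw [← hk i hi.1 hi.2]
  exact V.psi_e_mem_grading _ _

theorem fromPart_mem {j : Fin d} {x} {k : ℤ} (hx : x ∈ D.partGrading lam γ j k) :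
    fromPart U j x ∈ V.grading Γ lam γ β k := by
  refine V.map_grading (V.grading Γ lam γ β) (fromPart U j) (fun x => ?_) (fun a ha => ?_)
    (fun b x hb => ?_) hx
  · refine fromPart_mem_of U (D.sorted j) ?_
    rw [fromPart_e]
    exact eSet_mem _ D
  · obtain ⟨h1, h2, h3⟩ := (D.sorted j).posN_spec ha
    refine fromPart_mem_of U (D.sorted j) ?_
    rw [fromPart_y U h2 h3]
    have := SetLike.GradedMul.mul_mem (V.y_mem_grading (Γ := Γ) (lam := lam) (γ := γ) (β := β)
      ((D.sorted j).posN j a)) (eSet_mem (lam := lam) (γ := γ) {i | D.word i = D.sorted j} D)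
    rwa [add_zero] at this
  · cases b with
    | zero =>
      obtain ⟨h1, h2⟩ := D.sorted_apply hb
      refine fromPart_psi_e_mem U (fromPart_psi0 U h2) fun i hi hx => ?_
      rw [← hi] at h2
      rw [← hx, psiDeg_sub_zero (h0 := h1) h2]
    | succ b =>
      obtain ⟨k, hk, h1, h2, h3⟩ := D.sorted_adj j hb
      refine fromPart_psi_e_mem U (fromPart_psi U h1 h2 h3) fun i hi hx => ?_
      rw [← hi] at h1 h2 h3
      rw [← hx, psiDeg_sub h1 h2 h3]

theorem ofMat_mem {k : ℤ} {N : Matrix (Word n m) (Word n m) (D.T lam γ)}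
    (hN : N ∈ entryGrading (Word n m) (tensorGrading (D.partGrading lam γ)) k) :
    ofMat U N ∈ V.grading Γ lam γ β k := by
  rw [Matrix.matrix_eq_sum_single N, map_sum]
  refine sum_mem fun w _ => ?_
  rw [map_sum]
  refine sum_mem fun u _ => ?_
  rw [ofMat_single]
  have h : ofTensor U (N w u) ∈ V.grading Γ lam γ β k :=
    commLift_mem (𝒢 := D.partGrading lam γ) (fun j k x hx => fromPart_mem U hx) (hN w u)
  have := SetLike.GradedMul.mul_mem (matUnits_mem U w u) h
  rwa [zero_add] at this

/-- The graded isomorphism between `V_β(Γ, λ, γ)` and the matrix algebra. -/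
theorem exists_algEquiv (D : Decomp Γ p m β) (lam : I → ℕ) (γ : I → K) :
    ∃ Φ : V Γ lam γ β ≃ₐ[K] Matrix (Fin (Nat.multinomial Finset.univ m))
      (Fin (Nat.multinomial Finset.univ m)) (D.T lam γ),
      ∀ k, (V.grading Γ lam γ β k).map Φ.toLinearMap =
        matrixGrading (Nat.multinomial Finset.univ m) (tensorGrading (D.partGrading lam γ)) k := by
  obtain ⟨M, U⟩ := (D.shuffle lam γ).exists_matUnits
  let e : Word n m ≃ Fin (Nat.multinomial Finset.univ m) :=
    Fintype.equivFinOfCardEq (Word.card_eq (D.word ⟨_, D.nonempty.some_mem⟩))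
  refine ⟨(matEquiv U).trans (Matrix.reindexAlgEquiv K _ e), fun k => ?_⟩
  ext N
  constructor
  · rintro ⟨x, hx, rfl⟩ s t
    exact toMat_mem hx (e.symm s) (e.symm t)
  -- Equality of the graded pieces, not just an inclusion, needs homogeneity of the inverse as well.
  · intro hN
    refine ⟨ofMat U (N.submatrix e e), ofMat_mem U fun s t => hN (e s) (e t), ?_⟩
    change (D.toMat lam γ (ofMat U (N.submatrix e e))).submatrix e.symm e.symm = N
    rw [toMat_ofMat]
    simp

end Decomp

end GradedMaps

/-! ### Orbits of the group of signed permutations -/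

section Orbit

variable {I : Type u} {A : Type v} {Γ : InvQuiver I A} {n d : ℕ} {p : I → Fin d}

/-- The signed permutation whose inverse maps `a` to `ε(a) σ(a)`. -/
def signedPerm (σ : Equiv.Perm (Fin n)) (ε : Fin n → ℤˣ) : SignedPerm n :=
  ⟨(Equiv.mk (fun x => (σ x.1, ε x.1 * x.2)) (fun x => (σ.symm x.1, (ε (σ.symm x.1))⁻¹ * x.2))
    (fun x => by simp [← mul_assoc]) (fun x => by simp [← mul_assoc]) : Equiv.Perm (Fin n × ℤˣ))⁻¹,
    (SignedPerm n).inv_mem fun x => by simp [flip]⟩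

/-- A signed permutation is a permutation of the positions together with signs, and a sign decides
whether `θ` is applied to an entry. Conversely, the signs are read off from the entries. -/
theorem mem_orbit_iff {i i₀ : Fin n → I} : i ∈ Γ.orbit i₀ ↔
    ∃ σ : Equiv.Perm (Fin n), ∀ a, i a = i₀ (σ a) ∨ i a = Γ.θ (i₀ (σ a)) := by
  constructor
  · rintro ⟨π, rfl⟩
    have hinj : Function.Injective (fun a : Fin n => ((π⁻¹ : SignedPerm n).1 (a, 1)).1) := by
      intro a b hab
      have key : (π⁻¹ : SignedPerm n).1 (a, 1) = (π⁻¹ : SignedPerm n).1 (b, 1) ∨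
          (π⁻¹ : SignedPerm n).1 (a, 1) = (π⁻¹ : SignedPerm n).1 (flip (b, 1)) := by
        rw [(π⁻¹ : SignedPerm n).2]
        rcases (show ∀ s t : ℤˣ, s = t ∨ s = -t by decide) ((π⁻¹ : SignedPerm n).1 (a, 1)).2
          ((π⁻¹ : SignedPerm n).1 (b, 1)).2 with h | h
        · exact Or.inl (Prod.ext hab h)
        · exact Or.inr (Prod.ext hab h)
      rcases key with h | h
      · exact congrArg Prod.fst ((π⁻¹ : SignedPerm n).1.injective h)
      · exact congrArg Prod.fst ((π⁻¹ : SignedPerm n).1.injective h)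
    refine ⟨Equiv.ofBijective _ (Finite.injective_iff_bijective.mp hinj), fun a => ?_⟩
    change Γ.entry i₀ ((π⁻¹ : SignedPerm n).1 (a, 1)) = i₀ ((π⁻¹ : SignedPerm n).1 (a, 1)).1 ∨
      Γ.entry i₀ ((π⁻¹ : SignedPerm n).1 (a, 1)) = Γ.θ (i₀ ((π⁻¹ : SignedPerm n).1 (a, 1)).1)
    unfold InvQuiver.entry
    split_ifs
    · exact Or.inl rfl
    · exact Or.inr rfl
  · classical
    rintro ⟨σ, h⟩
    refine ⟨signedPerm σ fun a => if i a = i₀ (σ a) then 1 else -1, funext fun a => ?_⟩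
    change Γ.entry i₀ (σ a, (if i a = i₀ (σ a) then 1 else -1) * 1) = i a
    by_cases ha : i a = i₀ (σ a)
    · simp [InvQuiver.entry, ha]
    · have h1 : (-1 : ℤˣ) ≠ 1 := by decide
      rw [if_neg ha, mul_one, InvQuiver.entry, if_neg h1, (h a).resolve_left ha]

theorem orbit_stable (i₀ : Fin n → I) : Stable (Γ.orbit i₀) Γ where
  finite := Set.finite_range _
  swap_mem i hi k hk := by
    obtain ⟨σ, h⟩ := mem_orbit_iff.mp hi
    exact mem_orbit_iff.mpr ⟨(Equiv.swap _ _).trans σ, fun a => h _⟩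
  theta_mem i hi h0 := by
    obtain ⟨σ, h⟩ := mem_orbit_iff.mp hi
    refine mem_orbit_iff.mpr ⟨σ, fun a => ?_⟩
    by_cases ha : a = ⟨0, h0⟩
    · subst ha
      rw [Function.update_self]
      rcases h ⟨0, h0⟩ with h1 | h1
      · exact Or.inr (congrArg Γ.θ h1)
      · exact Or.inl (by rw [h1, Γ.θ_invol])
    · rw [Function.update_of_ne ha]
      exact h a

/-- For each part the hypothesis matches the positions of `i` in that part injectively with
positions of `i₀`, the entries agreeing up to `θ`. Since `θ` preserves the parts, the images for
different parts are disjoint, and the matchings unite to a permutation. -/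
theorem orbit_glue (hθ : ∀ i, p (Γ.θ i) = p i) {i i₀ : Fin n → I} {m : Fin d → ℕ}
    (h : ∀ j, (subtuples p {i} j (m j) ∩ subtuples p (Γ.orbit i₀) j (m j)).Nonempty) :
    i ∈ Γ.orbit i₀ := by
  have key : ∀ j, ∃ τ : {a // p (i a) = j} → Fin n, Function.Injective τ ∧
      ∀ a, p (i₀ (τ a)) = j ∧ (i a = i₀ (τ a) ∨ i a = Γ.θ (i₀ (τ a))) := by
    intro j
    obtain ⟨x, ⟨i'', hi'', g, hg, hxg⟩, i', hi', f, hf, hxf⟩ := h j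
    rw [Set.mem_singleton_iff.mp hi''] at hg hxg
    obtain ⟨σ, hσ⟩ := mem_orbit_iff.mp hi'
    have hk : ∀ a : {a // p (i a) = j}, ∃ k, g k = a := fun a => by
      have : a.1 ∈ Set.range g := by rw [hg]; exact a.2
      exact this
    choose k hk using hk
    refine ⟨fun a => σ (f (k a)), fun a b hab => ?_, fun a => ?_⟩
    · have h1 := f.injective (σ.injective hab)
      exact Subtype.ext (by rw [← hk a, ← hk b, h1])
    · have h1 : i a = i' (f (k a)) := by rw [← hk a, ← hxg, hxf]
      have h2 := hσ (f (k a))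
      rw [← h1] at h2
      refine ⟨?_, h2⟩
      refine Eq.trans ?_ a.2
      rcases h2 with h2 | h2
      · rw [h2]
      · rw [h2, hθ]
  choose τ hτ hτ' using key
  have hinj : Function.Injective fun a => τ (p (i a)) ⟨a, rfl⟩ := by
    intro a b hab
    have h1 := (hτ' (p (i a)) ⟨a, rfl⟩).1
    have h2 := (hτ' (p (i b)) ⟨b, rfl⟩).1
    have hab : τ (p (i a)) ⟨a, rfl⟩ = τ (p (i b)) ⟨b, rfl⟩ := hab
    rw [hab, h2] at h1
    have h3 : ∀ j (hj : p (i b) = j), τ (p (i b)) ⟨b, rfl⟩ = τ j ⟨b, hj⟩ := by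
      rintro _ rfl; rfl
    rw [h3 _ h1] at hab
    exact congrArg Subtype.val (hτ _ hab)
  exact mem_orbit_iff.mpr ⟨Equiv.ofBijective _ (Finite.injective_iff_bijective.mp hinj),
    fun a => (hτ' _ ⟨a, rfl⟩).2⟩

theorem orbit_decomp (hA : ∀ a, p (Γ.o a) = p (Γ.t a)) (hθ : ∀ i, p (Γ.θ i) = p i)
    (i₀ : Fin n → I) : Decomp Γ p (partSize p i₀) (Γ.orbit i₀) where
  toStable := orbit_stable i₀
  arrows_part := hA
  θ_part := hθ
  nonempty := ⟨i₀, mem_orbit_iff.mpr ⟨1, fun _ => Or.inl rfl⟩⟩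
  content _ hi j := partSize_eq_of_mem_orbit hθ hi j
  glue _ _ h := orbit_glue hθ h

end Orbit

end TypeB

/-! ### The theorem -/

theorem theorem4p1 {I A K : Type*} [CommRing K]
    -- the quiver with involution and the weights
    (Γ : TypeB.InvQuiver I A) (lam : I → ℕ) (γ : I → K)
    (hγ : ∀ i, Γ.θ i ≠ i → γ i = 0)
    (hγ' : ∀ i, γ i = 0 → Γ.θ i ≠ i ∨ Γ.d₁ lam γ i = 0)
    -- the decomposition into `θ`-stable full subquivers without arrows between them
    {d : ℕ} (hd : 0 < d) (p : I → Fin d)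
    (hpA : ∀ a, p (Γ.o a) = p (Γ.t a))
    (hpθ : ∀ i, p (Γ.θ i) = p i)
    -- the `B_n`-orbit, given by one of its elements
    {n : ℕ} (i₀ : Fin n → I) :
    -- both sides are graded algebras
    Nonempty (GradedAlgebra (TypeB.V.grading Γ lam γ (Γ.orbit i₀))) ∧
    Nonempty (GradedAlgebra
      (TypeB.matrixGrading (Nat.multinomial Finset.univ (TypeB.partSize p i₀))
        (TypeB.tensorGrading (TypeB.VPart.grading p Γ lam γ hpθ i₀)))) ∧
    -- and they are isomorphic as graded algebras
    ∃ Φ : TypeB.V Γ lam γ (Γ.orbit i₀) ≃ₐ[K]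
        Matrix (Fin (Nat.multinomial Finset.univ (TypeB.partSize p i₀)))
          (Fin (Nat.multinomial Finset.univ (TypeB.partSize p i₀)))
          (PiTensorProduct K (TypeB.VPart p Γ lam γ hpθ i₀)),
      ∀ k : ℤ,
        (TypeB.V.grading Γ lam γ (Γ.orbit i₀) k).map Φ.toLinearMap =
          TypeB.matrixGrading (Nat.multinomial Finset.univ (TypeB.partSize p i₀))
            (TypeB.tensorGrading (TypeB.VPart.grading p Γ lam γ hpθ i₀)) k := by
  have D := TypeB.orbit_decomp hpA hpθ i₀
  obtain ⟨Φ, hΦ⟩ := D.exists_algEquiv lam γ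
  obtain ⟨h⟩ := TypeB.V.gradedAlgebra (lam := lam) D.toStable hγ
  -- That the total grading makes the matrix algebra a graded algebra is not checked directly but
  -- transported from `V_β` along the isomorphism.
  exact ⟨⟨h⟩, TypeB.gradedAlgebra_of_algEquiv Φ h hΦ, Φ, hΦ⟩
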